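/- Let $\mathbf{k}$ be a field of characteristic zero, let $n\ge 1$, $e\ge 0$ and $m,d,r\ge 2$ be integers with $(n,e)\ne(1,0)$ and $\gcd(d,r)=1$, and let $Q\in\mathbf{k}[X,S,T]$ be a polynomial. Let $$B=\mathbf{k}[X,Y,Z,T]/\langle X^{n}Y-(Y^{m}-X^{e}Z)^{d}-T^{r}-X\,Q(X,Y^{m}-X^{e}Z,T)\rangle ,$$ let $x,y,z,t\in B$ be the classes of $X,Y,Z,T$, and put $s=y^{m}-x^{e}z\in B$. Then $x,s,t$ are algebraically independent over $\mathbf{k}$, so that the subalgebra $\mathbf{k}[x,s,t]\subseteq B$ is a polynomial ring in three variables and is contained in the polynomial ring $\mathbf{k}(x)[s,t]$ in two variables over the field $\mathbf{k}(x)$. Moreover, for every non-zero locally nilpotent $\mathbf{k}$-derivation $\partial$ of $B$ (that is, for every $a\in B$ there is $N\ge 0$ with $\partial^{N}(a)=0$) there exists $F\in\mathbf{k}[x,s,t]$ such that $F$ is a $\mathbf{k}(x)$-variable of $\mathbf{k}(x)[s,t]$, i.e. $\mathbf{k}(x)[s,t]=\mathbf{k}(x)[F,G]$ for some $G\in\mathbf{k}(x)[s,t]$,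 and such that $\ker\partial=\mathbf{k}[x,F]$, where $x$ and $F$ are algebraically independent over $\mathbf{k}$; thus $\ker\partial$ is a polynomial ring in two variables over $\mathbf{k}$. -/

import Mathlib

/-- A derivation `∂` is locally nilpotent if every element is killed by some power of `∂`. -/
def Derivation.IsLocallyNilpotent {k A : Type*} [CommRing k] [CommRing A] [Algebra k A]
    (D : Derivation k A A) : Prop :=
  ∀ a : A, ∃ N : ℕ, (⇑D)^[N] a = 0

/-- The kernel of a `k`-derivation of `A`, as a `k`-subalgebra of `A`. -/
def Derivation.kerSubalgebra {k A : Type*} [CommRing k] [CommRing A] [Algebra k A]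
    (D : Derivation k A A) : Subalgebra k A where
  carrier := {a | D a = 0}
  mul_mem' := by
    intro a b ha hb
    simp only [Set.mem_ofPred_eq] at ha hb ⊢
    simp [ha, hb]
  add_mem' := by
    intro a b ha hb
    simp only [Set.mem_ofPred_eq] at ha hb ⊢
    simp [ha, hb]
  algebraMap_mem' := by
    intro c
    simp

/-- `F` is a `K`-variable of the polynomial ring `K[s,t]` if `K[s,t] = K[F,G]` for some `G`. -/
def IsPolyVariable (K : Type*) [CommRing K] (F : MvPolynomial (Fin 2) K) : Prop :=
  ∃ G : MvPolynomial (Fin 2) K, Algebra.adjoin K {F, G} = ⊤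

namespace NewClass

/-- The element `S = Y ^ m - X ^ e * Z` of `k[X,Y,Z,T]`; the variables `X, Y, Z, T` have the
indices `0, 1, 2, 3`. -/
noncomputable def sPoly (k : Type*) [Field k] (m e : ℕ) : MvPolynomial (Fin 4) k :=
  MvPolynomial.X 1 ^ m - MvPolynomial.X 0 ^ e * MvPolynomial.X 2

/-- `X ^ n * Y - S ^ d - T ^ r - X * Q(X, S, T)` in `k[X,Y,Z,T]`, where `S = Y ^ m - X ^ e * Z`. -/
noncomputable def relPoly {k : Type*} [Field k] (n e m d r : ℕ) (Q : MvPolynomial (Fin 3) k) :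
    MvPolynomial (Fin 4) k :=
  MvPolynomial.X 0 ^ n * MvPolynomial.X 1 - sPoly k m e ^ d - MvPolynomial.X 3 ^ r -
    MvPolynomial.X 0 *
      MvPolynomial.aeval ![MvPolynomial.X 0, sPoly k m e, MvPolynomial.X 3] Q

/-- The `k`-algebra `B = k[X,Y,Z,T] / ⟨X ^ n * Y - S ^ d - T ^ r - X * Q(X, S, T)⟩`. -/
abbrev B {k : Type*} [Field k] (n e m d r : ℕ) (Q : MvPolynomial (Fin 3) k) : Type _ :=
  MvPolynomial (Fin 4) k ⧸ Ideal.span {relPoly n e m d r Q}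

section Elements

variable {k : Type*} [Field k] (n e m d r : ℕ) (Q : MvPolynomial (Fin 3) k)

/-- The class `x` of `X` in `B`. -/
noncomputable def x : B n e m d r Q := Ideal.Quotient.mk _ (MvPolynomial.X 0)

/-- The class `y` of `Y` in `B`. -/
noncomputable def y : B n e m d r Q := Ideal.Quotient.mk _ (MvPolynomial.X 1)

/-- The class `z` of `Z` in `B`. -/
noncomputable def z : B n e m d r Q := Ideal.Quotient.mk _ (MvPolynomial.X 2)

/-- The class `t` of `T` in `B`. -/
noncomputable def t : B n e m d r Q := Ideal.Quotient.mk _ (MvPolynomial.X 3)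

/-- The element `s = y ^ m - x ^ e * z` of `B`. -/
noncomputable def s : B n e m d r Q := y n e m d r Q ^ m - x n e m d r Q ^ e * z n e m d r Q

/-- The element `f(x, s, t)` of `k[x,s,t] ⊆ B` given by a polynomial `f` in three variables. -/
noncomputable def evalXST (f : MvPolynomial (Fin 3) k) : B n e m d r Q :=
  MvPolynomial.aeval ![x n e m d r Q, s n e m d r Q, t n e m d r Q] f

end Elements

/-- The inclusion `k[x,s,t] → k(x)[s,t]` of polynomial rings: `x` goes to the constant `x`, and
`s`, `t` go to the two variables. -/
noncomputable def toRatPoly (k : Type*) [Field k] :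
    MvPolynomial (Fin 3) k →ₐ[k] MvPolynomial (Fin 2) (RatFunc k) :=
  MvPolynomial.aeval ![MvPolynomial.C RatFunc.X, MvPolynomial.X 0, MvPolynomial.X 1]

end NewClass

/-! Inverting `x` turns `B` into `k[x, 1/x, s, t]`, so `B` embeds into a Laurent polynomial ring,
with `y = x⁻ⁿ(sᵈ + tʳ + xQ)` and `z = x⁻ᵉ(yᵐ - s)`. Three facts about a nonzero locally nilpotent
derivation `∂` of `B` give the result.

The kernel lies in `k[x, s, t]` (`exists_evalXST_eq_of_apply_eq_zero`). Order Laurent monomials by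
the exponent of `x`, then by the weights `(r, d)` of `(s, t)`. The lowest component `δ` of `∂` is
nilpotent on initial forms of elements of `B`, and these have the shape `xⁱ p(s,t) y₀ʲ z₀^q` with `j
< m`, `p` quasi-homogeneous, and `x^(nm+e) z₀ = (sᵈ + tʳ)ᵐ`. A kernel element outside `k[x, s, t]`
forces `δ z₀ = 0`. The exponential of `δ` turns the relation into an identity of univariate
polynomials, and degree estimates show that `δ` would vanish if it also killed `x` or a nonconstant
quasi-homogeneous `p(s,t)`. Hence the relevant homogeneous kernel elements have degrees on one line,
so that all nonzero combinations of `sᵈ` and `tʳ` survive equally many applications of `δ` and end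
at multiples of the same monomial. Some combination then dies too early.

The kernel contains `x` (`apply_x_eq_zero`). It has transcendence degree at least two, so some
nonzero kernel element vanishes on the curve `x = 0`, `sᵈ + tʳ = 0`. It is divisible by `x` in `B`,
and kernels are factorially closed.

Therefore `∂` extends to a `k(x)`-derivation of `k(x)[s,t]`, whose kernel is generated by a variable
by Rentschler's theorem (`exists_kerSubalgebra_eq_adjoin_variable`, proved over the algebraic
closure and descended). Normalizing that variable to a primitive `F` in `k[x][s,t]` without constant
term gives `k(x)[F] ∩ k[x,s,t] = k[x,F]`. -/

set_option linter.unusedSectionVars false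

/-! ### Locally nilpotent derivations: exponential map, factorially closed kernel, local slices. -/

/-- The Leibniz rule for the iterates of a derivation. -/
theorem Derivation.iterate_mul {k A : Type*} [CommRing k] [CommRing A] [Algebra k A]
    (D : Derivation k A A) (n : ℕ) (a b : A) :
    (⇑D)^[n] (a * b) = ∑ p ∈ Finset.HasAntidiagonal.antidiagonal n, n.choose p.1 • ((⇑D)^[p.1] a * (⇑D)^[p.2] b) := by
  induction n with
  | zero => simp
  | succ n ih =>
    rw [Finset.sum_antidiagonal_choose_succ_nsmul (fun i j => (⇑D)^[i] a * (⇑D)^[j] b) n,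
      Function.iterate_succ_apply', ih, map_sum, ← Finset.sum_add_distrib]
    refine Finset.sum_congr rfl fun p hp => ?_
    have h1 : n.choose p.2 = n.choose p.1 := by
      rw [← Finset.HasAntidiagonal.mem_antidiagonal.1 hp]
      exact (Nat.choose_symm_add).symm
    rw [map_nsmul, Derivation.leibniz, h1, ← smul_add]
    simp only [Function.iterate_succ_apply', smul_eq_mul]
    ring_nf

namespace Derivation

variable {k A : Type*} [Field k] [CharZero k] [CommRing A] [Algebra k A]

theorem iterate_map_add (D : Derivation k A A) (n : ℕ) (a b : A) :
    (⇑D)^[n] (a + b) = (⇑D)^[n] a + (⇑D)^[n] b :=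
  _root_.iterate_map_add D n a b

theorem iterate_map_smul (D : Derivation k A A) (n : ℕ) (c : k) (a : A) :
    (⇑D)^[n] (c • a) = c • (⇑D)^[n] a := by
  induction n with
  | zero => rfl
  | succ n ih => simp only [Function.iterate_succ_apply', ih, map_smul]

theorem iterate_eq_zero_of_le (D : Derivation k A A) {m n : ℕ} (h : m ≤ n) {a : A}
    (ha : (⇑D)^[m] a = 0) : (⇑D)^[n] a = 0 := by
  obtain ⟨j, rfl⟩ := Nat.exists_eq_add_of_le' h
  rw [Function.iterate_add_apply, ha]
  exact iterate_map_zero D j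

/-- The exponential map `a ↦ ∑ Dⁿ(a) / n! Xⁿ` of a derivation. -/
noncomputable def expHom (D : Derivation k A A) : A →ₐ[k] PowerSeries A where
  toFun a := PowerSeries.mk fun n => ((n.factorial : k)⁻¹) • (⇑D)^[n] a
  map_one' := by
    ext n
    rcases n with _ | n
    · simp
    · simp [PowerSeries.coeff_one, Function.iterate_succ_apply]
  map_zero' := by ext n; simp
  map_add' a b := by ext n; simp [smul_add]
  map_mul' a b := by
    ext n
    simp only [PowerSeries.coeff_mk, PowerSeries.coeff_mul]
    rw [D.iterate_mul, Finset.smul_sum]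
    refine Finset.sum_congr rfl fun p hp => ?_
    obtain rfl := (Finset.HasAntidiagonal.mem_antidiagonal.1 hp)
    rw [smul_mul_smul_comm, ← Nat.cast_smul_eq_nsmul k, smul_smul]
    congr 1
    have h := Nat.add_choose_mul_factorial_mul_factorial p.1 p.2
    have h1 : (p.1.factorial : k) ≠ 0 := by exact_mod_cast p.1.factorial_ne_zero
    have h2 : (p.2.factorial : k) ≠ 0 := by exact_mod_cast p.2.factorial_ne_zero
    have h3 : ((p.1 + p.2).factorial : k) ≠ 0 := by exact_mod_cast (p.1 + p.2).factorial_ne_zero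
    rw [← Nat.choose_symm_add, ← Nat.cast_inj (R := k)] at h
    push_cast at h
    field_simp
    linear_combination h
  commutes' c := by
    ext n
    rcases n with _ | n
    · simp [PowerSeries.algebraMap_apply]
    · simp [PowerSeries.algebraMap_apply, Function.iterate_succ_apply]

variable (D : Derivation k A A)

theorem coeff_expHom (n : ℕ) (a : A) :
    PowerSeries.coeff n (D.expHom a) = ((n.factorial : k)⁻¹) • (⇑D)^[n] a := by
  simp [expHom]

theorem expHom_of_apply_eq_zero {a : A} (h : D a = 0) : D.expHom a = PowerSeries.C a := by
  ext n
  rw [coeff_expHom]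
  rcases n with _ | n
  · simp
  · simp [Function.iterate_succ_apply, h]

theorem expHom_injective : Function.Injective D.expHom := by
  intro a b h
  have := congrArg (PowerSeries.coeff 0) h
  simpa [coeff_expHom] using this

/-- The elements killed by some power of `D` form a subalgebra. -/
noncomputable def nilSubalgebra : Subalgebra k A :=
  ((Polynomial.coeToPowerSeries.algHom (R := A) A).restrictScalars k).range.comap D.expHom

theorem mem_nilSubalgebra_iff_exists {a : A} :
    a ∈ D.nilSubalgebra ↔ ∃ q : Polynomial A, (q : PowerSeries A) = D.expHom a := by
  simp [nilSubalgebra, Polynomial.coeToPowerSeries.algHom_apply]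

/-- In characteristic zero the coefficients `Dⁿ(a)/n!` of the exponential vanish exactly when
`Dⁿ(a)` does. -/
theorem mem_nilSubalgebra {a : A} : a ∈ D.nilSubalgebra ↔ ∃ N : ℕ, (⇑D)^[N] a = 0 := by
  rw [mem_nilSubalgebra_iff_exists]
  constructor
  · rintro ⟨q, hq⟩
    refine ⟨q.natDegree + 1, ?_⟩
    have h := congrArg (PowerSeries.coeff (q.natDegree + 1)) hq
    rw [coeff_expHom, Polynomial.coeff_coe,
      Polynomial.coeff_eq_zero_of_natDegree_lt (Nat.lt_succ_self _)] at h
    have h3 : ((q.natDegree + 1).factorial : k)⁻¹ ≠ 0 :=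
      inv_ne_zero (by exact_mod_cast (q.natDegree + 1).factorial_ne_zero)
    exact (smul_eq_zero_iff_right h3).1 h.symm
  · rintro ⟨N, hN⟩
    refine ⟨PowerSeries.trunc N (D.expHom a), ?_⟩
    ext n
    rw [Polynomial.coeff_coe, PowerSeries.coeff_trunc]
    split_ifs with h
    · rfl
    · rw [coeff_expHom, D.iterate_eq_zero_of_le (not_lt.1 h) hN, smul_zero]

theorem isLocallyNilpotent_iff : D.IsLocallyNilpotent ↔ D.nilSubalgebra = ⊤ := by
  rw [IsLocallyNilpotent, eq_top_iff]
  exact ⟨fun h a _ => D.mem_nilSubalgebra.2 (h a), fun h a => D.mem_nilSubalgebra.1 (h trivial)⟩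

variable {D}

/-- The degree of the exponential polynomial measures the order of nilpotency. Its additivity over a
domain is what makes kernels factorially closed. -/
theorem apply_eq_zero_iff_natDegree {a : A} {q : Polynomial A}
    (hq : (q : PowerSeries A) = D.expHom a) : D a = 0 ↔ q.natDegree = 0 := by
  constructor
  · intro h
    rw [expHom_of_apply_eq_zero D h, ← Polynomial.coe_C, Polynomial.coe_inj] at hq
    rw [hq, Polynomial.natDegree_C]
  · intro h
    have h1 := congrArg (PowerSeries.coeff 1) hq
    rw [Polynomial.coeff_coe, Polynomial.coeff_eq_zero_of_natDegree_lt (by omega),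
      coeff_expHom] at h1
    simpa using h1.symm

/-- The kernel of a locally nilpotent derivation is factorially closed. -/
theorem apply_eq_zero_of_mul [IsDomain A] {a b : A} (ha : a ∈ D.nilSubalgebra)
    (hb : b ∈ D.nilSubalgebra) (hab : a * b ≠ 0) (h : D (a * b) = 0) : D a = 0 := by
  obtain ⟨q, hq⟩ := D.mem_nilSubalgebra_iff_exists.1 ha
  obtain ⟨q', hq'⟩ := D.mem_nilSubalgebra_iff_exists.1 hb
  have hm : ((q * q' : Polynomial A) : PowerSeries A) = D.expHom (a * b) := by
    rw [Polynomial.coe_mul, hq, hq', map_mul]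
  have h0 : q * q' ≠ 0 := by
    intro h0
    rw [h0, Polynomial.coe_zero] at hm
    exact hab (D.expHom_injective (by rw [← hm, map_zero]))
  rw [apply_eq_zero_iff_natDegree hm,
    Polynomial.natDegree_mul (left_ne_zero_of_mul h0) (right_ne_zero_of_mul h0)] at h
  rw [apply_eq_zero_iff_natDegree hq]
  omega

theorem IsLocallyNilpotent.apply_eq_zero_of_mul [IsDomain A] (hD : D.IsLocallyNilpotent) {a b : A}
    (hab : a * b ≠ 0) (h : D (a * b) = 0) : D a = 0 ∧ D b = 0 := by
  rw [isLocallyNilpotent_iff] at hD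
  have hm : ∀ c : A, c ∈ D.nilSubalgebra := fun c => hD ▸ trivial
  exact ⟨Derivation.apply_eq_zero_of_mul (hm a) (hm b) hab h,
    Derivation.apply_eq_zero_of_mul (hm b) (hm a) (by rwa [mul_comm]) (by rwa [mul_comm])⟩

theorem mem_kerSubalgebra {a : A} : a ∈ D.kerSubalgebra ↔ D a = 0 := Iff.rfl

/-- An element outside of the kernel is transcendental over the kernel. -/
theorem IsLocallyNilpotent.transcendental [IsDomain A] (hD : D.IsLocallyNilpotent) {r : A}
    (hr : D r ≠ 0) : Transcendental D.kerSubalgebra r := by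
  rw [transcendental_iff]
  intro p hp
  rw [isLocallyNilpotent_iff] at hD
  obtain ⟨q, hq⟩ := (D.mem_nilSubalgebra_iff_exists (a := r)).1 (hD ▸ trivial)
  have hq0 : q.natDegree ≠ 0 := fun h => hr ((apply_eq_zero_iff_natDegree hq).2 h)
  set p' : Polynomial A := p.map (algebraMap D.kerSubalgebra A) with hp'
  -- The exponential fixes the coefficients of `p` and sends `r` to `q`, of positive degree. Since
  -- degrees multiply under composition, `p` must be constant, hence zero.
  have key : p'.comp q = 0 := by
    apply Polynomial.coe_injective
    have h1 : D.expHom (Polynomial.aeval r p) = 0 := by rw [hp, map_zero]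
    rw [Polynomial.coe_zero, ← h1, Polynomial.aeval_eq_sum_range, map_sum, Polynomial.comp,
      hp', Polynomial.eval₂_map, Polynomial.eval₂_eq_sum_range]
    rw [← Polynomial.coeToPowerSeries.ringHom_apply, map_sum]
    refine Finset.sum_congr rfl fun i _ => ?_
    rw [Algebra.smul_def, map_mul, map_mul, map_pow, map_pow,
      Polynomial.coeToPowerSeries.ringHom_apply, Polynomial.coeToPowerSeries.ringHom_apply, hq,
      expHom_of_apply_eq_zero D (a := algebraMap D.kerSubalgebra A (p.coeff i)) (p.coeff i).2]
    simp
  have hd := congrArg Polynomial.natDegree key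
  rw [Polynomial.natDegree_comp, Polynomial.natDegree_zero, mul_eq_zero, or_iff_left hq0] at hd
  rw [Polynomial.eq_C_of_natDegree_eq_zero hd, Polynomial.C_comp, Polynomial.C_eq_zero,
    hp', Polynomial.coeff_map] at key
  have hinj : Function.Injective (algebraMap D.kerSubalgebra A) := Subtype.val_injective
  rw [hp', Polynomial.natDegree_map_eq_of_injective hinj] at hd
  rw [Polynomial.eq_C_of_natDegree_eq_zero hd, (map_eq_zero_iff _ hinj).1 key, Polynomial.C_0]

/-- A nonzero locally nilpotent derivation has a local slice. -/
theorem IsLocallyNilpotent.exists_localSlice (hD : D.IsLocallyNilpotent) (h0 : D ≠ 0) :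
    ∃ r : A, D r ≠ 0 ∧ D (D r) = 0 := by
  classical
  obtain ⟨a, ha⟩ : ∃ a, D a ≠ 0 := by
    by_contra! h
    exact h0 (Derivation.ext h)
  have hN := hD a
  have h1 : 2 ≤ Nat.find hN := by
    by_contra! h
    have := Nat.find_spec hN
    interval_cases Nat.find hN
    · exact ha (by rw [show a = 0 from this, map_zero])
    · exact ha this
  obtain ⟨N, hNN⟩ := Nat.exists_eq_add_of_le' h1
  have h2 := Nat.find_spec hN
  rw [hNN, Function.iterate_succ_apply', Function.iterate_succ_apply'] at h2
  refine ⟨(⇑D)^[N] a, ?_, h2⟩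
  rw [← Function.iterate_succ_apply' D]
  exact Nat.find_min hN (by omega)

/-- The exponential of a local slice is the linear polynomial `r + D(r)X`, and the coefficient of
`Xⁿ` in its `n`-th power is `D(r)ⁿ`. -/
theorem iterate_pow_localSlice {r : A} (h2 : D (D r) = 0) (n : ℕ) :
    (⇑D)^[n] (r ^ n) = (n.factorial : k) • D r ^ n := by
  have hn : (n.factorial : k) ≠ 0 := by exact_mod_cast n.factorial_ne_zero
  have h1 : ((Polynomial.C r + Polynomial.C (D r) * Polynomial.X : Polynomial A) : PowerSeries A)
      = D.expHom r := by
    ext i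
    rw [Polynomial.coeff_coe, coeff_expHom]
    rcases i with _ | _ | i
    · simp
    · simp
    · rw [D.iterate_eq_zero_of_le (m := 2) (by omega) h2]
      simp
  have h3 := coeff_expHom D n (r ^ n)
  rw [map_pow, ← h1, ← Polynomial.coe_pow, Polynomial.coeff_coe] at h3
  have h4 : ((Polynomial.C r + Polynomial.C (D r) * Polynomial.X : Polynomial A) ^ n).coeff n =
      D r ^ n := by
    have := Polynomial.coeff_pow_of_natDegree_le (p := Polynomial.C r +
      Polynomial.C (D r) * Polynomial.X) (n := 1) (by compute_degree) (m := n)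
    simpa using this
  rw [← h4, h3, smul_smul, mul_inv_cancel₀ hn, one_smul]

/-- Every element is, up to a factor in the kernel, a polynomial in a local slice. -/
theorem IsLocallyNilpotent.exists_mul_mem_adjoin (hD : D.IsLocallyNilpotent) {r : A}
    (h2 : D (D r) = 0) (b : A) :
    ∃ M : ℕ, D r ^ M * b ∈ Algebra.adjoin D.kerSubalgebra {r} := by
  obtain ⟨N, hN⟩ := hD b
  have hker : ∀ c : A, D c = 0 → c ∈ Algebra.adjoin D.kerSubalgebra {r} := fun c hc =>
    (Algebra.adjoin D.kerSubalgebra {r}).algebraMap_mem ⟨c, hc⟩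
  have hk : ∀ (c : k) (a : A), a ∈ Algebra.adjoin D.kerSubalgebra {r} →
      c • a ∈ Algebra.adjoin D.kerSubalgebra {r} := fun c a ha => by
    rw [Algebra.smul_def]
    exact mul_mem (hker _ (D.map_algebraMap c)) ha
  have hrm : r ∈ Algebra.adjoin D.kerSubalgebra {r} := Algebra.self_mem_adjoin_singleton _ _
  induction N generalizing b with
  | zero => exact ⟨0, by rw [show b = 0 from hN, mul_zero]; exact zero_mem _⟩
  | succ N ih =>
    have hn : (N.factorial : k) ≠ 0 := by exact_mod_cast N.factorial_ne_zero
    have hc : D ((⇑D)^[N] b) = 0 := by rw [← Function.iterate_succ_apply' D]; exact hN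
    have hmulker : ∀ (c a : A), D c = 0 → ∀ n, (⇑D)^[n] (c * a) = c * (⇑D)^[n] a := by
      intro c a hc n
      induction n with
      | zero => rfl
      | succ n ih => simp [Function.iterate_succ_apply', ih, hc]
    have hDr : ∀ n : ℕ, D (D r ^ n) = 0 := fun n => by
      rw [Derivation.leibniz_pow, h2]; simp
    -- The correction term has the same `N`-th derivative as `D(r)^N b`, so the difference is killed
    -- by `D^N` and induction applies.
    obtain ⟨M, hM⟩ := ih (D r ^ N * b + (-(N.factorial : k)⁻¹) • ((⇑D)^[N] b * r ^ N)) (by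
      rw [D.iterate_map_add, D.iterate_map_smul, hmulker _ _ hc, iterate_pow_localSlice h2,
        hmulker _ _ (hDr N), mul_smul_comm, smul_smul, neg_mul, inv_mul_cancel₀ hn, neg_smul,
        one_smul]
      ring)
    refine ⟨M + N, ?_⟩
    have : D r ^ (M + N) * b =
        D r ^ M * (D r ^ N * b + (-(N.factorial : k)⁻¹) • ((⇑D)^[N] b * r ^ N)) +
          (N.factorial : k)⁻¹ • (D r ^ M * ((⇑D)^[N] b * r ^ N)) := by
      rw [mul_add, neg_smul, mul_neg, mul_smul_comm]
      ring
    rw [this]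
    exact add_mem hM (hk _ _ (mul_mem (hker _ (hDr M)) (mul_mem (hker _ hc) (pow_mem hrm N))))

/-- The slice theorem. -/
theorem IsLocallyNilpotent.adjoin_slice (hD : D.IsLocallyNilpotent) {r : A}
    (hr : D r = 1) : Algebra.adjoin D.kerSubalgebra {r} = ⊤ := by
  rw [eq_top_iff]
  intro b _
  obtain ⟨M, hM⟩ := hD.exists_mul_mem_adjoin (by rw [hr, D.map_one_eq_zero]) b
  rwa [hr, one_pow, one_mul] at hM

/-- A locally nilpotent derivation lowers the transcendence degree by one. -/
theorem IsLocallyNilpotent.trdeg_eq [IsDomain A] (hD : D.IsLocallyNilpotent) (h0 : D ≠ 0) :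
    Algebra.trdeg k D.kerSubalgebra + 1 = Algebra.trdeg k A := by
  obtain ⟨r, hr, h2⟩ := hD.exists_localSlice h0
  have htr := hD.transcendental hr
  have hind : AlgebraicIndependent D.kerSubalgebra (fun _ : PUnit => r) := by
    rw [algebraicIndependent_unique_type_iff]
    exact htr
  have halg : Algebra.IsAlgebraic (Algebra.adjoin D.kerSubalgebra (Set.range fun _ : PUnit => r)) A := by
    constructor
    intro b
    obtain ⟨M, hM⟩ := hD.exists_mul_mem_adjoin h2 b
    have hS : Set.range (fun _ : PUnit => r) = {r} := Set.range_const
    rw [hS]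
    set S := Algebra.adjoin D.kerSubalgebra {r}
    have hDM : D (D r ^ M) = 0 := by rw [Derivation.leibniz_pow, h2]; simp
    let c : S := ⟨D r ^ M, S.algebraMap_mem ⟨_, hDM⟩⟩
    have hc : c ≠ 0 := fun h => pow_ne_zero M hr (congrArg Subtype.val h)
    -- A relation `D(r)^M b ∈ (ker D)[r]` is a linear equation for `b`.
    refine ⟨Polynomial.C c * Polynomial.X - Polynomial.C ⟨_, hM⟩, ?_, ?_⟩
    · intro h
      have := congrArg (fun p => Polynomial.coeff p 1) h
      simp [Polynomial.coeff_C] at this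
      exact hc this
    · simp [c, Subalgebra.algebraMap_eq]
  have hb := hind.isTranscendenceBasis_iff_isAlgebraic.2 halg
  rw [← trdeg_add_eq k D.kerSubalgebra (A := A), ← hb.cardinalMk_eq_trdeg, Cardinal.mk_punit]

end Derivation

/-! ### Degree estimates for univariate polynomials. -/

namespace Polynomial

variable {F : Type*} [Field F] [CharZero F]

/-- `Sᵈ + c Tʳ` is constant only if `S` and `T` are, for `d, r ≥ 2`. -/
theorem natDegree_eq_zero_of_isUnit_pow_add {S T : F[X]} {c : F} (hc : c ≠ 0) {d r : ℕ}
    (hd : 2 ≤ d) (hr : 2 ≤ r) (h : IsUnit (S ^ d + C c * T ^ r)) :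
    S.natDegree = 0 ∧ T.natDegree = 0 := by
  have hcop : IsCoprime S T := by
    obtain ⟨u, hu⟩ := h.exists_left_inv
    refine ⟨u * S ^ (d - 1), u * C c * T ^ (r - 1), ?_⟩
    rw [← hu]
    obtain ⟨d, rfl⟩ := Nat.exists_eq_add_of_le' hd
    obtain ⟨r, rfl⟩ := Nat.exists_eq_add_of_le' hr
    simp only [show d + 2 - 1 = d + 1 by omega, show r + 2 - 1 = r + 1 by omega]
    ring
  have hder : C (d : F) * S ^ (d - 1) * derivative S
      + C c * (C (r : F) * T ^ (r - 1) * derivative T) = 0 := by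
    have h1 : derivative (S ^ d + C c * T ^ r) = 0 := by
      rw [eq_C_of_natDegree_eq_zero (natDegree_eq_zero_of_isUnit h), derivative_C]
    simpa [derivative_pow] using h1
  have hd0 : (d : F) ≠ 0 := by norm_cast; omega
  have hr0 : (r : F) ≠ 0 := by norm_cast; omega
  have hCu : ∀ a : F, a ≠ 0 → IsUnit (C a) := fun a ha => isUnit_C.2 ha.isUnit
  -- Differentiating the constant `Sᵈ + cTʳ` shows that `S^(d-1)` divides `T^(r-1) T'`, and `S` is
  -- coprime to `T`.
  have h1 : S ^ (d - 1) ∣ derivative T := by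
    have h2 : S ^ (d - 1) ∣ C (c * r) * (T ^ (r - 1) * derivative T) :=
      ⟨-(C (d : F) * derivative S), by rw [C_mul]; linear_combination hder⟩
    exact (hcop.pow).dvd_of_dvd_mul_left
      (((hCu _ (mul_ne_zero hc hr0)).dvd_mul_left).1 h2)
  have h2 : T ^ (r - 1) ∣ derivative S := by
    have h2 : T ^ (r - 1) ∣ C (d : F) * (S ^ (d - 1) * derivative S) :=
      ⟨-(C c * C (r : F) * derivative T), by linear_combination hder⟩
    exact (hcop.symm.pow).dvd_of_dvd_mul_left (((hCu _ hd0).dvd_mul_left).1 h2)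
  have hle : ∀ {P R : F[X]} {j : ℕ}, 1 ≤ j → R ≠ 0 → P ^ j ∣ R → P.natDegree ≤ R.natDegree := by
    intro P R j hj hR hdvd
    have := natDegree_le_of_dvd hdvd hR
    rw [natDegree_pow] at this
    nlinarith
  by_cases hS : S.natDegree = 0
  · refine ⟨hS, ?_⟩
    by_contra hT
    have hS' : derivative S = 0 := by rw [eq_C_of_natDegree_eq_zero hS, derivative_C]
    rw [hS', mul_zero, zero_add] at hder
    have hT0 : T ≠ 0 := by rintro rfl; exact hT natDegree_zero
    have hT' : derivative T ≠ 0 := fun h => hT (derivative_eq_zero.1 h)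
    have := mul_ne_zero ((hCu c hc).ne_zero)
      (mul_ne_zero (mul_ne_zero ((hCu _ hr0).ne_zero) (pow_ne_zero (r - 1) hT0)) hT')
    exact this hder
  · exfalso
    have hS' : derivative S ≠ 0 := fun h => hS (derivative_eq_zero.1 h)
    have hS0 : S ≠ 0 := by rintro rfl; exact hS natDegree_zero
    have hT' : derivative T ≠ 0 := by
      intro h
      rw [h, mul_zero, mul_zero, add_zero] at hder
      exact mul_ne_zero (mul_ne_zero ((hCu _ hd0).ne_zero) (pow_ne_zero (d - 1) hS0)) hS' hder
    have hT : T.natDegree ≠ 0 := fun h => hT' (by rw [eq_C_of_natDegree_eq_zero h, derivative_C])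
    -- The contradiction is `deg S ≤ deg T' < deg T ≤ deg S' < deg S`.
    have h3 := hle (by omega) hT' h1
    have h4 := hle (by omega) hS' h2
    have h5 := natDegree_derivative_lt hS
    have h6 := natDegree_derivative_lt hT
    omega

theorem rootMultiplicity_pow (p : F[X]) (α : F) (n : ℕ) :
    rootMultiplicity α (p ^ n) = n * rootMultiplicity α p := by
  classical
  rw [← count_roots, ← count_roots, roots_pow, Multiset.count_nsmul]

/-- If `a + Tʳ` is, up to an `m`-th power, an `N`-th power with `N > m`, then `T` is constant. -/
theorem natDegree_eq_zero_of_pow_eq [IsAlgClosed F] {T x : F[X]} {a z : F} (ha : a ≠ 0)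
    (hz : z ≠ 0) {m N r : ℕ} (hm : 1 ≤ m) (hN : m < N) (hr : 2 ≤ r)
    (h : (C a + T ^ r) ^ m = C z * x ^ N) : T.natDegree = 0 := by
  classical
  by_contra hT
  set V := C a + T ^ r with hV
  have hT0 : T ≠ 0 := by rintro rfl; exact hT natDegree_zero
  have hVdeg : V.natDegree = r * T.natDegree := by
    rw [hV, natDegree_C_add, natDegree_pow]
  have hV0 : V ≠ 0 := by
    intro h0
    rw [h0, natDegree_zero] at hVdeg
    have : 0 < r * T.natDegree := by positivity
    omega
  have hx0 : x ≠ 0 := by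
    rintro rfl
    rw [zero_pow (by omega), mul_zero] at h
    exact pow_ne_zero m hV0 h
  have hT' : derivative T ≠ 0 := fun h => hT (derivative_eq_zero.1 h)
  have hr0 : (r : F) ≠ 0 := by norm_cast; omega
  have hV' : derivative V = C (r : F) * (T ^ (r - 1) * derivative T) := by
    simp [hV, derivative_pow, mul_assoc]
  have hV'0 : derivative V ≠ 0 := by
    rw [hV']
    exact mul_ne_zero (C_ne_zero.2 hr0) (mul_ne_zero (pow_ne_zero _ hT0) hT')
  -- A root of `V` has multiplicity `μ` with `mμ` divisible by `N > m`, so `μ ≥ 2`. As `T` does not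
  -- vanish there, `T'` has multiplicity `μ - 1`, and `2(μ - 1) ≥ μ`. The divisibility then
  -- contradicts `deg V = r deg T ≥ 2 deg T`.
  have hdvd : V ∣ derivative T ^ 2 := by
    rw [(IsAlgClosed.splits V).dvd_iff_roots_le_roots hV0 (pow_ne_zero 2 hT'),
      Multiset.le_iff_count]
    intro α
    rw [count_roots, count_roots]
    by_cases hα : V.IsRoot α
    · have hTα : T.eval α ≠ 0 := by
        intro h0
        have : V.eval α = a := by rw [hV]; simp [h0, show r ≠ 0 by omega]
        exact ha (by rw [← this]; exact hα)
      have h1 : rootMultiplicity α (V ^ m) = m * rootMultiplicity α V := rootMultiplicity_pow ..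
      have h2 : rootMultiplicity α (V ^ m) = N * rootMultiplicity α x := by
        rw [h, rootMultiplicity_mul (mul_ne_zero (C_ne_zero.2 hz) (pow_ne_zero _ hx0)),
          rootMultiplicity_C, zero_add, rootMultiplicity_pow]
      have h3 : 0 < rootMultiplicity α V := (rootMultiplicity_pos hV0).2 hα
      have h4 := derivative_rootMultiplicity_of_root hα
      have h5 : rootMultiplicity α (derivative V) = rootMultiplicity α (derivative T) := by
        rw [hV', rootMultiplicity_mul (hV' ▸ hV'0), rootMultiplicity_C, zero_add,
          rootMultiplicity_mul (mul_ne_zero (pow_ne_zero _ hT0) hT'), rootMultiplicity_pow,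
          rootMultiplicity_eq_zero (p := T) hTα, mul_zero, zero_add]
      have h6 : 2 ≤ rootMultiplicity α V := by
        by_contra! h6
        have h7 : rootMultiplicity α V = 1 := by omega
        rw [h1, h7, mul_one] at h2
        rcases Nat.eq_zero_or_pos (rootMultiplicity α x) with h8 | h8
        · rw [h8] at h2; omega
        · nlinarith
      rw [rootMultiplicity_pow]
      omega
    · rw [rootMultiplicity_eq_zero hα]
      exact Nat.zero_le _
  have h1 := natDegree_le_of_dvd hdvd (pow_ne_zero 2 hT')
  rw [natDegree_pow, hVdeg] at h1
  have h2 := natDegree_derivative_lt hT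
  nlinarith

/-- If the value of a nonconstant polynomial `p`, quasi-homogeneous for the weights `(r, d)`, is a
unit, then one of the quasi-homogeneous prime factors of `p` has a unit as its value. -/
theorem isUnit_of_isUnit_aeval_isWeightedHomogeneous {k : Type*} [Field k]
    [IsAlgClosed F] [Algebra k F] {d r : ℕ} (hd : d ≠ 0) (hr : r ≠ 0) (hdr : Nat.gcd d r = 1)
    {p : MvPolynomial (Fin 2) k} {ρ : ℕ} (hp : p.IsWeightedHomogeneous ![r, d] ρ) (hρ : ρ ≠ 0)
    {S T : F[X]} (hu : IsUnit (MvPolynomial.aeval ![S, T] p)) :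
    IsUnit S ∨ IsUnit T ∨ ∃ c : F, c ≠ 0 ∧ IsUnit (S ^ d + C c * T ^ r) := by
  have hsum : MvPolynomial.aeval ![S, T] p =
      ∑ m ∈ p.support, C (algebraMap k F (p.coeff m)) * (S ^ m 0 * T ^ m 1) := by
    rw [MvPolynomial.aeval_def, MvPolynomial.eval₂_eq']
    simp [Fin.prod_univ_two, Polynomial.algebraMap_apply]
  have hw : ∀ m ∈ p.support, r * m 0 + d * m 1 = ρ := by
    intro m hm
    have := hp (MvPolynomial.mem_support_iff.1 hm)
    rw [Finsupp.weight_apply, Finsupp.sum_fintype _ _ (by simp)] at this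
    simpa [Fin.sum_univ_two, mul_comm] using this
  by_cases h0 : ∀ m ∈ p.support, m 0 ≠ 0
  · left
    refine isUnit_of_dvd_unit ?_ hu
    rw [hsum]
    refine Finset.dvd_sum fun m hm => ?_
    exact ((dvd_pow_self S (h0 m hm)).mul_right _).mul_left _
  by_cases h1 : ∀ m ∈ p.support, m 1 ≠ 0
  · right; left
    refine isUnit_of_dvd_unit ?_ hu
    rw [hsum]
    refine Finset.dvd_sum fun m hm => ?_
    exact ((dvd_pow_self T (h1 m hm)).mul_left _).mul_left _
  right; right
  push Not at h0 h1
  obtain ⟨mb, hmb, hb⟩ := h0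
  obtain ⟨ma, hma, ha⟩ := h1
  have hcop : Nat.Coprime d r := hdr
  -- Pure powers of both variables occur, so `d` and `r` divide `ρ`. Every exponent is then of the
  -- form `(dj, r(J - j))`.
  obtain ⟨J, hJ⟩ : d * r ∣ ρ := by
    refine hcop.mul_dvd_of_dvd_of_dvd ?_ ?_
    · exact ⟨mb 1, by have := hw mb hmb; rw [hb] at this; omega⟩
    · exact ⟨ma 0, by have := hw ma hma; rw [ha] at this; omega⟩
  have hJ0 : J ≠ 0 := by rintro rfl; exact hρ (by simpa using hJ)
  have hsplit : ∀ m ∈ p.support, ∃ j, j ≤ J ∧ m 0 = d * j ∧ m 1 = r * (J - j) := by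
    intro m hm
    have h := hw m hm
    have h2 : d ∣ m 0 := by
      have : d ∣ r * m 0 := (Nat.dvd_add_left (Dvd.intro _ rfl)).1
        (show d ∣ r * m 0 + d * m 1 by rw [h, hJ, mul_assoc]; exact Dvd.intro _ rfl)
      exact hcop.dvd_of_dvd_mul_left this
    obtain ⟨j, hj⟩ := h2
    have h3 : r * j + m 1 = r * J := by
      apply Nat.eq_of_mul_eq_mul_left (Nat.pos_of_ne_zero hd)
      rw [hj, hJ] at h
      linarith
    have h4 : j ≤ J := Nat.le_of_mul_le_mul_left (by omega) (Nat.pos_of_ne_zero hr)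
    refine ⟨j, h4, hj, ?_⟩
    rw [Nat.mul_sub]
    omega
  choose! jj hjJ hj0 hj1 using hsplit
  have hinj : ∀ m ∈ p.support, ∀ m' ∈ p.support, jj m = jj m' → m = m' := by
    intro m hm m' hm' h
    ext i
    fin_cases i
    · simp [hj0 m hm, hj0 m' hm', h]
    · simp [hj1 m hm, hj1 m' hm', h]
  -- The dehomogenization of `p` in `Sᵈ/Tʳ`. A root `c` of it yields the factor `Sᵈ - cTʳ`, and `c ≠
  -- 0` because a pure power of the second variable occurs.
  set φ : F[X] := ∑ m ∈ p.support, monomial (jj m) (algebraMap k F (p.coeff m)) with hφ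
  have hcoef : ∀ m ∈ p.support, φ.coeff (jj m) ≠ 0 := by
    intro m hm
    rw [hφ, finsetSum_coeff, Finset.sum_eq_single m]
    · rw [coeff_monomial, if_pos rfl]
      exact (_root_.map_ne_zero _).2 (MvPolynomial.mem_support_iff.1 hm)
    · intro m' hm' hne
      rw [coeff_monomial, if_neg fun h => hne (hinj _ hm' _ hm h)]
    · exact fun h => absurd hm h
  have hja : jj ma = J := by
    have h2 := hj1 ma hma
    have h3 := hjJ ma hma
    rw [ha, eq_comm, mul_eq_zero, or_iff_right hr] at h2
    omega
  have hjb : jj mb = 0 := by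
    have h2 := hj0 mb hmb
    rw [hb, eq_comm, mul_eq_zero, or_iff_right hd] at h2
    exact h2
  have hφdeg : φ.degree ≠ 0 := by
    intro h
    have := hcoef ma hma
    rw [eq_C_of_degree_eq_zero h, hja, coeff_C, if_neg hJ0] at this
    exact this rfl
  obtain ⟨c, hc⟩ := IsAlgClosed.exists_root φ hφdeg
  have hc0 : c ≠ 0 := by
    rintro rfl
    rw [IsRoot, ← coeff_zero_eq_eval_zero, ← hjb] at hc
    exact hcoef mb hmb hc
  refine ⟨-c, neg_ne_zero.2 hc0, isUnit_of_dvd_unit ?_ hu⟩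
  have hc' : ∑ m ∈ p.support, algebraMap k F (p.coeff m) * c ^ jj m = 0 := by
    rw [IsRoot, hφ, eval_finsetSum] at hc
    simpa using hc
  have hq : MvPolynomial.aeval ![S, T] p = ∑ m ∈ p.support, C (algebraMap k F (p.coeff m)) *
      (T ^ r) ^ (J - jj m) * ((S ^ d) ^ jj m - (C c * T ^ r) ^ jj m) := by
    have h2 : ∑ m ∈ p.support, C (algebraMap k F (p.coeff m)) *
      (T ^ r) ^ (J - jj m) * (C c * T ^ r) ^ jj m = 0 := by
      have h3 := congrArg (fun a => C a * (T ^ r) ^ J) hc'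
      simp only [map_sum, Finset.sum_mul, C_0, zero_mul] at h3
      rw [← h3]
      refine Finset.sum_congr rfl fun m hm => ?_
      rw [← Nat.sub_add_cancel (hjJ m hm), pow_add, C_mul, C_pow, mul_pow]
      simp only [Nat.sub_add_cancel (hjJ m hm)]
      ring
    simp only [mul_sub]
    rw [Finset.sum_sub_distrib, h2, sub_zero, hsum]
    refine Finset.sum_congr rfl fun m hm => ?_
    rw [hj0 m hm, hj1 m hm, pow_mul, pow_mul]
    ring
  rw [hq]
  refine Finset.dvd_sum fun m hm => Dvd.dvd.mul_left ?_ _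
  have := sub_dvd_pow_sub_pow (S ^ d) (C c * T ^ r) (jj m)
  rwa [show S ^ d + C (-c) * T ^ r = S ^ d - C c * T ^ r by rw [C_neg]; ring]

end Polynomial

/-! ### Supports, Euler derivations and initial forms in group algebras. -/

namespace AddMonoidAlgebra

section Supported

variable {k G : Type*} [Field k] [AddCommGroup G]

/-- The elements of `k[G]` with support in `S`. -/
def supportedIn (k : Type*) {G : Type*} [Field k] [AddCommGroup G] (S : Set G) :
    Submodule k (AddMonoidAlgebra k G) where
  carrier := {f | ∀ g, f.coeff g ≠ 0 → g ∈ S}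
  zero_mem' := by simp
  add_mem' {f h} hf hh g hg := by
    by_contra hS
    have h1 : f.coeff g = 0 := by by_contra h; exact hS (hf g h)
    have h2 : h.coeff g = 0 := by by_contra h; exact hS (hh g h)
    simp [h1, h2] at hg
  smul_mem' c f hf g hg := hf g fun h => hg (by simp [h])

theorem supportedIn_mono {S T : Set G} (h : S ⊆ T) : supportedIn k S ≤ supportedIn k T :=
  fun _ hf g hg => h (hf g hg)

theorem mul_mem_supportedIn {S T U : Set G} (h : ∀ a ∈ S, ∀ b ∈ T, a + b ∈ U)
    {f f' : AddMonoidAlgebra k G} (hf : f ∈ supportedIn k S) (hf' : f' ∈ supportedIn k T) :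
    f * f' ∈ supportedIn k U := by
  classical
  intro g hg
  obtain ⟨a, ha, b, hb, rfl⟩ := Finset.mem_add.1
    (support_coeff_mul_subset f f' (Finsupp.mem_support_iff.2 hg))
  exact h a (hf a (Finsupp.mem_support_iff.1 ha)) b (hf' b (Finsupp.mem_support_iff.1 hb))

theorem single_mem_supportedIn {S : Set G} {g : G} (hg : g ∈ S) (c : k) :
    single g c ∈ supportedIn k S := by
  classical
  intro g' h
  rw [coeff_single, Finsupp.single_apply] at h
  split_ifs at h with h1
  · exact h1 ▸ hg
  · exact absurd rfl h

theorem eq_zero_of_mem_supportedIn_of_mem {S T : Set G} (hST : Disjoint S T)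
    {f : AddMonoidAlgebra k G} (h1 : f ∈ supportedIn k S) (h2 : f ∈ supportedIn k T) : f = 0 := by
  ext g
  by_contra h
  exact Set.disjoint_left.1 hST (h1 g h) (h2 g h)

/-- The Euler derivation of `k[G]` defined by an additive character. -/
noncomputable def euler (χ : G →+ k) :
    Derivation k (AddMonoidAlgebra k G) (AddMonoidAlgebra k G) :=
  Derivation.mk'
    { toFun := fun f => .ofCoeff (Finsupp.onFinset f.coeff.support (fun g => χ g * f.coeff g)
        fun g hg => Finsupp.mem_support_iff.2 (right_ne_zero_of_mul hg))
      map_add' := fun f h => by ext g; simp [mul_add]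
      map_smul' := fun c f => by ext g; simp [mul_left_comm] }
    (by
      have hsingle : ∀ (g : G) (c : k), (AddMonoidAlgebra.ofCoeff
          (Finsupp.onFinset (single g c).coeff.support (fun g' => χ g' * (single g c).coeff g')
          fun g hg => Finsupp.mem_support_iff.2 (right_ne_zero_of_mul hg))) =
          single g (χ g * c) := by
        classical
        intro g c
        ext g'
        simp only [coeff_single, Finsupp.onFinset_apply, Finsupp.single_apply]
        split_ifs with h
        · rw [h]
        · simp
      intro f h
      induction f using induction_linear with
      | zero => simp only [zero_mul, map_zero, smul_zero, zero_smul, add_zero]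
      | add f f' hf hf' => rw [add_mul, map_add, hf, hf', map_add, add_smul, smul_add]; abel
      | single a c =>
        induction h using induction_linear with
        | zero => simp only [mul_zero, map_zero, smul_zero, zero_smul, add_zero]
        | add f f' hf hf' => rw [mul_add, map_add, hf, hf', map_add, add_smul, smul_add]; abel
        | single b c' =>
          simp only [LinearMap.coe_mk, AddHom.coe_mk, smul_eq_mul, single_mul_single, hsingle,
            map_add]
          rw [add_comm b a, ← single_add]
          ring_nf)

theorem coeff_euler (χ : G →+ k) (f : AddMonoidAlgebra k G) (g : G) :
    (euler χ f).coeff g = χ g * f.coeff g := rfl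

theorem euler_single (χ : G →+ k) (g : G) (c : k) :
    euler χ (single g c) = single g (χ g * c) := by
  classical
  ext g'
  rw [coeff_euler]
  simp only [coeff_single, Finsupp.single_apply]
  split_ifs with h
  · rw [h]
  · simp

theorem euler_mem_supportedIn (χ : G →+ k) {S : Set G} {f : AddMonoidAlgebra k G}
    (hf : f ∈ supportedIn k S) : euler χ f ∈ supportedIn k S :=
  fun g hg => hf g (right_ne_zero_of_mul (coeff_euler χ f g ▸ hg))

end Supported

section InitialForm

variable {k G Γ : Type*} [Field k] [AddCommGroup G] [AddCommGroup Γ] [LinearOrder Γ]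
  [IsOrderedAddMonoid Γ] {ω : G →+ Γ}

/-- `h` is homogeneous of degree `γ` and `f - h` has only terms of degree larger than `γ`. -/
def HasInitialForm (ω : G →+ Γ) (γ : Γ) (f h : AddMonoidAlgebra k G) : Prop :=
  h ∈ supportedIn k {g | ω g = γ} ∧ f - h ∈ supportedIn k {g | γ < ω g}

theorem hasInitialForm_self {γ : Γ} {h : AddMonoidAlgebra k G}
    (hh : h ∈ supportedIn k {g | ω g = γ}) : HasInitialForm ω γ h h :=
  ⟨hh, by rw [sub_self]; exact zero_mem _⟩

theorem hasInitialForm_single (g : G) (c : k) :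
    HasInitialForm ω (ω g) (single g c) (single g c) :=
  hasInitialForm_self (single_mem_supportedIn (S := {g' | ω g' = ω g}) rfl c)

/-- Allowing the form `0` below the order of `f` lets initial forms be followed through sums and
derivations without excluding cancellation. -/
theorem hasInitialForm_zero_right {γ : Γ} {f : AddMonoidAlgebra k G}
    (hf : f ∈ supportedIn k {g | γ < ω g}) : HasInitialForm ω γ f 0 :=
  ⟨zero_mem _, by rwa [sub_zero]⟩

namespace HasInitialForm

theorem add {γ : Γ} {f h f' h' : AddMonoidAlgebra k G} (H : HasInitialForm ω γ f h)
    (H' : HasInitialForm ω γ f' h') : HasInitialForm ω γ (f + f') (h + h') :=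
  ⟨add_mem H.1 H'.1, by rw [add_sub_add_comm]; exact add_mem H.2 H'.2⟩

theorem add_of_lt {γ : Γ} {f h f' : AddMonoidAlgebra k G} (H : HasInitialForm ω γ f h)
    (H' : f' ∈ supportedIn k {g | γ < ω g}) : HasInitialForm ω γ (f + f') h := by
  simpa using H.add (hasInitialForm_zero_right H')

theorem mem_le {γ : Γ} {f h : AddMonoidAlgebra k G} (H : HasInitialForm ω γ f h) :
    f ∈ supportedIn k {g | γ ≤ ω g} := by
  rw [← sub_add_cancel f h]
  exact add_mem (supportedIn_mono (fun _ => le_of_lt) H.2)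
    (supportedIn_mono (fun _ h => h.symm.le) H.1)

theorem mul {γ γ' : Γ} {f h f' h' : AddMonoidAlgebra k G} (H : HasInitialForm ω γ f h)
    (H' : HasInitialForm ω γ' f' h') : HasInitialForm ω (γ + γ') (f * f') (h * h') := by
  refine ⟨mul_mem_supportedIn (fun a ha b hb => ?_) H.1 H'.1, ?_⟩
  · simp only [Set.mem_ofPred_eq] at *
    rw [map_add, ha, hb]
  · rw [show f * f' - h * h' = (f - h) * f' + h * (f' - h') by ring]
    refine add_mem (mul_mem_supportedIn (fun a ha b hb => ?_) H.2 H'.mem_le)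
      (mul_mem_supportedIn (fun a ha b hb => ?_) H.1 H'.2)
    · simp only [Set.mem_ofPred_eq] at *
      rw [map_add]
      exact add_lt_add_of_lt_of_le ha hb
    · simp only [Set.mem_ofPred_eq] at *
      rw [map_add, ha]
      exact add_lt_add_right hb γ

theorem pow {γ : Γ} {f h : AddMonoidAlgebra k G} (H : HasInitialForm ω γ f h) (n : ℕ) :
    HasInitialForm ω (n • γ) (f ^ n) (h ^ n) := by
  induction n with
  | zero =>
    rw [pow_zero, pow_zero, zero_smul, one_def, ← map_zero ω]
    exact hasInitialForm_single 0 1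
  | succ n ih => rw [pow_succ, pow_succ, succ_nsmul]; exact ih.mul H

theorem eq_zero {γ : Γ} {h : AddMonoidAlgebra k G} (H : HasInitialForm ω γ 0 h) : h = 0 := by
  refine eq_zero_of_mem_supportedIn_of_mem ?_ H.1 (neg_mem_iff.1 (by simpa using H.2))
  rw [Set.disjoint_left]
  exact fun g h1 h2 => (ne_of_gt (show γ < ω g from h2)) h1

theorem of_lt {γ γ' : Γ} {f h : AddMonoidAlgebra k G} (H : HasInitialForm ω γ f h)
    (hγ : γ' < γ) : HasInitialForm ω γ' f 0 :=
  hasInitialForm_zero_right (supportedIn_mono (fun _ hg => hγ.trans_le hg) H.mem_le)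

theorem neg {γ : Γ} {f h : AddMonoidAlgebra k G} (H : HasInitialForm ω γ f h) :
    HasInitialForm ω γ (-f) (-h) :=
  ⟨neg_mem H.1, by rw [← neg_sub_neg, neg_neg, neg_neg] ; exact
    (by simpa [sub_eq_add_neg, add_comm] using neg_mem H.2)⟩

theorem unique {γ γ' : Γ} {f h h' : AddMonoidAlgebra k G} (H : HasInitialForm ω γ f h)
    (H' : HasInitialForm ω γ' f h') (h0 : h ≠ 0) (h0' : h' ≠ 0) : γ = γ' ∧ h = h' := by
  have key : ∀ {γ : Γ} {h h' : AddMonoidAlgebra k G}, HasInitialForm ω γ f h →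
      HasInitialForm ω γ f h' → h = h' := by
    intro γ h h' H H'
    have := H.add H'.neg
    rw [add_neg_cancel] at this
    exact add_neg_eq_zero.1 this.eq_zero
  rcases lt_trichotomy γ γ' with hlt | rfl | hlt
  · exact absurd (key H (H'.of_lt hlt)) h0
  · exact ⟨rfl, key H H'⟩
  · exact absurd (key H' (H.of_lt hlt)) h0'

theorem ne_zero {γ : Γ} {f h : AddMonoidAlgebra k G} (H : HasInitialForm ω γ f h) (h0 : h ≠ 0) :
    f ≠ 0 := by
  rintro rfl
  exact h0 H.eq_zero

end HasInitialForm

/-- Finitely many elements, not all zero, have homogeneous components of the lowest degree that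
occurs in them. -/
theorem exists_hasInitialForm {ι : Type*} [Fintype ι] (ω : G →+ Γ) (a : ι → AddMonoidAlgebra k G)
    (ha : ∃ i, a i ≠ 0) : ∃ (ν : Γ) (b : ι → AddMonoidAlgebra k G),
      (∀ i, HasInitialForm ω ν (a i) (b i)) ∧ ∃ i, b i ≠ 0 := by
  classical
  set S : Finset Γ := Finset.univ.biUnion fun i => (a i).coeff.support.image ω with hS
  have hmem : ∀ i g, (a i).coeff g ≠ 0 → ω g ∈ S := fun i g hg =>
    Finset.mem_biUnion.2 ⟨i, Finset.mem_univ i,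
      Finset.mem_image_of_mem _ (Finsupp.mem_support_iff.2 hg)⟩
  have hne : S.Nonempty := by
    obtain ⟨i, hi⟩ := ha
    obtain ⟨g, hg⟩ := Finsupp.ne_iff.1 (fun h => hi (coeff_eq_zero.1 h) : (a i).coeff ≠ 0)
    exact ⟨_, hmem i g hg⟩
  set ν := S.min' hne with hν
  refine ⟨ν, fun i => .ofCoeff ((a i).coeff.filter fun g => ω g = ν), fun i => ⟨?_, ?_⟩, ?_⟩
  · intro g hg
    by_contra h
    exact hg (Finsupp.filter_apply_neg _ _ h)
  · intro g hg
    simp only [coeff_sub, Finsupp.sub_apply, Finsupp.filter_apply] at hg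
    split_ifs at hg with h
    · exact absurd (sub_self _) hg
    · rw [sub_zero] at hg
      exact lt_of_le_of_ne (S.min'_le _ (hmem i g hg)) (Ne.symm h)
  · obtain ⟨i, -, hi⟩ := Finset.mem_biUnion.1 (S.min'_mem hne)
    obtain ⟨g, hg, hgν⟩ := Finset.mem_image.1 hi
    refine ⟨i, fun h => (Finsupp.mem_support_iff.1 hg) ?_⟩
    have := congrArg (fun f => f.coeff g) h
    simpa [Finsupp.filter_apply, hgν, hν] using this

variable {ι : Type*} [Fintype ι] {χ : ι → G →+ k}

/-- The derivation `∑ aᵢ θᵢ`, with `θᵢ` the Euler derivation of `χᵢ`. -/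
noncomputable def eulerSum (χ : ι → G →+ k) (a : ι → AddMonoidAlgebra k G) :
    Derivation k (AddMonoidAlgebra k G) (AddMonoidAlgebra k G) :=
  ∑ i, a i • euler (χ i)

theorem eulerSum_apply (a : ι → AddMonoidAlgebra k G) (f : AddMonoidAlgebra k G) :
    eulerSum χ a f = ∑ i, a i * euler (χ i) f := by
  have := congrFun (map_sum Derivation.coeFnAddMonoidHom (fun i => a i • euler (χ i)) Finset.univ) f
  rw [Finset.sum_apply] at this
  exact this

/-- Euler derivations preserve supports, so only the coefficients shift the degree. -/
theorem HasInitialForm.eulerSum {ν γ : Γ} {a b : ι → AddMonoidAlgebra k G}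
    (hab : ∀ i, HasInitialForm ω ν (a i) (b i)) {f h : AddMonoidAlgebra k G}
    (H : HasInitialForm ω γ f h) :
    HasInitialForm ω (γ + ν) (eulerSum χ a f) (eulerSum χ b h) := by
  rw [eulerSum_apply, eulerSum_apply]
  have hi : ∀ i, HasInitialForm ω (γ + ν) (a i * euler (χ i) f) (b i * euler (χ i) h) := by
    intro i
    rw [add_comm]
    refine (hab i).mul ⟨euler_mem_supportedIn _ H.1, ?_⟩
    rw [← map_sub]
    exact euler_mem_supportedIn _ H.2
  refine ⟨sum_mem fun i _ => (hi i).1, ?_⟩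
  rw [← Finset.sum_sub_distrib]
  exact sum_mem fun i _ => (hi i).2

theorem HasInitialForm.iterate_eulerSum {ν γ : Γ} {a b : ι → AddMonoidAlgebra k G}
    (hab : ∀ i, HasInitialForm ω ν (a i) (b i)) {f h : AddMonoidAlgebra k G}
    (H : HasInitialForm ω γ f h) (n : ℕ) :
    HasInitialForm ω (γ + n • ν) ((⇑(AddMonoidAlgebra.eulerSum χ a))^[n] f)
      ((⇑(AddMonoidAlgebra.eulerSum χ b))^[n] h) := by
  induction n with
  | zero => simpa using H
  | succ n ih =>
    rw [Function.iterate_succ_apply', Function.iterate_succ_apply', succ_nsmul, ← add_assoc]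
    exact ih.eulerSum hab

end InitialForm

end AddMonoidAlgebra

/-! ### Relations and the universal property of `B`. -/

namespace NewClass

open MvPolynomial

section Relations

variable {k : Type*} [Field k] {n e m d r : ℕ} {Q : MvPolynomial (Fin 3) k}

theorem comp_vec_three {A B : Type*} (f : A → B) (a b c : A) :
    (fun i => f (![a, b, c] i)) = ![f a, f b, f c] := by
  funext i
  fin_cases i <;> rfl

theorem comp_vec_two {A B : Type*} (f : A → B) (a b : A) :
    (fun i => f (![a, b] i)) = ![f a, f b] := by
  funext i
  fin_cases i <;> rfl

theorem map_evalXST {A : Type*} [CommRing A] [Algebra k A] (ψ : B n e m d r Q →ₐ[k] A)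
    (p : MvPolynomial (Fin 3) k) : ψ (evalXST n e m d r Q p) =
      aeval ![ψ (x n e m d r Q), ψ (s n e m d r Q), ψ (t n e m d r Q)] p := by
  rw [evalXST, comp_aeval_apply, comp_vec_three]

theorem mk_sPoly : (Ideal.Quotient.mk (Ideal.span {relPoly n e m d r Q}) (sPoly k m e)) =
    s n e m d r Q := by
  simp [sPoly, s, x, y, z]

theorem pow_mul_y : x n e m d r Q ^ n * y n e m d r Q = s n e m d r Q ^ d + t n e m d r Q ^ r +
    x n e m d r Q * evalXST n e m d r Q Q := by
  have h : Ideal.Quotient.mkₐ k (Ideal.span {relPoly n e m d r Q}) (relPoly n e m d r Q) = 0 :=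
    Ideal.Quotient.eq_zero_iff_mem.2 (Ideal.mem_span_singleton_self _)
  have h2 : Ideal.Quotient.mkₐ k (Ideal.span {relPoly n e m d r Q})
      (aeval ![X 0, sPoly k m e, X 3] Q) = evalXST n e m d r Q Q := by
    rw [comp_aeval_apply, comp_vec_three, evalXST]
    congr 3
  have h3 : Ideal.Quotient.mkₐ k (Ideal.span {relPoly n e m d r Q}) (sPoly k m e) =
    s n e m d r Q := mk_sPoly
  rw [relPoly] at h
  simp only [map_sub, map_mul, map_pow] at h
  rw [← relPoly, h2, h3] at h
  change x n e m d r Q ^ n * y n e m d r Q - _ - t n e m d r Q ^ r - x n e m d r Q * _ = 0 at h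
  linear_combination h

theorem pow_mul_z : x n e m d r Q ^ e * z n e m d r Q = y n e m d r Q ^ m - s n e m d r Q := by
  rw [s]; ring

/-- With `s` adjoined as a generator, these two equations are all the relations of `B`. -/
theorem exists_lift {A : Type*} [CommRing A] [Algebra k A] {x' s' t' y' z' : A}
    (hy : x' ^ n * y' = s' ^ d + t' ^ r + x' * aeval ![x', s', t'] Q)
    (hz : x' ^ e * z' = y' ^ m - s') : ∃ ψ : B n e m d r Q →ₐ[k] A,
      ψ (x n e m d r Q) = x' ∧ ψ (s n e m d r Q) = s' ∧ ψ (t n e m d r Q) = t' ∧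
      ψ (y n e m d r Q) = y' ∧ ψ (z n e m d r Q) = z' := by
  have hs : y' ^ m - x' ^ e * z' = s' := by rw [hz]; ring
  have hsp : aeval ![x', y', z', t'] (sPoly k m e) = s' := by
    rw [← hs]; simp [sPoly]
  have hrel : aeval ![x', y', z', t'] (relPoly n e m d r Q) = 0 := by
    rw [relPoly, map_sub, map_sub, map_sub, map_mul, map_mul, map_pow, map_pow, map_pow, hsp,
      comp_aeval_apply, comp_vec_three, hsp]
    simp only [aeval_X, Matrix.cons_val]
    rw [hy]
    ring
  refine ⟨Ideal.Quotient.liftₐ _ (aeval ![x', y', z', t']) ?_, ?_⟩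
  · intro a ha
    obtain ⟨c, rfl⟩ := Ideal.mem_span_singleton.1 ha
    rw [map_mul, hrel, zero_mul]
  · have key : ∀ p, (Ideal.Quotient.liftₐ (Ideal.span {relPoly n e m d r Q})
        (aeval ![x', y', z', t']) (by
          intro a ha
          obtain ⟨c, rfl⟩ := Ideal.mem_span_singleton.1 ha
          rw [map_mul, hrel, zero_mul])) (Ideal.Quotient.mk _ p) = aeval ![x', y', z', t'] p :=
      fun p => rfl
    refine ⟨?_, ?_, ?_, ?_, ?_⟩
    · rw [x, key]; simp
    · rw [← mk_sPoly, key, hsp]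
    · rw [t, key]; simp
    · rw [y, key]; simp
    · rw [z, key]; simp

theorem induction_on_B {motive : B n e m d r Q → Prop} (b : B n e m d r Q)
    (C : ∀ c : k, motive (algebraMap k _ c)) (add : ∀ a b, motive a → motive b → motive (a + b))
    (mul_x : ∀ a, motive a → motive (a * x n e m d r Q))
    (mul_y : ∀ a, motive a → motive (a * y n e m d r Q))
    (mul_z : ∀ a, motive a → motive (a * z n e m d r Q))
    (mul_t : ∀ a, motive a → motive (a * t n e m d r Q)) : motive b := by
  obtain ⟨p, rfl⟩ := Ideal.Quotient.mk_surjective b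
  induction p using MvPolynomial.induction_on with
  | C c => exact C c
  | add p q hp hq => rw [map_add]; exact add _ _ hp hq
  | mul_X p i hp =>
    rw [map_mul]
    fin_cases i
    · exact mul_x _ hp
    · exact mul_y _ hp
    · exact mul_z _ hp
    · exact mul_t _ hp

/-- After inverting `x`, the relations can be solved for `y` and then for `z` in terms of `x, s, t`.
-/
theorem exists_pow_mul_eq_evalXST (b : B n e m d r Q) :
    ∃ M p, x n e m d r Q ^ M * b = evalXST n e m d r Q p := by
  have hmul : ∀ a b : B n e m d r Q, (∃ M p, x n e m d r Q ^ M * a = evalXST n e m d r Q p) →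
      (∃ M p, x n e m d r Q ^ M * b = evalXST n e m d r Q p) →
      (∃ M p, x n e m d r Q ^ M * (a * b) = evalXST n e m d r Q p) := by
    rintro a b ⟨M, p, h⟩ ⟨M', p', h'⟩
    refine ⟨M + M', p * p', ?_⟩
    rw [evalXST, map_mul, ← evalXST, ← evalXST, ← h, ← h']
    ring
  have hx : evalXST n e m d r Q (X 0) = x n e m d r Q := by simp [evalXST]
  have hs : evalXST n e m d r Q (X 1) = s n e m d r Q := by simp [evalXST]
  have ht : evalXST n e m d r Q (X 2) = t n e m d r Q := by simp [evalXST]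
  have hy : ∃ p, x n e m d r Q ^ n * y n e m d r Q = evalXST n e m d r Q p :=
    ⟨X 1 ^ d + X 2 ^ r + X 0 * Q, by
      rw [pow_mul_y]; simp [evalXST]⟩
  induction b using induction_on_B with
  | C c => exact ⟨0, MvPolynomial.C c, by simp [evalXST]⟩
  | add a b ha hb =>
    obtain ⟨M, p, h⟩ := ha
    obtain ⟨M', p', h'⟩ := hb
    refine ⟨M + M', X 0 ^ M' * p + X 0 ^ M * p', ?_⟩
    rw [evalXST, map_add, map_mul, map_mul, map_pow, map_pow, ← evalXST, ← evalXST, ← evalXST, ← h,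
      ← h', hx]
    ring
  | mul_x a ha => exact hmul _ _ ha ⟨0, X 0, by rw [hx]; ring⟩
  | mul_y a ha =>
    obtain ⟨p, hp⟩ := hy
    exact hmul _ _ ha ⟨n, p, hp⟩
  | mul_z a ha =>
    obtain ⟨p, hp⟩ := hy
    -- This is `x^(nm+e) z = x^(nm)(yᵐ - s) = (xⁿy)ᵐ - x^(nm) s`.
    refine hmul _ _ ha ⟨n * m + e, p ^ m - X 0 ^ (n * m) * X 1, ?_⟩
    rw [evalXST, map_sub, map_mul, map_pow, map_pow, ← evalXST, ← evalXST, ← evalXST, hx, hs, ← hp,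
      pow_add, mul_assoc, pow_mul_z]
    ring
  | mul_t a ha => exact hmul _ _ ha ⟨0, X 2, by rw [ht]; ring⟩

/-- The variable `X` is prime and does not divide the defining polynomial, so it remains a
nonzerodivisor modulo it. -/
theorem x_pow_mul_cancel (hn : 1 ≤ n) (hm : 2 ≤ m) (hd : 2 ≤ d) {b : B n e m d r Q} {M : ℕ}
    (h : x n e m d r Q ^ M * b = 0) : b = 0 := by
  induction M with
  | zero => simpa using h
  | succ M ih =>
    apply ih
    rw [pow_succ', mul_assoc] at h
    generalize x n e m d r Q ^ M * b = b' at h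
    obtain ⟨q, rfl⟩ := Ideal.Quotient.mk_surjective b'
    rw [x, ← map_mul, Ideal.Quotient.eq_zero_iff_mem, Ideal.mem_span_singleton] at h
    obtain ⟨c, hc⟩ := h
    have hX : Prime (X 0 : MvPolynomial (Fin 4) k) := X_prime
    have hdvd : (X 0 : MvPolynomial (Fin 4) k) ∣ c := by
      refine (hX.dvd_or_dvd ⟨q, hc.symm⟩).resolve_left ?_
      rintro ⟨c', hc'⟩
      -- At the point `(0, 0, 0, 1)` the defining polynomial equals `-1`, whereas multiples of `X`
      -- vanish.
      have h1 := congrArg (aeval (R := k) ![(0 : k), 0, 0, 1]) hc'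
      rw [relPoly, sPoly] at h1
      simp [show n ≠ 0 by omega, show m ≠ 0 by omega, show d ≠ 0 by omega] at h1
    obtain ⟨c', rfl⟩ := hdvd
    rw [Ideal.Quotient.eq_zero_iff_mem, Ideal.mem_span_singleton]
    exact ⟨c', mul_left_cancel₀ hX.ne_zero (by rw [hc]; ring)⟩

theorem injective_of_injective_evalXST (hn : 1 ≤ n) (hm : 2 ≤ m) (hd : 2 ≤ d) {A : Type*}
    [CommRing A] [Algebra k A] (ψ : B n e m d r Q →ₐ[k] A)
    (hψ : Function.Injective fun p => ψ (evalXST n e m d r Q p)) : Function.Injective ψ := by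
  rw [injective_iff_map_eq_zero]
  intro b hb
  obtain ⟨M, p, h⟩ := exists_pow_mul_eq_evalXST b
  have h1 : ψ (evalXST n e m d r Q p) = ψ (evalXST n e m d r Q 0) := by
    rw [← h, map_mul, hb, mul_zero, evalXST, map_zero, map_zero]
  rw [hψ h1, evalXST, map_zero] at h
  exact x_pow_mul_cancel hn hm hd h

/-- Agreement on `x, s, t` extends to `k[x,s,t]`, and then to `b` by applying the Leibniz rule to
`x^M b ∈ k[x,s,t]` and cancelling `x^M`. -/
theorem derivation_comp_eq {A : Type*} [CommRing A] [IsDomain A] [Algebra k A]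
    (ψ : B n e m d r Q →ₐ[k] A) (hψ : ψ (x n e m d r Q) ≠ 0)
    (D : Derivation k (B n e m d r Q) (B n e m d r Q)) (D' : Derivation k A A)
    (hx : D' (ψ (x n e m d r Q)) = ψ (D (x n e m d r Q)))
    (hs : D' (ψ (s n e m d r Q)) = ψ (D (s n e m d r Q)))
    (ht : D' (ψ (t n e m d r Q)) = ψ (D (t n e m d r Q))) (b : B n e m d r Q) :
    D' (ψ b) = ψ (D b) := by
  have hmul : ∀ a b, D' (ψ a) = ψ (D a) → D' (ψ b) = ψ (D b) → D' (ψ (a * b)) = ψ (D (a * b)) := by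
    intro a b ha hb
    simp [ha, hb]
  have hp : ∀ p, D' (ψ (evalXST n e m d r Q p)) = ψ (D (evalXST n e m d r Q p)) := by
    intro p
    induction p using MvPolynomial.induction_on with
    | C c => simp [evalXST]
    | add p q hp hq =>
      rw [evalXST, map_add, ← evalXST, ← evalXST, map_add, map_add, map_add, map_add, hp, hq]
    | mul_X p i hp =>
      rw [evalXST, map_mul, ← evalXST, aeval_X]
      refine hmul _ _ hp ?_
      fin_cases i
      · exact hx
      · exact hs
      · exact ht
  obtain ⟨M, p, h⟩ := exists_pow_mul_eq_evalXST b
  have h1 := hp p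
  rw [← h, map_mul, Derivation.leibniz, Derivation.leibniz, map_add, smul_eq_mul, smul_eq_mul,
    smul_eq_mul, smul_eq_mul, map_mul, map_mul] at h1
  have h2 : D' (ψ (x n e m d r Q ^ M)) = ψ (D (x n e m d r Q ^ M)) := by
    rw [map_pow, Derivation.leibniz_pow, Derivation.leibniz_pow, hx]
    simp
  rw [h2, add_left_inj] at h1
  exact mul_left_cancel₀ (by rw [map_pow]; exact pow_ne_zero M hψ) h1

end Relations

end NewClass

/-! ### Laurent polynomials in `x, s, t` and their bidegree. -/

namespace NewClass

open MvPolynomial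

/-- The Laurent polynomials in three variables. -/
abbrev Laurent (k : Type*) [Field k] : Type _ := AddMonoidAlgebra k (Fin 3 → ℤ)

open AddMonoidAlgebra (single supportedIn HasInitialForm)

section Monomials

variable {k : Type*} [Field k]

theorem aeval_single_eq_sum {σ G : Type*} [Fintype σ] [AddCommGroup G] (v : σ → G)
    (p : MvPolynomial σ k) : aeval (fun i => (single (v i) 1 : AddMonoidAlgebra k G)) p =
      ∑ m ∈ p.support, single (∑ i, m i • v i) (p.coeff m) := by
  have hprod : ∀ (m : σ →₀ ℕ) (s : Finset σ), ∏ i ∈ s, (single (v i) 1 : AddMonoidAlgebra k G) ^ m i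
      = single (∑ i ∈ s, m i • v i) 1 := by
    classical
    intro m s
    induction s using Finset.induction_on with
    | empty => simp [AddMonoidAlgebra.one_def]
    | insert a s ha ih =>
      rw [Finset.prod_insert ha, Finset.sum_insert ha, ih, AddMonoidAlgebra.single_pow,
        AddMonoidAlgebra.single_mul_single, one_pow, one_mul]
  rw [aeval_def, eval₂_eq']
  refine Finset.sum_congr rfl fun m _ => ?_
  rw [hprod, ← Algebra.smul_def, AddMonoidAlgebra.smul_single, smul_eq_mul, mul_one]

theorem aeval_single_injective {σ G : Type*} [Fintype σ] [AddCommGroup G] {v : σ → G}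
    (hv : Function.Injective fun m : σ →₀ ℕ => ∑ i, m i • v i) : Function.Injective
      (aeval (R := k) (fun i => (single (v i) 1 : AddMonoidAlgebra k G))) := by
  classical
  rw [injective_iff_map_eq_zero]
  intro p hp
  ext m
  by_contra h
  have h1 := congrArg (fun f => f.coeff (∑ i, m i • v i)) hp
  rw [aeval_single_eq_sum] at h1
  simp only [AddMonoidAlgebra.coeff_sum, Finsupp.finsetSum_apply, AddMonoidAlgebra.coeff_single]
    at h1
  rw [Finset.sum_eq_single m] at h1
  · simp at h1
    exact h h1
  · intro m' _ hne
    rw [Finsupp.single_apply, if_neg fun h => hne (hv h)]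
  · intro hm
    simp [notMem_support_iff.1 hm]

theorem aeval_single_mem_supportedIn {σ G : Type*} [Fintype σ] [AddCommGroup G] {v : σ → G}
    {S : Set G} {p : MvPolynomial σ k} (h : ∀ m ∈ p.support, ∑ i, m i • v i ∈ S) :
    aeval (fun i => (single (v i) 1 : AddMonoidAlgebra k G)) p ∈ supportedIn k S := by
  rw [aeval_single_eq_sum]
  exact sum_mem fun m hm => AddMonoidAlgebra.single_mem_supportedIn (h m hm) _

variable (k)

/-- The Laurent monomial `xʲ`. -/
noncomputable def lx (j : ℤ) : Laurent k := single (Pi.single 0 j) 1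

/-- The variable `s` of the Laurent polynomial ring. -/
noncomputable def ls : Laurent k := single (Pi.single 1 1) 1

/-- The variable `t` of the Laurent polynomial ring. -/
noncomputable def lt : Laurent k := single (Pi.single 2 1) 1

/-- The inclusion of `k[x,s,t]` into the Laurent polynomial ring. -/
noncomputable def polyXST : MvPolynomial (Fin 3) k →ₐ[k] Laurent k :=
  aeval ![lx k 1, ls k, lt k]

/-- The inclusion of `k[s,t]` into the Laurent polynomial ring. -/
noncomputable def polyST : MvPolynomial (Fin 2) k →ₐ[k] Laurent k := aeval ![ls k, lt k]

variable {k}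

theorem polyXST_eq : polyXST k = aeval (fun i => (single (Pi.single i 1) 1 : Laurent k)) := by
  rw [polyXST]
  congr 1
  funext i
  fin_cases i <;> rfl

theorem polyST_eq : polyST k =
    aeval (fun i : Fin 2 => (single (Pi.single i.succ 1) 1 : Laurent k)) := by
  rw [polyST]
  congr 1
  funext i
  fin_cases i <;> rfl

theorem sum_smul_single (m : Fin 3 → ℕ) (j : Fin 3) :
    (∑ i, m i • (Pi.single i 1 : Fin 3 → ℤ)) j = m j := by
  simp [Finset.sum_apply, Pi.single_apply]

theorem polyXST_injective : Function.Injective (polyXST k) := by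
  rw [polyXST_eq]
  apply aeval_single_injective
  intro m m' h
  ext i
  have := congrFun h i
  simp only [sum_smul_single] at this
  exact_mod_cast this

theorem polyST_injective : Function.Injective (polyST k) := by
  rw [polyST_eq]
  apply aeval_single_injective
  intro m m' h
  ext i
  have := congrFun h i.succ
  fin_cases i <;> simpa [Fin.sum_univ_two, Pi.single_apply] using this

theorem polyXST_mem (p : MvPolynomial (Fin 3) k) : polyXST k p ∈ supportedIn k {g | 0 ≤ g 0} := by
  rw [polyXST_eq]
  refine aeval_single_mem_supportedIn fun m _ => ?_
  rw [Set.mem_ofPred_eq, sum_smul_single]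
  positivity

theorem lx_add (i j : ℤ) : lx k (i + j) = lx k i * lx k j := by
  rw [lx, lx, lx, AddMonoidAlgebra.single_mul_single, one_mul, ← Pi.single_add]

theorem lx_zero : lx k 0 = 1 := by
  rw [lx, Pi.single_zero, AddMonoidAlgebra.one_def]

theorem lx_one_pow (n : ℕ) : lx k 1 ^ n = lx k n := by
  induction n with
  | zero => rw [pow_zero, Nat.cast_zero, lx_zero]
  | succ n ih => rw [pow_succ, ih, ← lx_add]; push_cast; rfl

theorem lx_ne_zero (j : ℤ) : lx k j ≠ 0 := AddMonoidAlgebra.single_ne_zero.2 one_ne_zero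

theorem lx_pow (j : ℤ) (n : ℕ) : lx k j ^ n = lx k (n * j) := by
  induction n with
  | zero => rw [pow_zero, Nat.cast_zero, zero_mul, lx_zero]
  | succ n ih => rw [pow_succ, ih, ← lx_add]; push_cast; ring_nf

theorem ls_ne_zero : ls k ≠ 0 := AddMonoidAlgebra.single_ne_zero.2 one_ne_zero

theorem lt_ne_zero : lt k ≠ 0 := AddMonoidAlgebra.single_ne_zero.2 one_ne_zero

theorem polyXST_X_zero : polyXST k (X 0) = lx k 1 := by simp [polyXST]

theorem polyXST_rename (p : MvPolynomial (Fin 2) k) :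
    polyXST k (rename Fin.succ p) = polyST k p := by
  rw [polyXST_eq, polyST_eq, aeval_rename]
  rfl

/-- A polynomial in `x, s, t` is the sum of its part without `x` and a multiple of `x`. -/
theorem exists_eq_rename_add (p : MvPolynomial (Fin 3) k) :
    ∃ p₀ p₁, p = rename Fin.succ p₀ + X 0 * p₁ := by
  induction p using MvPolynomial.induction_on with
  | C c => exact ⟨C c, 0, by simp⟩
  | add p q hp hq =>
    obtain ⟨p₀, p₁, rfl⟩ := hp
    obtain ⟨q₀, q₁, rfl⟩ := hq
    exact ⟨p₀ + q₀, p₁ + q₁, by rw [map_add]; ring⟩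
  | mul_X p i hp =>
    obtain ⟨p₀, p₁, rfl⟩ := hp
    induction i using Fin.cases with
    | zero => exact ⟨0, rename Fin.succ p₀ + X 0 * p₁, by rw [map_zero]; ring⟩
    | succ i => exact ⟨p₀ * X i, p₁ * X i.succ, by rw [map_mul, rename_X]; ring⟩

end Monomials

section Weight

variable {k : Type*} [Field k] {d r : ℕ}

/-- The order in `x`, refined by the weights `r` of `s` and `d` of `t`. -/
def bidegree (d r : ℕ) : (Fin 3 → ℤ) →+ ℤ ×ₗ ℤ where
  toFun g := toLex (g 0, r * g 1 + d * g 2)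
  map_zero' := by simp
  map_add' g h := by
    rw [← toLex_add, Prod.mk_add_mk]
    simp only [Pi.add_apply]
    ring_nf

theorem bidegree_apply (g : Fin 3 → ℤ) : bidegree d r g = toLex (g 0, r * g 1 + d * g 2) := rfl

theorem hasInitialForm_lx (j : ℤ) :
    HasInitialForm (bidegree d r) (toLex (j, 0)) (lx k j) (lx k j) := by
  have := AddMonoidAlgebra.hasInitialForm_single (ω := bidegree d r) (Pi.single 0 j) (1 : k)
  rwa [bidegree_apply, show ((Pi.single 0 j : Fin 3 → ℤ) 0,
    (r : ℤ) * (Pi.single 0 j : Fin 3 → ℤ) 1 + d * (Pi.single 0 j : Fin 3 → ℤ) 2) = (j, 0) by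
      simp] at this

theorem lt_bidegree {a b : ℤ} {g : Fin 3 → ℤ} (h : a < g 0) : toLex (a, b) < bidegree d r g :=
  Prod.Lex.toLex_lt_toLex.2 (Or.inl h)

theorem le_of_le_bidegree {a b : ℤ} {g : Fin 3 → ℤ} (h : toLex (a, b) ≤ bidegree d r g) :
    a ≤ g 0 := by
  rcases Prod.Lex.toLex_le_toLex.1 h with h | h
  · exact h.le
  · exact h.1.le

theorem supportedIn_lt (a b : ℤ) : supportedIn k {g : Fin 3 → ℤ | a < g 0} ≤
    supportedIn k {g | toLex (a, b) < bidegree d r g} :=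
  AddMonoidAlgebra.supportedIn_mono fun _ h => lt_bidegree h

theorem toLex_add_toLex (a b a' b' : ℤ) :
    (toLex (a, b) : ℤ ×ₗ ℤ) + toLex (a', b') = toLex (a + a', b + b') := rfl

theorem nsmul_toLex (n : ℕ) (a b : ℤ) : n • (toLex (a, b) : ℤ ×ₗ ℤ) = toLex (n * a, n * b) := by
  induction n with
  | zero => rw [zero_smul, Nat.cast_zero, zero_mul, zero_mul]; rfl
  | succ n ih =>
    rw [succ_nsmul, ih, toLex_add_toLex]
    push_cast
    ring_nf

/-- The exponents of a monomial in `s, t`. -/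
theorem bidegree_sum (m : Fin 2 → ℕ) :
    bidegree d r (∑ i, m i • (Pi.single i.succ 1 : Fin 3 → ℤ)) =
      toLex (0, ((m 0 * r + m 1 * d : ℕ) : ℤ)) := by
  simp [bidegree_apply, Fin.sum_univ_two, mul_comm]

theorem weight_eq (m : Fin 2 →₀ ℕ) : Finsupp.weight ![r, d] m = m 0 * r + m 1 * d := by
  rw [Finsupp.weight_apply, Finsupp.sum_fintype _ _ (by simp)]
  simp [Fin.sum_univ_two]

theorem hasInitialForm_polyST {p : MvPolynomial (Fin 2) k} {ρ : ℕ}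
    (hp : p.IsWeightedHomogeneous ![r, d] ρ) :
    HasInitialForm (bidegree d r) (toLex (0, (ρ : ℤ))) (polyST k p) (polyST k p) := by
  refine AddMonoidAlgebra.hasInitialForm_self ?_
  rw [polyST_eq]
  refine aeval_single_mem_supportedIn fun m hm => ?_
  rw [Set.mem_ofPred_eq, bidegree_sum, ← weight_eq, hp (mem_support_iff.1 hm)]

/-- The initial form of a polynomial in `s, t`. -/
theorem exists_hasInitialForm_polyST (d r : ℕ) {p : MvPolynomial (Fin 2) k} (hp : p ≠ 0) :
    ∃ (ρ : ℕ) (p₀ : MvPolynomial (Fin 2) k), p₀ ≠ 0 ∧ p₀.IsWeightedHomogeneous ![r, d] ρ ∧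
      HasInitialForm (bidegree d r) (toLex (0, (ρ : ℤ))) (polyST k p) (polyST k p₀) := by
  classical
  obtain ⟨m, hm, hmin⟩ := Finset.exists_min_image p.support (Finsupp.weight ![r, d])
    (support_nonempty.2 hp)
  set ρ := Finsupp.weight ![r, d] m with hρ
  have hh := weightedHomogeneousComponent_isWeightedHomogeneous (w := ![r, d]) ρ p
  refine ⟨ρ, weightedHomogeneousComponent ![r, d] ρ p, ?_, hh, ?_⟩
  · intro h0
    have h1 := congrArg (coeff m) h0
    rw [coeff_weightedHomogeneousComponent, if_pos rfl, coeff_zero] at h1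
    exact mem_support_iff.1 hm h1
  · refine ⟨(hasInitialForm_polyST hh).1, ?_⟩
    rw [← map_sub, polyST_eq]
    refine aeval_single_mem_supportedIn fun m' hm' => ?_
    rw [mem_support_iff, coeff_sub, coeff_weightedHomogeneousComponent] at hm'
    rw [Set.mem_ofPred_eq, bidegree_sum, ← weight_eq]
    split_ifs at hm' with h
    · exact absurd (sub_self _) hm'
    · rw [sub_zero] at hm'
      refine Prod.Lex.toLex_lt_toLex.2 (Or.inr ⟨rfl, ?_⟩)
      have := hmin m' (mem_support_iff.2 hm')
      simp only [Nat.cast_lt]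
      omega

end Weight

end NewClass

/-! ### The Laurent embedding and the initial forms of elements of `B`. -/

namespace NewClass

open MvPolynomial
open AddMonoidAlgebra (single supportedIn HasInitialForm)

section LaurentEmbedding

variable (k : Type*) [Field k] (n e m d r : ℕ)

/-- The polynomial `sᵈ + tʳ`. -/
noncomputable def lv : Laurent k := ls k ^ d + lt k ^ r

variable {k} in
/-- The image of `y` in the Laurent polynomial ring. -/
noncomputable def ly (Q : MvPolynomial (Fin 3) k) : Laurent k :=
  lx k (-n) * (lv k d r + lx k 1 * polyXST k Q)

variable {k} in
/-- The image of `z` in the Laurent polynomial ring. -/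
noncomputable def lz (Q : MvPolynomial (Fin 3) k) : Laurent k :=
  lx k (-e) * (ly n d r Q ^ m - ls k)

/-- The initial form of `y`. -/
noncomputable def ly₀ : Laurent k := lx k (-n) * lv k d r

/-- The initial form of `z`. -/
noncomputable def lz₀ : Laurent k := lx k (-(n * m + e : ℕ)) * lv k d r ^ m

variable {k} in
/-- The monomials in `y` and `z` that are linear in the basis `1, y, …, y ^ (m - 1)`. -/
noncomputable def lw (Q : MvPolynomial (Fin 3) k) (c : ℕ) : Laurent k :=
  ly n d r Q ^ (c % m) * lz n e m d r Q ^ (c / m)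

/-- The initial form of `lw`. -/
noncomputable def lw₀ (c : ℕ) : Laurent k := ly₀ k n d r ^ (c % m) * lz₀ k n e m d r ^ (c / m)

/-- Minus the order in `x` of `lw`. -/
def theta (c : ℕ) : ℕ := n * c + e * (c / m)

variable {k n e m d r} {Q : MvPolynomial (Fin 3) k}

theorem lv_eq : lv k d r = polyST k (X 0 ^ d + X 1 ^ r) := by simp [lv, polyST]

theorem isWeightedHomogeneous_X_pow_zero (a : ℕ) :
    (X 0 ^ a : MvPolynomial (Fin 2) k).IsWeightedHomogeneous ![r, d] (a * r) := by
  have := (isWeightedHomogeneous_X k ![r, d] (0 : Fin 2)).pow a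
  simpa using this

theorem isWeightedHomogeneous_X_pow_one (a : ℕ) :
    (X 1 ^ a : MvPolynomial (Fin 2) k).IsWeightedHomogeneous ![r, d] (a * d) := by
  have := (isWeightedHomogeneous_X k ![r, d] (1 : Fin 2)).pow a
  simpa using this

theorem isWeightedHomogeneous_lv (a b : k) :
    (C a * X 0 ^ d + C b * X 1 ^ r : MvPolynomial (Fin 2) k).IsWeightedHomogeneous ![r, d]
      (d * r) := by
  refine IsWeightedHomogeneous.add ?_ ?_
  · simpa using (isWeightedHomogeneous_C ![r, d] a).mul (isWeightedHomogeneous_X_pow_zero d)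
  · simpa [mul_comm d r] using
      (isWeightedHomogeneous_C ![r, d] b).mul (isWeightedHomogeneous_X_pow_one r)

theorem hasInitialForm_lv :
    HasInitialForm (bidegree d r) (toLex (0, ((d * r : ℕ) : ℤ))) (lv k d r) (lv k d r) := by
  rw [lv_eq]
  apply hasInitialForm_polyST
  simpa using isWeightedHomogeneous_lv (k := k) (d := d) (r := r) 1 1

theorem pow_add_pow_ne_zero (hd : d ≠ 0) : (X 0 ^ d + X 1 ^ r : MvPolynomial (Fin 2) k) ≠ 0 := by
  intro h
  by_cases hr : r = 0
  · have h1 := congrArg (aeval (R := k) ![(1 : k), 1]) h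
    have h2 := congrArg (aeval (R := k) ![(0 : k), 1]) h
    simp [hd] at h1 h2
  · have h1 := congrArg (aeval (R := k) ![(1 : k), 0]) h
    simp [hr] at h1

theorem lv_ne_zero (hd : d ≠ 0) : lv k d r ≠ 0 := by
  rw [lv_eq]
  exact (map_ne_zero_iff _ polyST_injective).2 (pow_add_pow_ne_zero hd)

theorem lx_mul_polyXST_mem (p : MvPolynomial (Fin 3) k) (j : ℤ) :
    lx k (j + 1) * polyXST k p ∈ supportedIn k {g | j < g 0} := by
  refine AddMonoidAlgebra.mul_mem_supportedIn (S := {g | j < g 0}) (T := {g | 0 ≤ g 0}) ?_ ?_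
    (polyXST_mem p)
  · intro a ha b hb
    simp only [Set.mem_ofPred_eq, Pi.add_apply] at *
    omega
  · exact AddMonoidAlgebra.single_mem_supportedIn (by simp) _

theorem hasInitialForm_ly : HasInitialForm (bidegree d r) (toLex (-(n : ℤ), ((d * r : ℕ) : ℤ)))
    (ly n d r Q) (ly₀ k n d r) := by
  rw [ly, ly₀, mul_add]
  refine HasInitialForm.add_of_lt ?_ ?_
  · have := (hasInitialForm_lx (k := k) (d := d) (r := r) (-n)).mul hasInitialForm_lv
    rwa [toLex_add_toLex, add_zero, zero_add] at this
  · rw [← mul_assoc, ← lx_add]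
    exact supportedIn_lt _ _ (lx_mul_polyXST_mem Q _)

/-- Since `yᵐ` has `x`-order `-nm < 0`, the summand `s`, of order `0`, does not contribute. -/
theorem hasInitialForm_lz (hn : 1 ≤ n) (hm : 1 ≤ m) :
    HasInitialForm (bidegree d r) (toLex (-((n * m + e : ℕ) : ℤ), ((m * (d * r) : ℕ) : ℤ)))
    (lz n e m d r Q) (lz₀ k n e m d r) := by
  rw [lz, lz₀, mul_sub, sub_eq_add_neg]
  refine HasInitialForm.add_of_lt ?_ (neg_mem ?_)
  · have := (hasInitialForm_lx (k := k) (d := d) (r := r) (-e)).mul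
      ((hasInitialForm_ly (n := n) (Q := Q)).pow m)
    rw [ly₀, mul_pow, ← mul_assoc, lx_pow, ← lx_add, nsmul_toLex, toLex_add_toLex] at this
    convert this using 3 <;> push_cast <;> ring_nf
  · refine supportedIn_lt _ _ ?_
    have h1 : (1 : ℤ) ≤ n * m := by exact_mod_cast Nat.mul_pos hn hm
    rw [lx, ls, AddMonoidAlgebra.single_mul_single]
    refine AddMonoidAlgebra.single_mem_supportedIn ?_ _
    simp
    omega

theorem hasInitialForm_lw (hn : 1 ≤ n) (hm : 1 ≤ m) (c : ℕ) :
    HasInitialForm (bidegree d r) (toLex (-(theta n e m c : ℤ), ((c * (d * r) : ℕ) : ℤ)))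
    (lw n e m d r Q c) (lw₀ k n e m d r c) := by
  have := ((hasInitialForm_ly (n := n) (d := d) (r := r) (Q := Q)).pow (c % m)).mul
    ((hasInitialForm_lz (e := e) (Q := Q) (d := d) (r := r) hn hm).pow (c / m))
  rw [nsmul_toLex, nsmul_toLex, toLex_add_toLex] at this
  have hc : c = c % m + m * (c / m) := (Nat.mod_add_div c m).symm
  rw [lw, lw₀, theta]
  generalize c % m = j at *
  generalize c / m = q at *
  subst hc
  convert this using 3 <;> push_cast <;> ring

theorem lx_mul_ly : lx k n * ly n d r Q = polyXST k (X 1 ^ d + X 2 ^ r + X 0 * Q) := by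
  rw [ly, ← mul_assoc, ← lx_add, add_neg_cancel, lx_zero, one_mul, lv]
  simp [polyXST]

theorem lx_mul_lz : lx k e * lz n e m d r Q = ly n d r Q ^ m - ls k := by
  rw [lz, ← mul_assoc, ← lx_add, add_neg_cancel, lx_zero, one_mul]

/-- The multiples of `lw 0, …, lw c` by polynomials in `x, s, t`. -/
noncomputable def lwSpan (Q : MvPolynomial (Fin 3) k) (n e m d r c : ℕ) :
    Submodule (polyXST k).range (Laurent k) :=
  Submodule.span _ (lw n e m d r Q '' Set.Iic c)

theorem mul_mem_lwSpan {c : ℕ} {f : Laurent k} (p : MvPolynomial (Fin 3) k)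
    (hf : f ∈ lwSpan Q n e m d r c) : polyXST k p * f ∈ lwSpan Q n e m d r c :=
  Submodule.smul_mem _ (⟨_, p, rfl⟩ : (polyXST k).range) hf

theorem lx_mul_mem_lwSpan {c : ℕ} {f : Laurent k} (i : ℕ)
    (hf : f ∈ lwSpan Q n e m d r c) : lx k i * f ∈ lwSpan Q n e m d r c := by
  have := mul_mem_lwSpan (X 0 ^ i) hf
  rwa [map_pow, polyXST_X_zero, lx_one_pow] at this

theorem ls_mul_mem_lwSpan {c : ℕ} {f : Laurent k}
    (hf : f ∈ lwSpan Q n e m d r c) : ls k * f ∈ lwSpan Q n e m d r c := by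
  have := mul_mem_lwSpan (X 1) hf
  rwa [show polyXST k (X 1) = ls k by simp [polyXST]] at this

theorem lw_mem_lwSpan {c c' : ℕ} (h : c ≤ c') : lw n e m d r Q c ∈ lwSpan Q n e m d r c' :=
  Submodule.subset_span ⟨c, h, rfl⟩

theorem lwSpan_mono {c c' : ℕ} (h : c ≤ c') : lwSpan Q n e m d r c ≤ lwSpan Q n e m d r c' :=
  Submodule.span_mono (Set.image_mono (Set.Iic_subset_Iic.2 h))

theorem mem_lwSpan_zero {f : Laurent k} :
    f ∈ lwSpan Q n e m d r 0 ↔ ∃ p, polyXST k p = f := by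
  have h0 : lw n e m d r Q '' Set.Iic 0 = {1} := by
    rw [show Set.Iic 0 = {0} from Set.Iic_bot]
    simp [lw]
  rw [lwSpan, h0, Submodule.mem_span_singleton]
  constructor
  · rintro ⟨⟨_, p, rfl⟩, rfl⟩
    exact ⟨p, by rw [Subalgebra.smul_def]; simp⟩
  · rintro ⟨p, rfl⟩
    exact ⟨⟨_, p, rfl⟩, by rw [Subalgebra.smul_def]; simp⟩

theorem mem_lwSpan_succ {f : Laurent k} {c : ℕ} (hf : f ∈ lwSpan Q n e m d r (c + 1)) :
    ∃ p, ∃ f' ∈ lwSpan Q n e m d r c, f = polyXST k p * lw n e m d r Q (c + 1) + f' := by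
  have h0 : Set.Iic (c + 1) = insert (c + 1) (Set.Iic c) := by
    ext i
    simp only [Set.mem_Iic, Set.mem_insert_iff]
    omega
  rw [lwSpan, h0, Set.image_insert_eq, Submodule.mem_span_insert] at hf
  obtain ⟨⟨_, p, rfl⟩, f', hf', rfl⟩ := hf
  exact ⟨p, f', hf', rfl⟩

theorem mod_div_eq {q j : ℕ} (hj : j < m) : (m * q + j) % m = j ∧ (m * q + j) / m = q := by
  constructor
  · rw [Nat.mul_add_mod, Nat.mod_eq_of_lt hj]
  · rw [Nat.mul_add_div (by omega), Nat.div_eq_of_lt hj, add_zero]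

theorem lw_eq {q j : ℕ} (hj : j < m) : lw n e m d r Q (m * q + j) =
    ly n d r Q ^ j * lz n e m d r Q ^ q := by
  rw [lw, (mod_div_eq hj).1, (mod_div_eq hj).2]

theorem theta_eq {q j : ℕ} (hj : j < m) : theta n e m (m * q + j) = n * (m * q + j) + e * q := by
  rw [theta, (mod_div_eq hj).2]

theorem exists_mod_div (hm : 1 ≤ m) (c : ℕ) : ∃ q j, j < m ∧ c = m * q + j :=
  ⟨c / m, c % m, Nat.mod_lt _ hm, (Nat.div_add_mod c m).symm⟩

/-- A large enough power of `x` times `lw (c + 1)` is a combination of the previous `lw`. -/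
theorem lx_mul_lw_mem (hm : 1 ≤ m) (c : ℕ) : ∃ τ : ℕ, theta n e m (c + 1) = theta n e m c + τ ∧
    lx k τ * lw n e m d r Q (c + 1) ∈ lwSpan Q n e m d r c := by
  obtain ⟨q, j, hj, rfl⟩ := exists_mod_div hm c
  by_cases hj1 : j + 1 < m
  · refine ⟨n, ?_, ?_⟩
    · rw [add_assoc, theta_eq hj1, theta_eq hj]; ring
    · rw [add_assoc, lw_eq hj1, pow_succ]
      have := mul_mem_lwSpan (X 1 ^ d + X 2 ^ r + X 0 * Q)
        (lw_mem_lwSpan (n := n) (e := e) (m := m) (d := d) (r := r) (Q := Q) (le_refl (m * q + j)))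
      rw [← lx_mul_ly (n := n), lw_eq hj] at this
      convert this using 1
      ring
  -- Carrying over from `y^(m-1)` to `z` uses `x^(n+e) z = (xⁿy) y^(m-1) - xⁿs`.
  · have hj2 : j = m - 1 := by omega
    have h1 : m * q + j + 1 = m * (q + 1) + 0 := by rw [mul_add]; omega
    refine ⟨n + e, ?_, ?_⟩
    · rw [h1, theta_eq hm, theta_eq hj, ← h1]; ring
    · rw [h1, lw_eq hm, pow_zero, one_mul]
      have h2 := mul_mem_lwSpan (X 1 ^ d + X 2 ^ r + X 0 * Q)
        (lw_mem_lwSpan (n := n) (e := e) (m := m) (d := d) (r := r) (Q := Q) (le_refl (m * q + j)))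
      have h3 := lx_mul_mem_lwSpan n (ls_mul_mem_lwSpan
        (lw_mem_lwSpan (n := n) (e := e) (m := m) (d := d) (r := r) (Q := Q) (c := m * q + 0)
          (c' := m * q + j) (by omega)))
      rw [← lx_mul_ly (n := n), lw_eq hj] at h2
      rw [lw_eq hm, pow_zero, one_mul] at h3
      convert sub_mem h2 h3 using 1
      have h4 : ly n d r Q ^ m = ly n d r Q * ly n d r Q ^ j := by
        rw [← pow_succ', hj2, Nat.sub_add_cancel hm]
      have h5 := lx_mul_lz (k := k) (n := n) (e := e) (m := m) (d := d) (r := r) (Q := Q)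
      rw [h4] at h5
      rw [Nat.cast_add, lx_add, pow_succ]
      linear_combination (lx k n * lz n e m d r Q ^ q) * h5

theorem lwSpan_mem_supportedIn (hn : 1 ≤ n) (hm : 1 ≤ m) {c : ℕ} {f : Laurent k}
    (hf : f ∈ lwSpan Q n e m d r c) : f ∈ supportedIn k {g | -(theta n e m c : ℤ) ≤ g 0} := by
  induction hf using Submodule.span_induction with
  | mem f hf =>
    obtain ⟨c', hc', rfl⟩ := hf
    refine AddMonoidAlgebra.supportedIn_mono (fun g hg => ?_)
      (hasInitialForm_lw (d := d) (r := r) hn hm c').mem_le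
    have h1 := le_of_le_bidegree hg
    have h2 : theta n e m c' ≤ theta n e m c := by
      rw [theta, theta]
      gcongr <;> exact hc'
    simp only [Set.mem_ofPred_eq]
    omega
  | zero => exact zero_mem _
  | add f g _ _ hf hg => exact add_mem hf hg
  | smul a f _ hf =>
    obtain ⟨_, p, rfl⟩ := a
    refine AddMonoidAlgebra.mul_mem_supportedIn (fun a ha b hb => ?_) (polyXST_mem p) hf
    simp only [Set.mem_ofPred_eq, Pi.add_apply] at *
    omega

/-- The shape of the initial form of an element of `B`. -/
theorem exists_hasInitialForm_of_mem_lwSpan (hn : 1 ≤ n) (hm : 1 ≤ m) {c : ℕ} {f : Laurent k}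
    (hf : f ∈ lwSpan Q n e m d r c) (h0 : f ≠ 0) :
    ∃ (i c' ρ : ℕ) (p : MvPolynomial (Fin 2) k), p ≠ 0 ∧ p.IsWeightedHomogeneous ![r, d] ρ ∧
      HasInitialForm (bidegree d r) (toLex ((i : ℤ) - theta n e m c', ((ρ + c' * (d * r) : ℕ) : ℤ)))
        f (lx k i * polyST k p * lw₀ k n e m d r c') ∧ (c' = 0 → ∃ P, polyXST k P = f) := by
  -- Split off the largest power of `x`. What remains has a nonzero part `p₀` free of `x`.
  have key : ∀ p : MvPolynomial (Fin 3) k, p ≠ 0 → ∃ (i : ℕ) (p₀ : MvPolynomial (Fin 2) k) (p₁ p' :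
      MvPolynomial (Fin 3) k), p₀ ≠ 0 ∧ p = X 0 ^ i * p' ∧
        p' = rename Fin.succ p₀ + X 0 * p₁ := by
    intro p hp
    obtain ⟨p', h1, h2⟩ := (FiniteMultiplicity.of_not_isUnit
      (X_prime (R := k) (i := (0 : Fin 3))).not_isUnit hp).exists_eq_pow_mul_and_not_dvd
    obtain ⟨p₀, p₁, h⟩ := exists_eq_rename_add p'
    refine ⟨_, p₀, p₁, p', ?_, h1, h⟩
    rintro rfl
    exact h2 ⟨p₁, by rw [h, map_zero, zero_add]⟩
  have lead : ∀ (i c' : ℕ) (p₀ : MvPolynomial (Fin 2) k) (p₁ : MvPolynomial (Fin 3) k), p₀ ≠ 0 →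
      ∃ (ρ : ℕ) (p : MvPolynomial (Fin 2) k), p ≠ 0 ∧ p.IsWeightedHomogeneous ![r, d] ρ ∧
        HasInitialForm (bidegree d r)
          (toLex ((i : ℤ) - theta n e m c', ((ρ + c' * (d * r) : ℕ) : ℤ)))
          (polyXST k (X 0 ^ i * (rename Fin.succ p₀ + X 0 * p₁)) * lw n e m d r Q c')
          (lx k i * polyST k p * lw₀ k n e m d r c') := by
    intro i c' p₀ p₁ hp₀
    obtain ⟨ρ, p, hp, hw, hi⟩ := exists_hasInitialForm_polyST d r hp₀
    refine ⟨ρ, p, hp, hw, ?_⟩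
    have h1 : HasInitialForm (bidegree d r) (toLex (0, (ρ : ℤ)))
        (polyXST k (rename Fin.succ p₀ + X 0 * p₁)) (polyST k p) := by
      rw [map_add, polyXST_rename, map_mul, polyXST_X_zero]
      refine hi.add_of_lt (supportedIn_lt _ _ ?_)
      simpa using lx_mul_polyXST_mem p₁ 0
    have h2 := ((hasInitialForm_lx i).mul h1).mul (hasInitialForm_lw (e := e) (Q := Q) hn hm c')
    rw [toLex_add_toLex, toLex_add_toLex] at h2
    rw [map_mul, map_pow, polyXST_X_zero, lx_one_pow]
    convert h2 using 3
    · ring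
    · push_cast; ring
  induction c generalizing f with
  | zero =>
    obtain ⟨P, rfl⟩ := mem_lwSpan_zero.1 hf
    have hP : P ≠ 0 := by rintro rfl; exact h0 (map_zero _)
    obtain ⟨i, p₀, p₁, _, hp₀, h1, rfl⟩ := key P hP
    obtain ⟨ρ, p, hp, hw, hi⟩ := lead i 0 p₀ p₁ hp₀
    refine ⟨i, 0, ρ, p, hp, hw, ?_, fun _ => ⟨P, rfl⟩⟩
    rw [← h1, show lw n e m d r Q 0 = 1 by simp [lw], mul_one] at hi
    exact hi
  | succ c ih =>
    obtain ⟨P, f', hf', rfl⟩ := mem_lwSpan_succ hf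
    by_cases hP : P = 0
    · rw [hP, map_zero, zero_mul, zero_add] at h0 ⊢
      exact ih hf' h0
    obtain ⟨i, p₀, p₁, p', hp₀, h1, h2⟩ := key P hP
    obtain ⟨τ, hτ, hmem⟩ := lx_mul_lw_mem (k := k) (n := n) (e := e) (d := d) (r := r) (Q := Q) hm c
    -- If the coefficient of the top `lw` is divisible by `x^τ`, the top term can be rewritten with
    -- lower ones. Otherwise its `x`-order `i - theta (c + 1)` is below `-theta c`, a lower bound
    -- for the order of the rest, so nothing cancels.
    by_cases hi : τ ≤ i
    · refine ih (add_mem ?_ hf') h0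
      obtain ⟨i, rfl⟩ := Nat.exists_eq_add_of_le hi
      have := mul_mem_lwSpan (X 0 ^ i * p') hmem
      convert this using 1
      rw [h1, pow_add, mul_assoc, map_mul, map_pow, polyXST_X_zero, lx_one_pow]
      ring
    · obtain ⟨ρ, p, hp, hw, hin⟩ := lead i (c + 1) p₀ p₁ hp₀
      refine ⟨i, c + 1, ρ, p, hp, hw, ?_, fun h => absurd h (by omega)⟩
      rw [← h2, ← h1] at hin
      refine hin.add_of_lt (supportedIn_lt _ _ ?_)
      refine AddMonoidAlgebra.supportedIn_mono (fun g hg => ?_) (lwSpan_mem_supportedIn hn hm hf')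
      simp only [Set.mem_ofPred_eq] at *
      omega

end LaurentEmbedding

end NewClass

/-! ### From derivations to univariate polynomials over an algebraically closed field. -/

namespace Derivation

variable {k A : Type*} [Field k] [CharZero k] [CommRing A] [IsDomain A] [Algebra k A]

open Polynomial in
/-- The exponential map, as an embedding into a polynomial ring over an algebraically closed field
under which the nonzero elements of the kernel correspond to the units. -/
theorem exists_algHom_polynomial (D : Derivation k A A) :
    ∃ Φ : D.nilSubalgebra →ₐ[k] (AlgebraicClosure (FractionRing A))[X],
      ∀ a : D.nilSubalgebra, a ≠ 0 → (Φ a ≠ 0 ∧ (D a = 0 ↔ IsUnit (Φ a))) := by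
  set F := AlgebraicClosure (FractionRing A)
  let co : A[X] →ₐ[k] PowerSeries A := (coeToPowerSeries.algHom (R := A) A).restrictScalars k
  have hco : ∀ q, co q = (q : PowerSeries A) := fun q => by
    simp [co, coeToPowerSeries.algHom_apply]
  have hcoinj : Function.Injective co := fun a b h => by
    rw [hco, hco] at h
    exact Polynomial.coe_inj.1 h
  let e := AlgEquiv.ofInjective co hcoinj
  let E : D.nilSubalgebra →ₐ[k] A[X] := (e.symm : co.range →ₐ[k] A[X]).comp
    ((D.expHom.comp D.nilSubalgebra.val).codRestrict co.range fun a => a.2)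
  have hE : ∀ a, (E a : PowerSeries A) = D.expHom a := by
    intro a
    rw [← hco]
    have := e.apply_symm_apply (((D.expHom.comp D.nilSubalgebra.val).codRestrict co.range
      fun a => a.2) a)
    exact congrArg Subtype.val this
  let ι : A →ₐ[k] F := IsScalarTower.toAlgHom k A F
  have hι : Function.Injective ι := by
    have h1 : Function.Injective (algebraMap A (FractionRing A)) := IsFractionRing.injective A _
    have h2 : Function.Injective (algebraMap (FractionRing A) F) := RingHom.injective _
    have : (ι : A → F) = algebraMap (FractionRing A) F ∘ algebraMap A (FractionRing A) := by
      funext a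
      exact IsScalarTower.algebraMap_apply A (FractionRing A) F a
    rw [this]
    exact h2.comp h1
  refine ⟨(mapAlgHom ι).comp E, fun a ha => ?_⟩
  have hE0 : E a ≠ 0 := by
    intro h
    have h1 := hE a
    rw [h, Polynomial.coe_zero] at h1
    exact ha (Subtype.ext (D.expHom_injective (by rw [← h1, ZeroMemClass.coe_zero, map_zero])))
  have hm : ((mapAlgHom ι).comp E) a = (E a).map (ι : A →+* F) := rfl
  have h0 : (E a).map (ι : A →+* F) ≠ 0 := (Polynomial.map_ne_zero_iff hι).2 hE0
  have hd : ((E a).map (ι : A →+* F)).natDegree = (E a).natDegree :=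
    natDegree_map_eq_of_injective (f := (ι : A →+* F)) hι _
  rw [hm]
  refine ⟨h0, ?_⟩
  -- Kernel elements are those with exponential of degree zero. Over a field, a nonzero polynomial
  -- is a unit exactly in that case.
  rw [apply_eq_zero_iff_natDegree (hE a), isUnit_iff_degree_eq_zero,
    degree_eq_natDegree h0, hd, Nat.cast_eq_zero]

end Derivation

/-! ### Initial derivations that kill the initial form of `z`. -/

namespace NewClass

open MvPolynomial
open AddMonoidAlgebra (single supportedIn HasInitialForm)

section Initial

variable {k : Type*} [Field k] {n e m d r : ℕ} {Q : MvPolynomial (Fin 3) k}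

theorem exists_laurent_embedding (hn : 1 ≤ n) (hm : 2 ≤ m) (hd : 2 ≤ d) :
    ∃ ψ : B n e m d r Q →ₐ[k] Laurent k, Function.Injective ψ ∧
      (∀ p, ψ (evalXST n e m d r Q p) = polyXST k p) ∧
      ψ (y n e m d r Q) = ly n d r Q ∧ ψ (z n e m d r Q) = lz n e m d r Q := by
  obtain ⟨ψ, hx, hs, ht, hy, hz⟩ := exists_lift (n := n) (e := e) (m := m) (d := d) (r := r)
    (Q := Q) (x' := lx k 1) (s' := ls k) (t' := lt k) (y' := ly n d r Q) (z' := lz n e m d r Q)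
    (by rw [lx_one_pow, lx_mul_ly]; simp [polyXST]) (by rw [lx_one_pow, lx_mul_lz])
  have hψ : ∀ p, ψ (evalXST n e m d r Q p) = polyXST k p := fun p => by
    rw [map_evalXST, hx, hs, ht, polyXST]
  refine ⟨ψ, injective_of_injective_evalXST hn hm hd ψ ?_, hψ, hy, hz⟩
  simpa only [hψ] using polyXST_injective

/-- The only product that leaves the set of monomials `lw` is `y · y^(m-1)`, and `yᵐ = xᵉz + s`
brings it back. -/
theorem exists_mem_lwSpan (hm : 2 ≤ m) {ψ : B n e m d r Q →ₐ[k] Laurent k}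
    (hP : ∀ p, ψ (evalXST n e m d r Q p) = polyXST k p)
    (hy : ψ (y n e m d r Q) = ly n d r Q) (hz : ψ (z n e m d r Q) = lz n e m d r Q)
    (b : B n e m d r Q) : ∃ c, ψ b ∈ lwSpan Q n e m d r c := by
  have hmul : ∀ (w : Laurent k), (∀ c, ∃ c', w * lw n e m d r Q c ∈ lwSpan Q n e m d r c') →
      ∀ f, (∃ c, f ∈ lwSpan Q n e m d r c) → ∃ c, f * w ∈ lwSpan Q n e m d r c := by
    rintro w hw f ⟨c, hf⟩
    induction hf using Submodule.span_induction with
    | mem f hf =>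
      obtain ⟨c', -, rfl⟩ := hf
      obtain ⟨c'', h⟩ := hw c'
      exact ⟨c'', by rwa [mul_comm]⟩
    | zero => exact ⟨0, by rw [zero_mul]; exact zero_mem _⟩
    | add f g _ _ hf hg =>
      obtain ⟨c₁, h₁⟩ := hf
      obtain ⟨c₂, h₂⟩ := hg
      refine ⟨max c₁ c₂, ?_⟩
      rw [add_mul]
      exact add_mem (lwSpan_mono (le_max_left _ _) h₁) (lwSpan_mono (le_max_right _ _) h₂)
    | smul a f _ hf =>
      obtain ⟨c, h⟩ := hf
      exact ⟨c, by rw [smul_mul_assoc]; exact Submodule.smul_mem _ a h⟩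
  have hpoly : ∀ p f, (∃ c, f ∈ lwSpan Q n e m d r c) →
      ∃ c, f * ψ (evalXST n e m d r Q p) ∈ lwSpan Q n e m d r c := by
    rintro p f ⟨c, hf⟩
    exact ⟨c, by rw [hP, mul_comm]; exact mul_mem_lwSpan p hf⟩
  induction b using induction_on_B with
  | C c =>
    refine ⟨0, mem_lwSpan_zero.2 ⟨C c, ?_⟩⟩
    rw [AlgHom.commutes, ← MvPolynomial.algebraMap_eq, AlgHom.commutes]
  | add a b ha hb =>
    obtain ⟨c₁, h₁⟩ := ha
    obtain ⟨c₂, h₂⟩ := hb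
    refine ⟨max c₁ c₂, ?_⟩
    rw [map_add]
    exact add_mem (lwSpan_mono (le_max_left _ _) h₁) (lwSpan_mono (le_max_right _ _) h₂)
  | mul_x a ha => rw [map_mul]; simpa [evalXST] using hpoly (X 0) _ ha
  | mul_y a ha =>
    rw [map_mul, hy]
    refine hmul _ (fun c => ?_) _ ha
    obtain ⟨q, j, hj, rfl⟩ := exists_mod_div (m := m) (by omega) c
    rw [lw_eq hj, ← mul_assoc, ← pow_succ']
    by_cases hj1 : j + 1 < m
    · exact ⟨m * q + (j + 1), by rw [← lw_eq hj1]; exact lw_mem_lwSpan le_rfl⟩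
    · have h1 : j + 1 = m := by omega
      have h2 : ly n d r Q ^ m = lx k e * lz n e m d r Q + ls k := by rw [lx_mul_lz]; ring
      have h3 := lx_mul_mem_lwSpan e (lw_mem_lwSpan (n := n) (e := e) (m := m) (d := d) (r := r)
        (Q := Q) (le_refl (m * (q + 1) + 0)))
      have h4 := ls_mul_mem_lwSpan (lw_mem_lwSpan (n := n) (e := e) (m := m) (d := d) (r := r)
        (Q := Q) (c := m * q + 0) (c' := m * (q + 1) + 0) (by rw [mul_add]; omega))
      refine ⟨m * (q + 1) + 0, ?_⟩
      rw [lw_eq (by omega)] at h3 h4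
      rw [h1, h2]
      convert add_mem h3 h4 using 1
      ring
  | mul_z a ha =>
    rw [map_mul, hz]
    refine hmul _ (fun c => ?_) _ ha
    obtain ⟨q, j, hj, rfl⟩ := exists_mod_div (m := m) (by omega) c
    refine ⟨m * (q + 1) + j, ?_⟩
    have h := lw_mem_lwSpan (n := n) (e := e) (m := m) (d := d) (r := r)
        (Q := Q) (le_refl (m * (q + 1) + j))
    rw [lw_eq hj] at h ⊢
    convert h using 1
    ring
  | mul_t a ha => rw [map_mul]; simpa [evalXST] using hpoly (X 2) _ ha

/-- The degeneration of `yᵐ - s = xᵉz`, in which `s` has disappeared. It links the kernel membership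
of `y₀` to that of `z₀` and of `xᵉ`. -/
theorem ly₀_pow : ly₀ k n d r ^ m = lx k 1 ^ e * lz₀ k n e m d r := by
  rw [ly₀, lz₀, lx_one_pow, ← mul_assoc, ← lx_add, mul_pow, lx_pow]
  congr 2
  push_cast
  ring

theorem lv_pow : lv k d r ^ m = lx k 1 ^ (n * m + e) * lz₀ k n e m d r := by
  rw [lz₀, lx_one_pow, ← mul_assoc, ← lx_add, add_neg_cancel, lx_zero, one_mul]

theorem ly₀_ne_zero (hd : d ≠ 0) : ly₀ k n d r ≠ 0 := mul_ne_zero (lx_ne_zero _) (lv_ne_zero hd)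

theorem lz₀_ne_zero (hd : d ≠ 0) : lz₀ k n e m d r ≠ 0 :=
  mul_ne_zero (lx_ne_zero _) (pow_ne_zero _ (lv_ne_zero hd))

variable [CharZero k]

open Polynomial in
/-- A derivation of the Laurent polynomial ring that is nilpotent on the variables and kills the
initial form of `z`, and one of `x` and the nonconstant quasi-homogeneous polynomials in `s, t`,
kills everything. -/
theorem apply_eq_zero_of_apply_lz₀_eq_zero (hn : 1 ≤ n) (hne : (n, e) ≠ (1, 0)) (hm : 2 ≤ m)
    (hd : 2 ≤ d) (hr : 2 ≤ r) (hdr : Nat.gcd d r = 1) {δ : Derivation k (Laurent k) (Laurent k)}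
    (hx : lx k 1 ∈ δ.nilSubalgebra) (hs : ls k ∈ δ.nilSubalgebra) (ht : lt k ∈ δ.nilSubalgebra)
    (hz : lz₀ k n e m d r ∈ δ.nilSubalgebra) (hδz : δ (lz₀ k n e m d r) = 0)
    (h : δ (lx k 1) = 0 ∨ ∃ (ρ : ℕ) (p : MvPolynomial (Fin 2) k), ρ ≠ 0 ∧ p ≠ 0 ∧
      p.IsWeightedHomogeneous ![r, d] ρ ∧ δ (polyST k p) = 0) :
    δ (lx k 1) = 0 ∧ δ (ls k) = 0 ∧ δ (lt k) = 0 := by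
  -- The excluded pair `(n, e) = (1, 0)` is exactly the case of equality.
  have hN : m < n * m + e := by
    rcases Nat.lt_or_ge 1 n with h1 | h1
    · nlinarith
    · obtain rfl : n = 1 := by omega
      have : e ≠ 0 := by rintro rfl; exact hne rfl
      omega
  obtain ⟨Φ, hΦ⟩ := δ.exists_algHom_polynomial
  set F := AlgebraicClosure (FractionRing (Laurent k))
  have : CharZero F := charZero_of_injective_algebraMap (RingHom.injective (algebraMap k F))
  let x' : δ.nilSubalgebra := ⟨_, hx⟩
  let s' : δ.nilSubalgebra := ⟨_, hs⟩
  let t' : δ.nilSubalgebra := ⟨_, ht⟩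
  let z' : δ.nilSubalgebra := ⟨_, hz⟩
  obtain ⟨hX0, hX⟩ := hΦ x' fun h => lx_ne_zero 1 (congrArg Subtype.val h)
  obtain ⟨hS0, hS⟩ := hΦ s' fun h => ls_ne_zero (congrArg Subtype.val h)
  obtain ⟨hT0, hT⟩ := hΦ t' fun h => lt_ne_zero (congrArg Subtype.val h)
  obtain ⟨hZ0, hZ⟩ := hΦ z' fun h => lz₀_ne_zero (by omega) (congrArg Subtype.val h)
  have hZu : IsUnit (Φ z') := hZ.1 hδz
  -- The image of `lv_pow`. As `Φ z'` is a nonzero constant, `(Sᵈ + Tʳ)ᵐ` is a constant times a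
  -- power with exponent larger than `m`.
  have heq : (Φ s' ^ d + Φ t' ^ r) ^ m = Φ z' * Φ x' ^ (n * m + e) := by
    rw [← map_pow, ← map_pow, ← map_pow, ← map_add, ← map_pow, ← map_mul]
    congr 1
    apply Subtype.ext
    have := lv_pow (k := k) (n := n) (e := e) (m := m) (d := d) (r := r)
    rw [mul_comm] at this
    exact this
  obtain ⟨c, hc, hZc⟩ := Polynomial.isUnit_iff.1 hZu
  have hc0 : c ≠ 0 := hc.ne_zero
  have unit_of : ∀ q : F[X], q ≠ 0 → q.natDegree = 0 → IsUnit q := fun q h0 h => by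
    rw [Polynomial.eq_C_of_natDegree_eq_zero h] at h0 ⊢
    exact Polynomial.isUnit_C.2 (Polynomial.C_ne_zero.1 h0).isUnit
  rw [← hZc] at heq
  -- Once `S` and `T` are constant, `heq` makes the image of `x` constant as well.
  have fin : (Φ s').natDegree = 0 → (Φ t').natDegree = 0 →
      δ (lx k 1) = 0 ∧ δ (ls k) = 0 ∧ δ (lt k) = 0 := by
    intro h1 h2
    refine ⟨hX.2 (unit_of _ hX0 ?_), hS.2 (unit_of _ hS0 h1), hT.2 (unit_of _ hT0 h2)⟩
    have h3 : (Φ s' ^ d + Φ t' ^ r).natDegree = 0 := by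
      have := natDegree_add_le (Φ s' ^ d) (Φ t' ^ r)
      rw [natDegree_pow, natDegree_pow, h1, h2] at this
      simpa using this
    have h4 := congrArg natDegree heq
    rw [natDegree_C_mul hc0, natDegree_pow, natDegree_pow, h3, mul_zero, eq_comm,
      mul_eq_zero] at h4
    exact h4.resolve_left (by omega)
  rcases h with h | ⟨ρ, p, hρ, hp0, hp, hδp⟩
  · have h1 : IsUnit (Φ s' ^ d + Polynomial.C (1 : F) * Φ t' ^ r) := by
      have : IsUnit ((Φ s' ^ d + Φ t' ^ r) ^ m) := by
        rw [heq]
        exact (Polynomial.isUnit_C.2 hc).mul ((hX.1 h).pow _)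
      rw [Polynomial.C_1, one_mul]
      exact (isUnit_pow_iff (by omega)).1 this
    obtain ⟨h2, h3⟩ := natDegree_eq_zero_of_isUnit_pow_add one_ne_zero hd hr h1
    exact fin h2 h3
  · let p' : δ.nilSubalgebra := MvPolynomial.aeval ![s', t'] p
    have hp' : (p' : Laurent k) = polyST k p := by
      have := comp_aeval_apply ![s', t'] δ.nilSubalgebra.val p
      rw [comp_vec_two] at this
      exact this
    have hpu : IsUnit (MvPolynomial.aeval ![Φ s', Φ t'] p) := by
      have h1 := (hΦ p' fun h => hp0 (polyST_injective (by rw [← hp', h, map_zero]; rfl))).2.1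
        (by rw [hp', hδp])
      rwa [comp_aeval_apply, comp_vec_two] at h1
    rcases isUnit_of_isUnit_aeval_isWeightedHomogeneous (by omega) (by omega) hdr hp hρ hpu with
      hu | hu | ⟨a, ha, hu⟩
    · obtain ⟨a, ha, hSa⟩ := Polynomial.isUnit_iff.1 hu
      refine fin (Polynomial.natDegree_eq_zero_of_isUnit hu) ?_
      rw [← hSa, ← Polynomial.C_pow] at heq
      exact natDegree_eq_zero_of_pow_eq (pow_ne_zero d ha.ne_zero) hc0 (by omega) hN hr heq
    · obtain ⟨a, ha, hTa⟩ := Polynomial.isUnit_iff.1 hu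
      refine fin ?_ (Polynomial.natDegree_eq_zero_of_isUnit hu)
      rw [← hTa, ← Polynomial.C_pow, add_comm] at heq
      exact natDegree_eq_zero_of_pow_eq (pow_ne_zero r ha.ne_zero) hc0 (by omega) hN hd heq
    · obtain ⟨h2, h3⟩ := natDegree_eq_zero_of_isUnit_pow_add ha hd hr hu
      exact fin h2 h3

end Initial

end NewClass

/-! ### The kernel lies in `k[x, s, t]`. -/

namespace NewClass

open MvPolynomial
open AddMonoidAlgebra (single supportedIn HasInitialForm eulerSum)

section KernelInPolynomials

variable {k : Type*} [Field k] [CharZero k] {n e m d r : ℕ} {Q : MvPolynomial (Fin 3) k}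

/-- The characters of `ℤ³` given by the exponents. -/
def exponentChar (k : Type*) [Field k] (i : Fin 3) : (Fin 3 → ℤ) →+ k :=
  (Int.castAddHom k).comp (Pi.evalAddMonoidHom (fun _ => ℤ) i)

theorem eulerSum_single (a : Fin 3 → Laurent k) (i : Fin 3) :
    eulerSum (exponentChar k) a (single (Pi.single i 1) 1) = a i * single (Pi.single i 1) 1 := by
  rw [AddMonoidAlgebra.eulerSum_apply, Finset.sum_eq_single i]
  · rw [AddMonoidAlgebra.euler_single]
    simp [exponentChar]
  · intro j _ hj
    rw [AddMonoidAlgebra.euler_single]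
    simp [exponentChar, hj.symm]
  · simp

/-- Monomials are invertible, so prescribed values on the variables are reached by dividing them by
the variables. -/
theorem exists_eulerSum_eq (a : Fin 3 → Laurent k) :
    ∃ b : Fin 3 → Laurent k, ∀ i, eulerSum (exponentChar k) b (single (Pi.single i 1) 1) = a i := by
  refine ⟨fun i => a i * single (Pi.single i (-1)) 1, fun i => ?_⟩
  rw [eulerSum_single, mul_assoc, AddMonoidAlgebra.single_mul_single, one_mul, ← Pi.single_add,
    neg_add_cancel, Pi.single_zero, ← AddMonoidAlgebra.one_def, mul_one]

theorem eulerSum_eq_zero {b : Fin 3 → Laurent k}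
    (h : ∀ i, eulerSum (exponentChar k) b (single (Pi.single i 1) 1) = 0) (i : Fin 3) :
    b i = 0 := by
  have := h i
  rw [eulerSum_single] at this
  exact (mul_eq_zero.1 this).resolve_right (AddMonoidAlgebra.single_ne_zero.2 one_ne_zero)

/-- A derivation `D` of `B` together with the lowest homogeneous component `δ` of its extension to
the Laurent polynomial ring. -/
theorem exists_initial_derivation {ψ : B n e m d r Q →ₐ[k] Laurent k} (hψ : Function.Injective ψ)
    (hP : ∀ p, ψ (evalXST n e m d r Q p) = polyXST k p)
    {D : Derivation k (B n e m d r Q) (B n e m d r Q)} (h0 : D ≠ 0) :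
    ∃ (δ : Derivation k (Laurent k) (Laurent k)) (ν : ℤ ×ₗ ℤ),
      ¬ (δ (lx k 1) = 0 ∧ δ (ls k) = 0 ∧ δ (lt k) = 0) ∧
      ∀ (f : B n e m d r Q) (γ : ℤ ×ₗ ℤ) (h : Laurent k),
        HasInitialForm (bidegree d r) γ (ψ f) h → ∀ j : ℕ,
          HasInitialForm (bidegree d r) (γ + j • ν) (ψ ((⇑D)^[j] f)) ((⇑δ)^[j] h) := by
  have hx : ψ (x n e m d r Q) = lx k 1 := by
    have := hP (X 0); simpa [evalXST, polyXST] using this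
  have hs : ψ (s n e m d r Q) = ls k := by
    have := hP (X 1); simpa [evalXST, polyXST] using this
  have ht : ψ (t n e m d r Q) = lt k := by
    have := hP (X 2); simpa [evalXST, polyXST] using this
  -- This is the extension of `D` to Laurent polynomials, written through Euler derivations. The
  -- lowest component of the vector `a` defines `δ`.
  obtain ⟨a, ha⟩ := exists_eulerSum_eq
    ![ψ (D (x n e m d r Q)), ψ (D (s n e m d r Q)), ψ (D (t n e m d r Q))]
  have hD : ∀ b, eulerSum (exponentChar k) a (ψ b) = ψ (D b) :=
    derivation_comp_eq ψ (by rw [hx]; exact lx_ne_zero 1) D _ (by rw [hx]; exact ha 0)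
      (by rw [hs]; exact ha 1) (by rw [ht]; exact ha 2)
  have ha0 : ∃ i, a i ≠ 0 := by
    by_contra! h
    apply h0
    ext b
    apply hψ
    rw [← hD, AddMonoidAlgebra.eulerSum_apply]
    simp [h]
  obtain ⟨ν, b, hab, i, hi⟩ := AddMonoidAlgebra.exists_hasInitialForm (bidegree d r) a ha0
  refine ⟨eulerSum (exponentChar k) b, ν, ?_, fun f γ h H j => ?_⟩
  · rintro ⟨h1, h2, h3⟩
    apply hi
    apply eulerSum_eq_zero
    intro i
    fin_cases i
    exacts [h1, h2, h3]
  · have hj : ψ ((⇑D)^[j] f) = (⇑(eulerSum (exponentChar k) a))^[j] (ψ f) := by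
      induction j with
      | zero => rfl
      | succ j ih => rw [Function.iterate_succ_apply', Function.iterate_succ_apply', ← ih, hD]
    rw [hj]
    exact H.iterate_eulerSum hab j

/-- Every kernel of a nonzero locally nilpotent derivation of `B` lies in `k[x, s, t]`. -/
theorem exists_evalXST_eq_of_apply_eq_zero (hn : 1 ≤ n) (hne : (n, e) ≠ (1, 0)) (hm : 2 ≤ m)
    (hd : 2 ≤ d) (hr : 2 ≤ r) (hdr : Nat.gcd d r = 1)
    {D : Derivation k (B n e m d r Q) (B n e m d r Q)} (hD : D.IsLocallyNilpotent) (h0 : D ≠ 0)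
    {f : B n e m d r Q} (hf : D f = 0) : ∃ P, evalXST n e m d r Q P = f := by
  obtain ⟨ψ, hψ, hP, hy, hz⟩ :=
    exists_laurent_embedding (k := k) (n := n) (e := e) (r := r) (Q := Q) hn hm hd
  obtain ⟨δ, ν, hδ, hin⟩ := exists_initial_derivation hψ hP h0
  by_contra! hfP
  -- Powers of `δ` on an initial form give the initial forms of `D^N f`, possibly zero. Once `D^N f
  -- = 0` they must be zero.
  have hnil : ∀ (f : B n e m d r Q) (γ : ℤ ×ₗ ℤ) (h : Laurent k),
      HasInitialForm (bidegree d r) γ (ψ f) h → h ∈ δ.nilSubalgebra := by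
    intro f γ h H
    obtain ⟨N, hN⟩ := hD f
    rw [Derivation.mem_nilSubalgebra]
    refine ⟨N, HasInitialForm.eq_zero (ω := bidegree d r) (γ := γ + N • ν) ?_⟩
    have := hin f γ h H N
    rwa [hN, map_zero] at this
  have hpoly : ∀ (P : MvPolynomial (Fin 2) k) (ρ : ℕ), P.IsWeightedHomogeneous ![r, d] ρ →
      HasInitialForm (bidegree d r) (toLex (0, (ρ : ℤ)))
        (ψ (evalXST n e m d r Q (rename Fin.succ P))) (polyST k P) := by
    intro P ρ h
    rw [hP, polyXST_rename]
    exact hasInitialForm_polyST h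
  have hxn : lx k 1 ∈ δ.nilSubalgebra := by
    refine hnil (evalXST n e m d r Q (X 0)) (toLex (1, 0)) _ ?_
    rw [hP, polyXST_X_zero]
    exact hasInitialForm_lx 1
  have hpn : ∀ (P : MvPolynomial (Fin 2) k) (ρ : ℕ), P.IsWeightedHomogeneous ![r, d] ρ →
      polyST k P ∈ δ.nilSubalgebra := fun P ρ h => hnil _ _ _ (hpoly P ρ h)
  have hsn : ls k ∈ δ.nilSubalgebra := by
    have := hpn (X 0 ^ 1) _ (isWeightedHomogeneous_X_pow_zero (r := r) (d := d) 1)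
    simpa [polyST] using this
  have htn : lt k ∈ δ.nilSubalgebra := by
    have := hpn (X 1 ^ 1) _ (isWeightedHomogeneous_X_pow_one (r := r) (d := d) 1)
    simpa [polyST] using this
  have hyn : ly₀ k n d r ∈ δ.nilSubalgebra :=
    hnil (y n e m d r Q) (toLex (-(n : ℤ), ((d * r : ℕ) : ℤ))) _ (by rw [hy]; exact hasInitialForm_ly)
  have hzn : lz₀ k n e m d r ∈ δ.nilSubalgebra :=
    hnil (z n e m d r Q) (toLex (-((n * m + e : ℕ) : ℤ), ((m * (d * r) : ℕ) : ℤ))) _ (by rw [hz]; exact hasInitialForm_lz hn (by omega))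
  have hy0 : ly₀ k n d r ≠ 0 := ly₀_ne_zero (by omega)
  have hz0 : lz₀ k n e m d r ≠ 0 := lz₀_ne_zero (by omega)
  have hpow : ∀ {a : Laurent k} {j : ℕ}, a ∈ δ.nilSubalgebra → a ≠ 0 → j ≠ 0 → δ (a ^ j) = 0 →
      δ a = 0 := by
    intro a j ha ha0 hj h
    obtain ⟨j, rfl⟩ := Nat.exists_eq_succ_of_ne_zero hj
    rw [pow_succ'] at h
    exact Derivation.apply_eq_zero_of_mul ha (pow_mem ha j) (mul_ne_zero ha0 (pow_ne_zero j ha0)) h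
  have hmul : ∀ {a b : Laurent k}, a ∈ δ.nilSubalgebra → b ∈ δ.nilSubalgebra → a ≠ 0 → b ≠ 0 →
      δ (a * b) = 0 → δ a = 0 ∧ δ b = 0 := by
    intro a b ha hb ha0 hb0 h
    exact ⟨Derivation.apply_eq_zero_of_mul ha hb (mul_ne_zero ha0 hb0) h,
      Derivation.apply_eq_zero_of_mul hb ha (mul_ne_zero hb0 ha0) (by rwa [mul_comm])⟩
  have hpowz : ∀ {a : Laurent k} (j : ℕ), δ a = 0 → δ (a ^ j) = 0 := by
    intro a j h
    rw [Derivation.leibniz_pow, h]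
    simp
  have hlwn : ∀ c, lw₀ k n e m d r c ∈ δ.nilSubalgebra := fun c =>
    mul_mem (pow_mem hyn _) (pow_mem hzn _)
  have hlw0 : ∀ c, lw₀ k n e m d r c ≠ 0 := fun c =>
    mul_ne_zero (pow_ne_zero _ hy0) (pow_ne_zero _ hz0)
  have hlw : ∀ c, δ (lw₀ k n e m d r c) = 0 →
      (c % m ≠ 0 → δ (ly₀ k n d r) = 0) ∧ (c / m ≠ 0 → δ (lz₀ k n e m d r) = 0) := by
    intro c h
    obtain ⟨h1, h2⟩ := hmul (pow_mem hyn _) (pow_mem hzn _) (pow_ne_zero _ hy0)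
      (pow_ne_zero _ hz0) h
    exact ⟨fun hc => hpow hyn hy0 hc h1, fun hc => hpow hzn hz0 hc h2⟩
  have hyz : δ (ly₀ k n d r) = 0 → δ (lx k 1 ^ e) = 0 ∧ δ (lz₀ k n e m d r) = 0 := by
    intro h
    have h1 := hpowz m h
    rw [ly₀_pow (e := e)] at h1
    exact hmul (pow_mem hxn e) hzn (pow_ne_zero e (lx_ne_zero 1)) hz0 h1
  -- Factorial closedness distributes `δ h = 0` over the factors of the initial form.
  have shape : ∀ (g : B n e m d r Q) (γ : ℤ ×ₗ ℤ) (h : Laurent k), h ≠ 0 → δ h = 0 →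
      HasInitialForm (bidegree d r) γ (ψ g) h →
      ∃ (i c ρ : ℕ) (p : MvPolynomial (Fin 2) k), p ≠ 0 ∧ p.IsWeightedHomogeneous ![r, d] ρ ∧
        γ = toLex ((i : ℤ) - theta n e m c, ((ρ + c * (d * r) : ℕ) : ℤ)) ∧
        h = lx k 1 ^ i * polyST k p * lw₀ k n e m d r c ∧
        (c = 0 → ∃ P, polyXST k P = ψ g) ∧ δ (lx k 1 ^ i) = 0 ∧ δ (polyST k p) = 0 ∧
        δ (lw₀ k n e m d r c) = 0 := by
    intro g γ h hh0 hδh H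
    obtain ⟨c₀, hc₀⟩ := exists_mem_lwSpan hm hP hy hz g
    obtain ⟨i, c, ρ, p, hp0, hp, H', hc⟩ :=
      exists_hasInitialForm_of_mem_lwSpan hn (by omega) hc₀ (H.ne_zero hh0)
    have hp0' : polyST k p ≠ 0 := (map_ne_zero_iff _ polyST_injective).2 hp0
    rw [← lx_one_pow] at H'
    obtain ⟨h1, rfl⟩ := H.unique H' hh0
      (mul_ne_zero (mul_ne_zero (pow_ne_zero _ (lx_ne_zero 1)) hp0') (hlw0 c))
    have hxi := pow_mem hxn i
    obtain ⟨h2, h3⟩ := hmul (mul_mem hxi (hpn p ρ hp)) (hlwn c)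
      (mul_ne_zero (pow_ne_zero _ (lx_ne_zero 1)) hp0') (hlw0 c) hδh
    obtain ⟨h4, h5⟩ := hmul hxi (hpn p ρ hp) (pow_ne_zero _ (lx_ne_zero 1)) hp0' h2
    exact ⟨i, c, ρ, p, hp0, hp, h1, rfl, hc, h4, h5, h3⟩
  -- the initial form of `z` lies in the kernel of `δ`
  have hδz : δ (lz₀ k n e m d r) = 0 := by
    have hf0 : f ≠ 0 := by
      rintro rfl
      exact hfP 0 (by rw [evalXST, map_zero])
    obtain ⟨c₀, hc₀⟩ := exists_mem_lwSpan hm hP hy hz f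
    obtain ⟨i, c', ρ', p', hp0', hp', H, -⟩ := exists_hasInitialForm_of_mem_lwSpan hn (by omega)
      hc₀ ((map_ne_zero_iff _ hψ).2 hf0)
    have h1 := hin f _ _ H 1
    rw [Function.iterate_one, Function.iterate_one, hf, map_zero] at h1
    have hne0 : lx k i * polyST k p' * lw₀ k n e m d r c' ≠ 0 :=
      mul_ne_zero (mul_ne_zero (lx_ne_zero _) ((map_ne_zero_iff _ polyST_injective).2 hp0'))
        (hlw0 c')
    obtain ⟨i, c, ρ, p, -, -, -, -, hc, -, -, h2⟩ := shape f _ _ hne0 h1.eq_zero H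
    -- With `c = 0` the element `f` would be a polynomial in `x, s, t`. Hence `y₀` or `z₀` occurs in
    -- the initial form, and `δ y₀ = 0` implies `δ z₀ = 0`.
    have hc0 : c ≠ 0 := by
      intro h
      obtain ⟨P, hPf⟩ := hc h
      exact hfP P (hψ (by rw [hP, hPf]))
    obtain ⟨h3, h4⟩ := hlw c h2
    by_cases h5 : c / m = 0
    · refine (hyz (h3 ?_)).2
      intro h6
      have := Nat.mod_add_div c m
      rw [h5, h6] at this
      exact hc0 (by omega)
    · exact h4 h5
  -- As `δ` is nonzero on some variable, it kills neither `x` nor any nonzero quasi-homogeneous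
  -- polynomial of positive weight in `s, t`.
  have hno := fun h => hδ (apply_eq_zero_of_apply_lz₀_eq_zero hn hne hm hd hr hdr hxn hsn htn hzn
    hδz h)
  have hδx : δ (lx k 1) ≠ 0 := fun h => hno (Or.inl h)
  -- the homogeneous elements of the kernel of `δ`
  have hker : ∀ (g : B n e m d r Q) (γ : ℤ ×ₗ ℤ) (h : Laurent k), h ≠ 0 → δ h = 0 →
      HasInitialForm (bidegree d r) γ (ψ g) h →
      ∃ (c : ℕ) (κ : k), κ ≠ 0 ∧ h = κ • lw₀ k n e m d r c ∧
        γ = toLex (-(theta n e m c : ℤ), ((c * (d * r) : ℕ) : ℤ)) ∧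
        m * theta n e m c = (n * m + e) * c := by
    intro g γ h hh0 hδh H
    obtain ⟨i, c, ρ, p, hp0, hp, rfl, rfl, -, h1, h2, h3⟩ := shape g γ h hh0 hδh H
    obtain rfl : i = 0 := by
      by_contra hi
      exact hδx (hpow hxn (lx_ne_zero 1) hi h1)
    obtain rfl : ρ = 0 := by
      by_contra hρ
      exact hno (Or.inr ⟨ρ, p, hρ, hp0, hp, h2⟩)
    obtain ⟨κ, rfl⟩ : ∃ κ, p = C κ := by
      refine ⟨p.coeff 0, ?_⟩
      ext μ
      rw [coeff_C]
      split_ifs with hμ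
      · rw [hμ]
      · by_contra hne'
        have h4 := hp hne'
        rw [weight_eq] at h4
        apply hμ
        ext j
        have h5 : μ 0 * r = 0 ∧ μ 1 * d = 0 := by omega
        fin_cases j
        · exact ((Nat.mul_eq_zero.1 h5.1).resolve_right (by omega)).symm
        · exact ((Nat.mul_eq_zero.1 h5.2).resolve_right (by omega)).symm
    refine ⟨c, κ, fun h => hp0 (by rw [h, C_0]), ?_, ?_, ?_⟩
    · rw [pow_zero, one_mul, ← MvPolynomial.algebraMap_eq, AlgHom.commutes, ← Algebra.smul_def]
    · simp
    -- Otherwise `y₀` occurs and is killed, hence so is `xᵉ` with `e ≠ 0`, and therefore `x`.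
    · have hdvd : e = 0 ∨ m ∣ c := by
        by_contra! hcon
        obtain ⟨h5, h6⟩ := hcon
        refine hδx (hpow hxn (lx_ne_zero 1) h5 (hyz ((hlw c h3).1 ?_)).1)
        exact fun h => h6 (Nat.dvd_of_mod_eq_zero h)
      rw [theta]
      rcases hdvd with rfl | h6
      · ring
      · rw [mul_add, mul_left_comm m e, Nat.mul_div_cancel' h6]
        ring
  -- the last nonzero derivatives of the combinations of `s ^ d` and `t ^ r`
  have last : ∀ a b : k, ¬ (a = 0 ∧ b = 0) → ∃ (j c : ℕ) (κ : k), κ ≠ 0 ∧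
      (⇑δ)^[j] (polyST k (C a * X 0 ^ d + C b * X 1 ^ r)) = κ • lw₀ k n e m d r c ∧
      (toLex (0, ((d * r : ℕ) : ℤ)) : ℤ ×ₗ ℤ) + j • ν =
        toLex (-(theta n e m c : ℤ), ((c * (d * r) : ℕ) : ℤ)) ∧
      m * theta n e m c = (n * m + e) * c := by
    intro a b hab
    set u := polyST k (C a * X 0 ^ d + C b * X 1 ^ r) with hu
    have hu0 : u ≠ 0 := by
      refine (map_ne_zero_iff _ polyST_injective).2 fun h => hab ?_
      have h1 := congrArg (aeval (R := k) ![(1 : k), 0]) h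
      have h2 := congrArg (aeval (R := k) ![(0 : k), 1]) h
      simp [show r ≠ 0 by omega, show d ≠ 0 by omega] at h1 h2
      exact ⟨h1, h2⟩
    have hw := isWeightedHomogeneous_lv (d := d) (r := r) a b
    classical
    have hex := Derivation.mem_nilSubalgebra _ |>.1 (hpn _ _ hw)
    obtain ⟨j, hj⟩ : ∃ j, Nat.find hex = j + 1 := by
      refine Nat.exists_eq_succ_of_ne_zero fun h => hu0 ?_
      have := Nat.find_spec hex
      rw [h] at this
      exact this
    have h1 : (⇑δ)^[j] u ≠ 0 := Nat.find_min hex (by omega)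
    have h2 : δ ((⇑δ)^[j] u) = 0 := by
      rw [← Function.iterate_succ_apply' δ, Nat.succ_eq_add_one, ← hj]
      exact Nat.find_spec hex
    obtain ⟨c, κ, hκ, h3, h4, h5⟩ := hker _ _ _ h1 h2 (hin _ _ _ (hpoly _ _ hw) j)
    exact ⟨j, c, κ, hκ, h3, h4, h5⟩
  obtain ⟨ν₁, ν₂⟩ := ν
  -- The functional `(a, b) ↦ (nm+e)b + m(dr)a` vanishes on the degrees found in `hker` and equals
  -- `(nm+e)dr ≠ 0` on the degree `(0, dr)`. It therefore determines `j`, and then `c`.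
  have num : ∀ {j c : ℕ}, (toLex (0, ((d * r : ℕ) : ℤ)) : ℤ ×ₗ ℤ) + j • toLex (ν₁, ν₂) =
        toLex (-(theta n e m c : ℤ), ((c * (d * r) : ℕ) : ℤ)) →
      m * theta n e m c = (n * m + e) * c →
      (j : ℤ) * ((n * m + e) * ν₂ + m * (d * r) * ν₁) = -((n * m + e) * (d * r)) ∧
        (c : ℤ) * (d * r) = d * r + j * ν₂ := by
    intro j c h1 h2
    rw [nsmul_toLex, toLex_add_toLex, toLex_inj, Prod.mk.injEq] at h1
    obtain ⟨h3, h4⟩ := h1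
    push_cast at h3 h4
    have h5 : (m : ℤ) * theta n e m c = (n * m + e) * c := by exact_mod_cast h2
    refine ⟨?_, by linarith⟩
    linear_combination ((n : ℤ) * m + e) * h4 + m * (d * r) * h3 - d * r * h5
  have hNdr : ((n * m + e) * (d * r) : ℤ) ≠ 0 := by positivity
  have hdr0 : (d * r : ℤ) ≠ 0 := by positivity
  have uniq : ∀ {j c j' c' : ℕ},
      (j : ℤ) * ((n * m + e) * ν₂ + m * (d * r) * ν₁) = -((n * m + e) * (d * r)) →
      (c : ℤ) * (d * r) = d * r + j * ν₂ →
      (j' : ℤ) * ((n * m + e) * ν₂ + m * (d * r) * ν₁) = -((n * m + e) * (d * r)) →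
      (c' : ℤ) * (d * r) = d * r + j' * ν₂ → j = j' ∧ c = c' := by
    intro j c j' c' h1 h2 h3 h4
    have hj : (j : ℤ) = j' := by
      refine mul_right_cancel₀ (b := (n * m + e) * ν₂ + m * (d * r) * ν₁) ?_ (h1.trans h3.symm)
      intro h
      rw [h, mul_zero, eq_comm, neg_eq_zero] at h1
      exact hNdr h1
    refine ⟨by exact_mod_cast hj, ?_⟩
    rw [← hj, ← h2] at h4
    exact_mod_cast (mul_right_cancel₀ hdr0 h4).symm
  obtain ⟨j₁, c₁, κ₁, hκ₁, hd₁, hγ₁, hc₁⟩ := last 1 0 (by simp)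
  obtain ⟨j₂, c₂, κ₂, hκ₂, hd₂, hγ₂, hc₂⟩ := last 0 1 (by simp)
  -- The combination `κ₂sᵈ - κ₁tʳ` is chosen so that the `j`-th derivatives cancel, although its
  -- last nonzero derivative is also the `j`-th one.
  obtain ⟨j₃, c₃, κ₃, hκ₃, hd₃, hγ₃, hc₃⟩ := last κ₂ (-κ₁) (by simp [hκ₂])
  have e₁ := num hγ₁ hc₁
  have e₂ := num hγ₂ hc₂
  have e₃ := num hγ₃ hc₃
  obtain ⟨rfl, rfl⟩ := uniq e₁.1 e₁.2 e₂.1 e₂.2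
  obtain ⟨rfl, rfl⟩ := uniq e₁.1 e₁.2 e₃.1 e₃.2
  have hcomb : polyST k (C κ₂ * X 0 ^ d + C (-κ₁) * X 1 ^ r) =
      κ₂ • polyST k (C 1 * X 0 ^ d + C 0 * X 1 ^ r) +
        (-κ₁) • polyST k (C 0 * X 0 ^ d + C 1 * X 1 ^ r) := by
    rw [← map_smul, ← map_smul, ← map_add]
    congr 1
    simp [smul_eq_C_mul]
  rw [hcomb, Derivation.iterate_map_add, Derivation.iterate_map_smul, Derivation.iterate_map_smul,
    hd₁, hd₂, smul_smul, smul_smul, ← add_smul] at hd₃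
  rw [show κ₂ * κ₁ + -κ₁ * κ₂ = 0 by ring, zero_smul] at hd₃
  exact smul_ne_zero hκ₃ (hlw0 _) hd₃.symm

end KernelInPolynomials

end NewClass

/-! ### The kernel contains `x`. -/

namespace NewClass

open MvPolynomial

section KernelContainsX

variable {k : Type*} [Field k] {n e m d r : ℕ} {Q : MvPolynomial (Fin 3) k}

/-- Division with remainder by `sᵈ + tʳ`, which is monic in `t`. -/
theorem exists_eq_mul_add_of_mod (d : ℕ) {r : ℕ} (hr : 1 ≤ r) (p : MvPolynomial (Fin 2) k) :
    ∃ q g, p = (X 0 ^ d + X 1 ^ r) * q + g ∧ ∀ μ ∈ g.support, μ 1 < r := by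
  classical
  induction p using MvPolynomial.induction_on' with
  | add p p' hp hp' =>
    obtain ⟨q, g, rfl, hg⟩ := hp
    obtain ⟨q', g', rfl, hg'⟩ := hp'
    refine ⟨q + q', g + g', by ring, fun μ hμ => ?_⟩
    rcases Finset.mem_union.1 (support_add hμ) with h | h
    exacts [hg μ h, hg' μ h]
  | monomial u a =>
    have key : ∀ (j i : ℕ), ∃ q g, (C a * X 0 ^ i * X 1 ^ j : MvPolynomial (Fin 2) k) =
        (X 0 ^ d + X 1 ^ r) * q + g ∧ ∀ μ ∈ g.support, μ 1 < r := by
      intro j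
      induction j using Nat.strong_induction_on with
      | _ j ih =>
        intro i
        by_cases hj : j < r
        · refine ⟨0, _, by rw [mul_zero, zero_add], fun μ hμ => ?_⟩
          have h1 : (C a * X 0 ^ i * X 1 ^ j : MvPolynomial (Fin 2) k) =
              monomial (Finsupp.single 0 i + Finsupp.single 1 j) a := by
            rw [X_pow_eq_monomial, X_pow_eq_monomial, C_mul_monomial, monomial_mul, mul_one, mul_one]
          rw [h1] at hμ
          have := Finset.mem_singleton.1 (support_monomial_subset hμ)
          rw [this]
          simpa using hj
        · obtain ⟨l, rfl⟩ := Nat.exists_eq_add_of_le (not_lt.1 hj)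
          obtain ⟨q, g, h, hg⟩ := ih l (by omega) (i + d)
          refine ⟨C a * X 0 ^ i * X 1 ^ l - q, -g, ?_, by simpa using hg⟩
          rw [pow_add] at h ⊢
          linear_combination -h
    have h1 : monomial u a = (C a * X 0 ^ u 0 * X 1 ^ u 1 : MvPolynomial (Fin 2) k) := by
      rw [monomial_eq, Finsupp.prod_fintype _ _ (by simp), Fin.prod_univ_two, mul_assoc]
    rw [h1]
    exact key _ _

open Polynomial in
/-- A polynomial vanishing on the parametrized curve `sᵈ + tʳ = 0` is a multiple of `sᵈ + tʳ`. -/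
theorem dvd_of_aeval_curve_eq_zero {d r : ℕ} (hr : 1 ≤ r) (hdr : Nat.gcd d r = 1)
    {a b : k} (ha : a ≠ 0) (hb : b ≠ 0) (hab : a ^ d + b ^ r = 0) {p : MvPolynomial (Fin 2) k}
    (h : MvPolynomial.aeval ![Polynomial.C a * Polynomial.X ^ r,
      Polynomial.C b * Polynomial.X ^ d] p = 0) :
    (MvPolynomial.X 0 ^ d + MvPolynomial.X 1 ^ r) ∣ p := by
  obtain ⟨q, g, rfl, hg⟩ := exists_eq_mul_add_of_mod d hr p
  have hv : MvPolynomial.aeval ![Polynomial.C a * Polynomial.X ^ r,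
      Polynomial.C b * Polynomial.X ^ d] (MvPolynomial.X 0 ^ d + MvPolynomial.X 1 ^ r :
        MvPolynomial (Fin 2) k) = 0 := by
    simp only [map_add, map_pow, MvPolynomial.aeval_X, Matrix.cons_val]
    rw [mul_pow, mul_pow, ← pow_mul, ← pow_mul, mul_comm r d, ← add_mul, ← Polynomial.C_pow,
      ← Polynomial.C_pow, ← Polynomial.C_add, hab, Polynomial.C_0, zero_mul]
  rw [map_add, map_mul, hv, zero_mul, zero_add] at h
  suffices hg0 : g = 0 by rw [hg0, add_zero]; exact Dvd.intro _ rfl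
  have hsum : MvPolynomial.aeval ![Polynomial.C a * Polynomial.X ^ r,
      Polynomial.C b * Polynomial.X ^ d] g = ∑ μ ∈ g.support,
        Polynomial.monomial (r * μ 0 + d * μ 1) (g.coeff μ * (a ^ μ 0 * b ^ μ 1)) := by
    rw [MvPolynomial.aeval_def, MvPolynomial.eval₂_eq']
    refine Finset.sum_congr rfl fun μ _ => ?_
    rw [Fin.prod_univ_two, ← Polynomial.C_mul_X_pow_eq_monomial]
    simp only [Matrix.cons_val, Polynomial.C_mul, Polynomial.C_pow, Polynomial.algebraMap_eq]
    rw [pow_add, pow_mul, pow_mul, mul_pow, mul_pow]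
    ring
  -- On the curve, `sⁱtʲ` has degree `ri + dj` in the parameter. For `j < r` these degrees are
  -- distinct because `gcd(d, r) = 1`, so no terms of the remainder `g` cancel.
  ext μ
  by_contra hμ
  have hμs : μ ∈ g.support := MvPolynomial.mem_support_iff.2 hμ
  have h1 := congrArg (fun P => P.coeff (r * μ 0 + d * μ 1)) (hsum.symm.trans h)
  simp only [Polynomial.finsetSum_coeff, Polynomial.coeff_zero] at h1
  rw [Finset.sum_eq_single μ] at h1
  · rw [Polynomial.coeff_monomial, if_pos rfl] at h1
    exact mul_ne_zero hμ (mul_ne_zero (pow_ne_zero _ ha) (pow_ne_zero _ hb)) h1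
  · intro μ' hμ' hne
    rw [Polynomial.coeff_monomial, if_neg]
    intro heq
    apply hne
    have h2 : μ' 1 ≡ μ 1 [MOD r] := by
      refine Nat.ModEq.cancel_left_of_coprime (c := d) (by rwa [Nat.gcd_comm]) ?_
      have h3 := congrArg (· % r) heq
      simpa [Nat.ModEq, Nat.add_mod, Nat.mul_mod] using h3
    have h3 : μ' 1 = μ 1 := by
      have := h2
      rwa [Nat.ModEq, Nat.mod_eq_of_lt (hg _ hμ'), Nat.mod_eq_of_lt (hg _ hμs)] at this
    have h4 : μ' 0 = μ 0 := by
      rw [h3, Nat.add_right_cancel_iff] at heq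
      exact Nat.eq_of_mul_eq_mul_left hr heq
    ext i
    fin_cases i
    exacts [h4, h3]
  · exact fun h => absurd hμs h

theorem isDomain_B (hn : 1 ≤ n) (hm : 2 ≤ m) (hd : 2 ≤ d) : IsDomain (B n e m d r Q) := by
  obtain ⟨ψ, hψ, -⟩ :=
    exists_laurent_embedding (k := k) (n := n) (e := e) (r := r) (Q := Q) hn hm hd
  exact hψ.isDomain ψ.toRingHom

theorem evalXST_injective (hn : 1 ≤ n) (hm : 2 ≤ m) (hd : 2 ≤ d) :
    Function.Injective (evalXST n e m d r Q) := by
  obtain ⟨ψ, hψ, hP, -⟩ :=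
    exists_laurent_embedding (k := k) (n := n) (e := e) (r := r) (Q := Q) hn hm hd
  intro p q h
  apply polyXST_injective
  rw [← hP, ← hP, h]

variable [CharZero k]

/-- The element `x` lies in the kernel of every nonzero locally nilpotent derivation of `B`. -/
theorem apply_x_eq_zero (hn : 1 ≤ n) (hne : (n, e) ≠ (1, 0)) (hm : 2 ≤ m)
    (hd : 2 ≤ d) (hr : 2 ≤ r) (hdr : Nat.gcd d r = 1)
    {D : Derivation k (B n e m d r Q) (B n e m d r Q)} (hD : D.IsLocallyNilpotent) (h0 : D ≠ 0) :
    D (x n e m d r Q) = 0 := by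
  have := isDomain_B (k := k) (e := e) (r := r) (Q := Q) hn hm hd
  have hinj := evalXST_injective (k := k) (e := e) (r := r) (Q := Q) hn hm hd
  let ev : MvPolynomial (Fin 3) k →ₐ[k] B n e m d r Q :=
    aeval ![x n e m d r Q, s n e m d r Q, t n e m d r Q]
  have hev : ∀ p, ev p = evalXST n e m d r Q p := fun _ => rfl
  -- Coprimality makes `d` or `r` odd, so a sign suffices to find a point of the curve over `k`.
  obtain ⟨a, b, ha, hb, hab⟩ : ∃ a b : k, a ≠ 0 ∧ b ≠ 0 ∧ a ^ d + b ^ r = 0 := by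
    rcases Nat.even_or_odd r with h | h
    · have hdo : Odd d := by
        rw [← Nat.not_even_iff_odd]
        intro hde
        have := Nat.dvd_gcd hde.two_dvd h.two_dvd
        rw [hdr] at this
        omega
      exact ⟨-1, 1, by simp, by simp, by rw [hdo.neg_one_pow]; simp⟩
    · exact ⟨1, -1, by simp, by simp, by rw [h.neg_one_pow]; simp⟩
  let R' := D.kerSubalgebra.comap ev
  let curve : MvPolynomial (Fin 3) k →ₐ[k] Polynomial k :=
    aeval ![0, Polynomial.C a * Polynomial.X ^ r, Polynomial.C b * Polynomial.X ^ d]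
  -- The restriction to the curve lands in `k[X]`, of transcendence degree one. Injectivity would
  -- give `3 ≤ trdeg B = trdeg (ker D) + 1 ≤ 2`.
  have hnot : ¬ Function.Injective (curve.comp R'.val) := by
    intro hc
    let ε : R' →ₐ[k] D.kerSubalgebra := (ev.comp R'.val).codRestrict _ fun p => p.2
    have hε : Function.Bijective ε := by
      constructor
      · intro p q h
        exact Subtype.ext (hinj (congrArg Subtype.val h))
      · rintro ⟨f, hf⟩
        obtain ⟨P, hP⟩ := exists_evalXST_eq_of_apply_eq_zero hn hne hm hd hr hdr hD h0 hf
        refine ⟨⟨P, ?_⟩, Subtype.ext hP⟩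
        change ev P ∈ D.kerSubalgebra
        rw [hev, hP]
        exact hf
    have h1 := (AlgEquiv.ofBijective ε hε).trdeg_eq
    have h2 := hD.trdeg_eq h0
    have h3 : Algebra.trdeg k R' ≤ Algebra.trdeg k (Polynomial k) :=
      trdeg_le_of_injective _ hc
    rw [Polynomial.trdeg_of_isDomain, h1] at h3
    have h4 : Algebra.trdeg k (MvPolynomial (Fin 3) k) ≤ Algebra.trdeg k (B n e m d r Q) :=
      trdeg_le_of_injective ev hinj
    rw [MvPolynomial.trdeg_of_isDomain, ← h2] at h4
    have h5 := h4.trans (add_le_add_left h3 1)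
    simp at h5
    norm_num at h5
  rw [injective_iff_map_eq_zero] at hnot
  push Not at hnot
  obtain ⟨⟨P, hP⟩, hcP, hP0⟩ := hnot
  have hcP' : curve P = 0 := hcP
  have hPne : P ≠ 0 := fun h => hP0 (Subtype.ext h)
  obtain ⟨p₀, p₁, rfl⟩ := exists_eq_rename_add P
  have h1 : curve (X 0) = 0 := by simp [curve]
  rw [map_add, map_mul, h1, zero_mul, add_zero, aeval_rename] at hcP'
  obtain ⟨q, rfl⟩ := dvd_of_aeval_curve_eq_zero (by omega) hdr ha hb hab (p := p₀) (by
    convert hcP' using 2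
    congr 1)
  -- In `B` the polynomial `sᵈ + tʳ = x(x^(n-1)y - Q)` is a multiple of `x`.
  obtain ⟨g, hg⟩ : ∃ g, ev (rename Fin.succ ((X 0 ^ d + X 1 ^ r) * q) + X 0 * p₁) =
      x n e m d r Q * g := by
    refine ⟨(x n e m d r Q ^ (n - 1) * y n e m d r Q - evalXST n e m d r Q Q) *
      ev (rename Fin.succ q) + ev p₁, ?_⟩
    have h2 : ev (rename Fin.succ (X 0 ^ d + X 1 ^ r)) = s n e m d r Q ^ d + t n e m d r Q ^ r := by
      simp [ev]
    have h3 : ev (X 0) = x n e m d r Q := by simp [ev]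
    have h4 := pow_mul_y (k := k) (n := n) (e := e) (m := m) (d := d) (r := r) (Q := Q)
    rw [← Nat.sub_add_cancel hn, pow_succ] at h4
    rw [map_mul (rename Fin.succ), map_add, map_mul, map_mul, h2, h3]
    rw [Nat.sub_add_cancel hn] at h4
    linear_combination (-ev (rename Fin.succ q)) * h4
  have hP' : D (ev _) = 0 := hP
  rw [hg] at hP'
  refine (hD.apply_eq_zero_of_mul ?_ hP').1
  rw [← hg]
  exact fun h => hPne (hinj (h.trans (map_zero ev).symm))

end KernelContainsX

end NewClass

/-! ### Kernels of locally nilpotent derivations of `L[s, t]` over an algebraically closed field. -/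

open MvPolynomial in
/-- Evaluations at congruent points are congruent. -/
theorem MvPolynomial.dvd_aeval_sub_aeval {R A σ : Type*} [CommRing R] [CommRing A] [Algebra R A]
    {g : A} {a b : σ → A} (h : ∀ i, g ∣ a i - b i) (P : MvPolynomial σ R) :
    g ∣ aeval a P - aeval b P := by
  rw [← Ideal.mem_span_singleton, ← Ideal.Quotient.eq]
  have h1 := comp_aeval_apply a (Ideal.Quotient.mkₐ R (Ideal.span {g})) P
  have h2 := comp_aeval_apply b (Ideal.Quotient.mkₐ R (Ideal.span {g})) P
  simp only [Ideal.Quotient.mkₐ_eq_mk] at h1 h2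
  rw [h1, h2]
  congr 2
  funext i
  rw [Ideal.Quotient.eq, Ideal.mem_span_singleton]
  exact h i

/-- Over an algebraically closed field, a prime dividing `q(h)` divides some `h - c`. -/
theorem Prime.exists_dvd_sub_of_dvd_aeval {L A : Type*} [Field L] [IsAlgClosed L] [CommRing A]
    [Algebra L A] {g h : A} (hg : Prime g) {q : Polynomial L} (hq : q ≠ 0)
    (hgq : g ∣ Polynomial.aeval h q) : ∃ c : L, g ∣ h - algebraMap L A c := by
  induction hN : q.natDegree generalizing q with
  | zero =>
    rw [Polynomial.eq_C_of_natDegree_eq_zero hN, Polynomial.aeval_C] at hgq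
    have h0 : q.coeff 0 ≠ 0 := by
      intro h0
      rw [Polynomial.eq_C_of_natDegree_eq_zero hN, h0, map_zero] at hq
      exact hq rfl
    exact absurd (isUnit_of_dvd_unit hgq ((IsUnit.mk0 _ h0).map (algebraMap L A))) hg.not_isUnit
  | succ N ih =>
    have hd : q.degree ≠ 0 := by
      intro h
      rw [Polynomial.natDegree_eq_zero_iff_degree_le_zero.2 h.le] at hN
      omega
    obtain ⟨c, hc⟩ := IsAlgClosed.exists_root q hd
    obtain ⟨p, rfl⟩ := Polynomial.dvd_iff_isRoot.2 hc
    have hp : p ≠ 0 := right_ne_zero_of_mul hq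
    rw [Polynomial.natDegree_mul (Polynomial.X_sub_C_ne_zero c) hp,
      Polynomial.natDegree_X_sub_C] at hN
    rw [map_mul] at hgq
    rcases hg.dvd_or_dvd hgq with h1 | h1
    · exact ⟨c, by simpa using h1⟩
    · exact ih hp h1 (by omega)

namespace Derivation

open MvPolynomial

section Field

variable {L : Type*} [Field L] [CharZero L]
  {D : Derivation L (MvPolynomial (Fin 2) L) (MvPolynomial (Fin 2) L)}

theorem IsLocallyNilpotent.trdeg_kerSubalgebra (hD : D.IsLocallyNilpotent) (h0 : D ≠ 0) :
    Algebra.trdeg L D.kerSubalgebra = 1 := by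
  have h := hD.trdeg_eq h0
  rw [MvPolynomial.trdeg_of_isDomain, Cardinal.mk_fin, Cardinal.lift_natCast] at h
  have h2 : Algebra.trdeg L D.kerSubalgebra + 1 = 1 + 1 := by
    rw [h]; norm_num
  exact Cardinal.add_one_inj.1 h2

/-- The kernel has transcendence degree one. -/
theorem IsLocallyNilpotent.exists_aeval_eq_zero (hD : D.IsLocallyNilpotent) (h0 : D ≠ 0)
    {g h : MvPolynomial (Fin 2) L} (hg : D g = 0) (hh : D h = 0) :
    ∃ P : MvPolynomial (Fin 2) L, P ≠ 0 ∧ aeval ![g, h] P = 0 := by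
  by_contra! hcon
  have hind : AlgebraicIndependent L
      (![⟨g, hg⟩, ⟨h, hh⟩] : Fin 2 → D.kerSubalgebra) := by
    refine (injective_iff_map_eq_zero _).2 fun P hP => ?_
    by_contra hP0
    apply hcon P hP0
    have := congrArg D.kerSubalgebra.val hP
    rw [comp_aeval_apply, map_zero] at this
    rw [← this]
    congr 2
    funext i
    fin_cases i <;> rfl
  have := hind.lift_cardinalMk_le_trdeg
  rw [hD.trdeg_kerSubalgebra h0] at this
  simp at this

theorem IsLocallyNilpotent.exists_totalDegree_ne_zero (hD : D.IsLocallyNilpotent) (h0 : D ≠ 0) :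
    ∃ g, D g = 0 ∧ g.totalDegree ≠ 0 := by
  by_contra! hcon
  have : Algebra.IsAlgebraic L D.kerSubalgebra := by
    constructor
    rintro ⟨g, hg⟩
    have h1 := hcon g hg
    rw [totalDegree_eq_zero_iff_eq_C] at h1
    have : (⟨g, hg⟩ : D.kerSubalgebra) = algebraMap L _ (g.coeff 0) := Subtype.ext h1
    rw [this]
    exact isAlgebraic_algebraMap _
  have h1 := trdeg_eq_zero (R := L) (A := D.kerSubalgebra)
  rw [hD.trdeg_kerSubalgebra h0] at h1
  exact one_ne_zero h1

/-- A kernel element of least positive degree is prime. -/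
theorem IsLocallyNilpotent.prime_of_minimal (hD : D.IsLocallyNilpotent)
    {g : MvPolynomial (Fin 2) L} (hg : D g = 0) (hg0 : g.totalDegree ≠ 0)
    (hmin : ∀ h, D h = 0 → h.totalDegree ≠ 0 → g.totalDegree ≤ h.totalDegree) : Prime g := by
  have hgne : g ≠ 0 := by rintro rfl; simp at hg0
  apply Irreducible.prime
  have key : ∀ a : MvPolynomial (Fin 2) L, a ≠ 0 → a.totalDegree = 0 → IsUnit a := by
    intro a ha h
    rw [totalDegree_eq_zero_iff_eq_C] at h
    rw [isUnit_iff_eq_C_of_isReduced]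
    exact ⟨_, IsUnit.mk0 _ (fun h1 => ha (by rw [h, h1, C_0])), h⟩
  constructor
  · intro h
    exact hg0 (isUnit_iff_totalDegree_of_isReduced.1 h).2
  · rintro a b rfl
    -- Both factors lie in the kernel, so if neither is constant, the degree of one of them
    -- contradicts minimality.
    obtain ⟨ha, hb⟩ := hD.apply_eq_zero_of_mul hgne hg
    have ha0 := left_ne_zero_of_mul hgne
    have hb0 := right_ne_zero_of_mul hgne
    have hdeg := totalDegree_mul_of_isDomain ha0 hb0
    by_cases h1 : a.totalDegree = 0
    · exact Or.inl (key a ha0 h1)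
    by_cases h2 : b.totalDegree = 0
    · exact Or.inr (key b hb0 h2)
    have := hmin a ha h1
    omega

theorem totalDegree_sub_C_ne_zero {g : MvPolynomial (Fin 2) L} (hg0 : g.totalDegree ≠ 0) (c : L) :
    (g - C c).totalDegree ≠ 0 := by
  intro h
  apply hg0
  rw [totalDegree_eq_zero_iff_eq_C] at h ⊢
  have h2 : g = C ((g - C c).coeff 0 + c) := by
    rw [C_add, ← h]; ring
  conv_lhs => rw [h2]
  rw [h2]
  simp

theorem IsLocallyNilpotent.prime_sub_C_of_minimal (hD : D.IsLocallyNilpotent)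
    {g : MvPolynomial (Fin 2) L} (hg : D g = 0) (hg0 : g.totalDegree ≠ 0)
    (hmin : ∀ h, D h = 0 → h.totalDegree ≠ 0 → g.totalDegree ≤ h.totalDegree) (c : L) :
    Prime (g - C c) := by
  refine hD.prime_of_minimal ?_ (totalDegree_sub_C_ne_zero hg0 c) fun h hh hh0 => ?_
  · rw [map_sub, hg, ← algebraMap_eq, Derivation.map_algebraMap, sub_zero]
  · refine le_trans ?_ (hmin h hh hh0)
    exact (totalDegree_sub _ _).trans (by simp)

end Field

section AlgClosed

variable {L : Type*} [Field L] [CharZero L] [IsAlgClosed L]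
  {D : Derivation L (MvPolynomial (Fin 2) L) (MvPolynomial (Fin 2) L)}

/-- Cancel powers of the first variable from `P` and reduce modulo `g`. This leaves a nonzero
univariate polynomial whose value at `h` is divisible by `g`, and it splits into linear factors. -/
theorem exists_dvd_sub_C_of_aeval_eq_zero {g h : MvPolynomial (Fin 2) L} (hg : Prime g)
    {P : MvPolynomial (Fin 2) L} (hP : P ≠ 0) (hPgh : aeval ![g, h] P = 0) :
    ∃ c : L, g ∣ h - C c := by
  have hX : Prime (X 0 : MvPolynomial (Fin 2) L) := X_prime
  obtain ⟨P', hPP, hP'⟩ := (FiniteMultiplicity.of_not_isUnit hX.not_isUnit hP).exists_eq_pow_mul_and_not_dvd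
  rw [hPP, map_mul, map_pow, aeval_X] at hPgh
  have h1 : aeval ![g, h] P' = 0 :=
    (mul_eq_zero.1 hPgh).resolve_left (pow_ne_zero _ hg.ne_zero)
  set q : Polynomial L := aeval ![0, Polynomial.X] P' with hq
  have hq0 : q ≠ 0 := by
    intro h0
    apply hP'
    have h2 : (X 0 : MvPolynomial (Fin 2) L) ∣ aeval ![X 0, X 1] P' -
        aeval ![0, X 1] P' := by
      refine dvd_aeval_sub_aeval (fun i => ?_) P'
      fin_cases i <;> simp
    have h3 : aeval ![(X 0 : MvPolynomial (Fin 2) L), X 1] P' = P' := by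
      have : ![(X 0 : MvPolynomial (Fin 2) L), X 1] = X := by
        funext i; fin_cases i <;> rfl
      rw [this, aeval_X_left_apply]
    have h4 : aeval ![(0 : MvPolynomial (Fin 2) L), X 1] P' = 0 := by
      have := congrArg (Polynomial.aeval (X 1 : MvPolynomial (Fin 2) L)) h0
      rw [hq, comp_aeval_apply, map_zero] at this
      have h5 : (fun i => Polynomial.aeval (X 1 : MvPolynomial (Fin 2) L)
          ((![0, Polynomial.X] : Fin 2 → Polynomial L) i)) = ![0, X 1] := by
        funext i; fin_cases i <;> simp
      rwa [h5] at this
    rwa [h3, h4, sub_zero] at h2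
  have h5 : g ∣ aeval ![g, h] P' - aeval ![0, h] P' := by
    refine dvd_aeval_sub_aeval (fun i => ?_) P'
    fin_cases i <;> simp
  have h6 : Polynomial.aeval h q = aeval ![0, h] P' := by
    rw [hq, comp_aeval_apply]
    congr 2
    funext i
    fin_cases i <;> simp
  rw [h1, zero_sub, dvd_neg, ← h6] at h5
  exact hg.exists_dvd_sub_of_dvd_aeval hq0 h5

/-- The kernel is generated by any element of least positive degree. -/
theorem IsLocallyNilpotent.kerSubalgebra_eq_of_minimal (hD : D.IsLocallyNilpotent) (h0 : D ≠ 0)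
    {g : MvPolynomial (Fin 2) L} (hg : D g = 0) (hg0 : g.totalDegree ≠ 0)
    (hmin : ∀ h, D h = 0 → h.totalDegree ≠ 0 → g.totalDegree ≤ h.totalDegree) :
    D.kerSubalgebra = Algebra.adjoin L {g} := by
  have hp := hD.prime_of_minimal hg hg0 hmin
  apply le_antisymm
  · intro h hh
    change D h = 0 at hh
    induction hN : h.totalDegree using Nat.strong_induction_on generalizing h with
    | _ N ih =>
    subst hN
    by_cases hh0 : h.totalDegree = 0
    · rw [totalDegree_eq_zero_iff_eq_C] at hh0
      rw [hh0, ← algebraMap_eq]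
      exact Subalgebra.algebraMap_mem _ _
    obtain ⟨P, hP, hPgh⟩ := hD.exists_aeval_eq_zero h0 hg hh
    -- Writing `h = g h' + c` puts `h'` in the kernel with smaller degree.
    obtain ⟨c, h', hh'⟩ := exists_dvd_sub_C_of_aeval_eq_zero hp hP hPgh
    have hne : h - C c ≠ 0 := by
      intro h1
      apply totalDegree_sub_C_ne_zero hh0 c
      rw [h1, totalDegree_zero]
    have hDc : D (h - C c) = 0 := by
      rw [map_sub, hh, ← algebraMap_eq, Derivation.map_algebraMap, sub_zero]
    rw [hh'] at hne hDc
    have h2 := (hD.apply_eq_zero_of_mul hne hDc).2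
    have hdeg := totalDegree_mul_of_isDomain (left_ne_zero_of_mul hne) (right_ne_zero_of_mul hne)
    have hle : (h - C c).totalDegree ≤ h.totalDegree :=
      (totalDegree_sub _ _).trans (by simp)
    rw [hh'] at hle
    have h3 := ih h'.totalDegree (by omega) h2 rfl
    have : h = g * h' + C c := by rw [← hh']; ring
    rw [this]
    exact add_mem (mul_mem (Algebra.subset_adjoin rfl) h3) (Subalgebra.algebraMap_mem _ c)
  · rw [Algebra.adjoin_le_iff]
    rintro _ rfl
    exact hg

end AlgClosed

end Derivation

/-! ### Slices for irreducible derivations of `L[s, t]`. -/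

namespace Derivation

open MvPolynomial

section Quotient

variable {k A : Type*} [Field k] [CharZero k] [CommRing A] [Algebra k A] {D D₁ : Derivation k A A}

theorem iterate_smul_apply {c : A} (hc : D₁ c = 0) (n : ℕ) (a : A) :
    (⇑(c • D₁))^[n] a = c ^ n * (⇑D₁)^[n] a := by
  induction n with
  | zero => simp
  | succ n ih =>
    rw [Function.iterate_succ_apply', Function.iterate_succ_apply', ih, Derivation.smul_apply,
      Derivation.leibniz, Derivation.leibniz_pow, hc]
    simp only [smul_zero, smul_eq_mul, mul_zero]
    ring

/-- Dividing a locally nilpotent derivation by a nonzero factor `c` gives a locally nilpotent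
derivation killing `c`. -/
theorem IsLocallyNilpotent.of_smul [IsDomain A] {c : A} (hD : (c • D₁).IsLocallyNilpotent)
    (h0 : c • D₁ ≠ 0) : D₁ c = 0 ∧ D₁.IsLocallyNilpotent := by
  have hc0 : c ≠ 0 := by rintro rfl; simp at h0
  obtain ⟨r, hr, hr2⟩ := hD.exists_localSlice h0
  rw [Derivation.smul_apply, smul_eq_mul] at hr
  -- For a local slice `r`, the factor `c` divides the nonzero kernel element `c D₁(r)`, so it is in
  -- the kernel too.
  have hr2' : (c • D₁) (c * D₁ r) = 0 := hr2
  have hc : D₁ c = 0 := by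
    have := (hD.apply_eq_zero_of_mul hr hr2').1
    rw [Derivation.smul_apply, smul_eq_mul] at this
    exact (mul_eq_zero.1 this).resolve_left hc0
  refine ⟨hc, fun a => ?_⟩
  obtain ⟨N, hN⟩ := hD a
  rw [iterate_smul_apply hc] at hN
  exact ⟨N, (mul_eq_zero.1 hN).resolve_left (pow_ne_zero _ hc0)⟩

theorem kerSubalgebra_eq_of_eq_smul [IsDomain A] {c : A} (h0 : D ≠ 0) (h : D = c • D₁) :
    D₁.kerSubalgebra = D.kerSubalgebra := by
  have hc0 : c ≠ 0 := by
    rintro rfl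
    rw [zero_smul] at h
    exact h0 h
  ext f
  rw [mem_kerSubalgebra, mem_kerSubalgebra, h, Derivation.smul_apply, smul_eq_mul,
    mul_eq_zero, or_iff_right hc0]

/-- If a multiple of `D₁` is locally nilpotent with kernel `k[g]` and `G` is a slice of `D₁`, then
`A = k[g, G]`. -/
theorem IsLocallyNilpotent.adjoin_pair_eq_top [IsDomain A] (hD : D.IsLocallyNilpotent) (h0 : D ≠ 0)
    {c g G : A} (h : D = c • D₁) (hG : D₁ G = 1) (hker : D.kerSubalgebra = Algebra.adjoin k {g}) :
    Algebra.adjoin k {g, G} = ⊤ := by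
  obtain ⟨-, hD₁⟩ := (h ▸ hD).of_smul (h ▸ h0)
  have htop := hD₁.adjoin_slice hG
  rw [eq_top_iff]
  intro f _
  have hf : f ∈ Algebra.adjoin D₁.kerSubalgebra {G} := htop ▸ Algebra.mem_top
  induction hf using Algebra.adjoin_induction with
  | mem x hx =>
    obtain rfl := hx
    exact Algebra.subset_adjoin (by simp)
  | algebraMap r =>
    obtain ⟨r, hr⟩ := r
    rw [kerSubalgebra_eq_of_eq_smul h0 h, hker] at hr
    exact Algebra.adjoin_mono (by simp) hr
  | add x y _ _ hx hy => exact add_mem (hx trivial) (hy trivial)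
  | mul x y _ _ hx hy => exact mul_mem (hx trivial) (hy trivial)

end Quotient

section AlgClosed

variable {L : Type*} [Field L] [CharZero L] [IsAlgClosed L]
  {D : Derivation L (MvPolynomial (Fin 2) L) (MvPolynomial (Fin 2) L)}

/-- Every domain that is a proper quotient of `L[s, t]` has transcendence degree at most one. -/
theorem trdeg_le_one_of_surjective {L E : Type*} [Field L] [CommRing E] [IsDomain E] [Algebra L E]
    (f : MvPolynomial (Fin 2) L →ₐ[L] E) (hf : Function.Surjective f)
    {p : MvPolynomial (Fin 2) L} (hp : p ≠ 0) (hfp : f p = 0) : ¬ 2 ≤ Algebra.trdeg L E := by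
  intro h
  have htop : Algebra.adjoin L (Set.range fun i => f (X i)) = ⊤ := by
    rw [eq_top_iff]
    intro b _
    obtain ⟨a, rfl⟩ := hf b
    have : f = aeval fun i => f (X i) := by ext i; simp
    rw [Algebra.adjoin_range_eq_range_aeval]
    exact ⟨a, (DFunLike.congr_fun this a).symm⟩
  have : Algebra.IsAlgebraic (Algebra.adjoin L (Set.range fun i => f (X i))) E := by
    constructor
    intro b
    have hb : b ∈ Algebra.adjoin L (Set.range fun i => f (X i)) := htop ▸ Algebra.mem_top
    exact isAlgebraic_algebraMap (⟨b, hb⟩ : Algebra.adjoin L (Set.range fun i => f (X i)))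
  have hind := (Algebra.IsAlgebraic.isTranscendenceBasis_of_lift_le_trdeg_of_finite L
    (fun i => f (X i)) (by simpa using h)).1
  have : f = aeval fun i => f (X i) := by ext i; simp
  rw [this] at hfp
  exact hp (hind (hfp.trans (map_zero _).symm))

/-- The key step of the slice argument: reduction modulo a prime in the kernel. -/
theorem IsLocallyNilpotent.exists_dvd_sub_C (hD : D.IsLocallyNilpotent)
    (hrel : IsRelPrime (D (X 0)) (D (X 1))) {p a : MvPolynomial (Fin 2) L} (hp : Prime p)
    (hDp : D p = 0) (ha : p ∣ D a) : ∃ c : L, p ∣ a - C c := by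
  let f := Ideal.Quotient.mkₐ L (Ideal.span {p})
  have hfs : Function.Surjective f := Ideal.Quotient.mkₐ_surjective L _
  have hf0 : ∀ b, f b = 0 ↔ p ∣ b := fun b => by
    rw [← Ideal.mem_span_singleton]
    exact Ideal.Quotient.eq_zero_iff_mem
  have : (Ideal.span {p}).IsPrime := (Ideal.span_singleton_prime hp.ne_zero).2 hp
  have hd : ∀ b, f b = 0 → f (D b) = 0 := by
    intro b hb
    rw [hf0] at hb ⊢
    obtain ⟨b', rfl⟩ := hb
    rw [Derivation.leibniz, hDp, smul_zero, add_zero]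
    exact dvd_mul_right _ _
  let D' := Derivation.liftOfSurjective hfs hd
  have hD' : ∀ b, D' (f b) = f (D b) := Derivation.liftOfSurjective_apply hfs hd
  have hDn : D'.IsLocallyNilpotent := by
    intro b
    obtain ⟨b, rfl⟩ := hfs b
    obtain ⟨N, hN⟩ := hD b
    refine ⟨N, ?_⟩
    have : ∀ n, (⇑D')^[n] (f b) = f ((⇑D)^[n] b) := by
      intro n
      induction n with
      | zero => rfl
      | succ n ih => rw [Function.iterate_succ_apply', Function.iterate_succ_apply', ih, hD']
    rw [this, hN, map_zero]
  -- Otherwise `p` would divide both `D(s)` and `D(t)`. The quotient by `p` has transcendence degree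
  -- at most one, so the kernel of `D'` is algebraic over `L`, and the class of `a` is a root of a
  -- nonzero polynomial over `L`.
  have hD0 : D' ≠ 0 := by
    intro h
    apply hp.not_isUnit
    apply hrel
    · rw [← hf0, ← hD', h]; rfl
    · rw [← hf0, ← hD', h]; rfl
  have htr := hDn.trdeg_eq hD0
  have h1 := trdeg_le_one_of_surjective f hfs hp.ne_zero ((hf0 p).2 dvd_rfl)
  have h2 : Algebra.trdeg L D'.kerSubalgebra = 0 := by
    by_contra h
    apply h1
    rw [← htr]
    have := Cardinal.one_le_iff_ne_zero.2 h
    calc (2 : Cardinal) = 1 + 1 := by norm_num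
      _ ≤ _ := add_le_add_left this 1
  rw [trdeg_eq_zero_iff] at h2
  have hfa : D' (f a) = 0 := by rw [hD', hf0]; exact ha
  obtain ⟨q, hq, hqa⟩ := h2.isAlgebraic ⟨f a, hfa⟩
  have h3 := congrArg D'.kerSubalgebra.val hqa
  rw [← Polynomial.aeval_algHom_apply, map_zero] at h3
  change Polynomial.aeval (f a) q = 0 at h3
  rw [Polynomial.aeval_algHom_apply, hf0] at h3
  exact hp.exists_dvd_sub_of_dvd_aeval hq h3

/-- An irreducible locally nilpotent derivation of `L[s, t]` has a slice. -/
theorem IsLocallyNilpotent.exists_slice_of_isRelPrime (hD : D.IsLocallyNilpotent) (h0 : D ≠ 0)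
    (hrel : IsRelPrime (D (X 0)) (D (X 1))) {g : MvPolynomial (Fin 2) L}
    (hker : D.kerSubalgebra = Algebra.adjoin L {g}) (hp : ∀ c, Prime (g - C c)) :
    ∃ G, D G = 1 := by
  have hg : D g = 0 := by
    change g ∈ D.kerSubalgebra
    rw [hker]; exact Algebra.subset_adjoin rfl
  -- For a root `c` of `q`, the prime `g - c` divides `D a`, hence divides `a - l` for some constant
  -- `l`. Replacing `a` by `(a - l)/(g - c)` removes this root from `q`.
  have key : ∀ N : ℕ, ∀ (q : Polynomial L) (a : MvPolynomial (Fin 2) L), q ≠ 0 → q.natDegree = N →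
      D a = Polynomial.aeval g q → ∃ G, D G = 1 := by
    intro N
    induction N with
    | zero =>
      intro q a hq hN ha
      rw [Polynomial.eq_C_of_natDegree_eq_zero hN, Polynomial.aeval_C] at ha
      have hc : q.coeff 0 ≠ 0 := by
        intro h0
        rw [Polynomial.eq_C_of_natDegree_eq_zero hN, h0, map_zero] at hq
        exact hq rfl
      refine ⟨(q.coeff 0)⁻¹ • a, ?_⟩
      rw [map_smul, ha, Algebra.smul_def, ← map_mul, inv_mul_cancel₀ hc, map_one]
    | succ N ih =>
      intro q a hq hN ha
      have hd : q.degree ≠ 0 := by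
        intro h
        rw [Polynomial.natDegree_eq_zero_iff_degree_le_zero.2 h.le] at hN
        omega
      obtain ⟨c, hc⟩ := IsAlgClosed.exists_root q hd
      obtain ⟨q', rfl⟩ := Polynomial.dvd_iff_isRoot.2 hc
      have hq' : q' ≠ 0 := right_ne_zero_of_mul hq
      rw [Polynomial.natDegree_mul (Polynomial.X_sub_C_ne_zero c) hq',
        Polynomial.natDegree_X_sub_C] at hN
      have hev : Polynomial.aeval g (Polynomial.X - Polynomial.C c) = g - C c := by
        simp [algebraMap_eq]
      rw [map_mul, hev] at ha
      have hDc : ∀ c : L, D (C c) = 0 := fun c => by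
        rw [← algebraMap_eq, Derivation.map_algebraMap]
      have hDp : D (g - C c) = 0 := by rw [map_sub, hg, hDc, sub_zero]
      obtain ⟨l, a', ha'⟩ := hD.exists_dvd_sub_C hrel (hp c) hDp (ha ▸ dvd_mul_right _ _)
      refine ih q' a' hq' (by omega) ?_
      apply mul_left_cancel₀ (hp c).ne_zero
      rw [← ha, ← sub_zero (D a), ← hDc l, ← map_sub, ha', Derivation.leibniz, hDp]
      simp
  obtain ⟨a, ha, ha2⟩ := hD.exists_localSlice h0
  have hm : D a ∈ Algebra.adjoin L {g} := hker ▸ (show D a ∈ D.kerSubalgebra from ha2)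
  rw [Algebra.adjoin_singleton_eq_range_aeval] at hm
  obtain ⟨q, hq⟩ := hm
  refine key _ q a ?_ rfl hq.symm
  rintro rfl
  apply ha
  rw [← hq]
  exact map_zero _

/-- Over an algebraically closed field, a locally nilpotent derivation of `L[s, t]` is a multiple
of a derivation with a slice. -/
theorem IsLocallyNilpotent.exists_eq_smul_slice (hD : D.IsLocallyNilpotent) (h0 : D ≠ 0)
    {g : MvPolynomial (Fin 2) L} (hg : D g = 0) (hg0 : g.totalDegree ≠ 0)
    (hmin : ∀ h, D h = 0 → h.totalDegree ≠ 0 → g.totalDegree ≤ h.totalDegree) :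
    ∃ (c : MvPolynomial (Fin 2) L)
      (D₁ : Derivation L (MvPolynomial (Fin 2) L) (MvPolynomial (Fin 2) L))
      (G : MvPolynomial (Fin 2) L), D = c • D₁ ∧ D₁ G = 1 := by
  have hker := hD.kerSubalgebra_eq_of_minimal h0 hg hg0 hmin
  have hX : D (X 0) ≠ 0 ∨ D (X 1) ≠ 0 := by
    by_contra! h
    apply h0
    apply derivation_ext
    intro i
    fin_cases i
    · simpa using h.1
    · simpa using h.2
  -- Taking out the greatest common divisor of `D(s)` and `D(t)` leaves an irreducible derivation.
  obtain ⟨a, b, c, hab, ha, hb⟩ : ∃ a b c, IsRelPrime a b ∧ c * a = D (X 0) ∧ c * b = D (X 1) := by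
    rcases hX with h | h
    · exact UniqueFactorizationMonoid.exists_reduced_factors _ h _
    · exact UniqueFactorizationMonoid.exists_reduced_factors' _ _ h
  let D₁ := mkDerivation L ![a, b]
  have hDc : D = c • D₁ := by
    apply derivation_ext
    intro i
    rw [Derivation.smul_apply, mkDerivation_X]
    fin_cases i
    · simpa using ha.symm
    · simpa using hb.symm
  obtain ⟨-, hD₁⟩ := (hDc ▸ hD).of_smul (hDc ▸ h0)
  obtain ⟨G, hG⟩ := hD₁.exists_slice_of_isRelPrime (by
      intro h
      rw [h, smul_zero] at hDc
      exact h0 hDc)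
    (by simpa [D₁, mkDerivation_X] using hab) ((kerSubalgebra_eq_of_eq_smul h0 hDc).trans hker)
    (hD.prime_sub_C_of_minimal hg hg0 hmin)
  exact ⟨c, D₁, G, hDc, hG⟩

end AlgClosed

end Derivation

/-! ### Descent to a subfield by linear functionals, and Rentschler's theorem. -/

namespace MvPolynomial

variable {K L σ : Type*} [Field K] [Field L] [Algebra K L]

/-- The application of a `K`-linear functional of `L` to the coefficients of a polynomial. -/
noncomputable def mapCoeff (φ : L →ₗ[K] K) (p : MvPolynomial σ L) : MvPolynomial σ K :=
  ∑ m ∈ p.support, monomial m (φ (coeff m p))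

variable (φ : L →ₗ[K] K)

@[simp]
theorem coeff_mapCoeff (p : MvPolynomial σ L) (m : σ →₀ ℕ) :
    coeff m (mapCoeff φ p) = φ (coeff m p) := by
  classical
  simp only [mapCoeff, coeff_sum, coeff_monomial]
  rw [Finset.sum_ite_eq']
  split_ifs with h
  · rfl
  · rw [notMem_support_iff.1 h, map_zero]

theorem mapCoeff_add (p q : MvPolynomial σ L) :
    mapCoeff φ (p + q) = mapCoeff φ p + mapCoeff φ q := by
  ext m; simp

theorem mapCoeff_C_mul_map (c : L) (q : MvPolynomial σ K) :
    mapCoeff φ (C c * map (algebraMap K L) q) = C (φ c) * q := by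
  ext m
  rw [coeff_mapCoeff, coeff_C_mul, coeff_C_mul, coeff_map, mul_comm, ← Algebra.smul_def, map_smul,
    smul_eq_mul, mul_comm]

theorem mapCoeff_mul_map (p : MvPolynomial σ L) (q : MvPolynomial σ K) :
    mapCoeff φ (p * map (algebraMap K L) q) = mapCoeff φ p * q := by
  classical
  ext m
  rw [coeff_mapCoeff, coeff_mul, coeff_mul, map_sum]
  refine Finset.sum_congr rfl fun x _ => ?_
  rw [coeff_map, coeff_mapCoeff, mul_comm, ← Algebra.smul_def, map_smul, smul_eq_mul, mul_comm]

theorem mapCoeff_pderiv (i : σ) (p : MvPolynomial σ L) :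
    mapCoeff φ (pderiv i p) = pderiv i (mapCoeff φ p) := by
  ext m
  rw [coeff_mapCoeff, coeff_pderiv, coeff_pderiv, coeff_mapCoeff]
  have : coeff (m + Finsupp.single i 1) p * (↑(m i) + 1) =
      ((m i : K) + 1) • coeff (m + Finsupp.single i 1) p := by
    rw [Algebra.smul_def]; simp [mul_comm]
  rw [this, map_smul, smul_eq_mul, mul_comm]

theorem totalDegree_mapCoeff_le (p : MvPolynomial σ L) :
    (mapCoeff φ p).totalDegree ≤ p.totalDegree := by
  refine Finset.sup_mono ?_
  intro m hm
  rw [mem_support_iff, coeff_mapCoeff] at hm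
  rw [mem_support_iff]
  intro h
  rw [h, map_zero] at hm
  exact hm rfl

theorem mapCoeff_aeval_map {τ : Type*} (a : τ → MvPolynomial σ K) (P : MvPolynomial τ L) :
    mapCoeff φ (aeval (fun i => map (algebraMap K L) (a i)) P) = aeval a (mapCoeff φ P) := by
  induction P using MvPolynomial.induction_on' with
  | monomial u c =>
    have h1 : aeval (fun i => map (algebraMap K L) (a i)) (monomial u c) =
        C c * map (algebraMap K L) (aeval a (monomial u (1 : K))) := by
      rw [aeval_monomial, aeval_monomial, map_one, one_mul, Finsupp.prod, Finsupp.prod, map_prod]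
      simp [algebraMap_eq]
    have h2 : mapCoeff φ (monomial u c) = monomial u (φ c) := by
      classical
      ext m
      rw [coeff_mapCoeff, coeff_monomial, coeff_monomial]
      split_ifs <;> simp
    rw [h1, mapCoeff_C_mul_map, h2, aeval_monomial, aeval_monomial, map_one, one_mul, algebraMap_eq]
  | add p q hp hq => rw [map_add, mapCoeff_add, hp, hq, mapCoeff_add, map_add]

/-- Membership in a subalgebra generated over `K` can be checked after extending scalars. -/
theorem mem_adjoin_of_map_mem_adjoin {τ : Type*} (a : τ → MvPolynomial σ K)
    {f : MvPolynomial σ K} (hf : map (algebraMap K L) f ∈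
      Algebra.adjoin L (Set.range fun i => map (algebraMap K L) (a i))) :
    f ∈ Algebra.adjoin K (Set.range a) := by
  -- A `K`-linear retraction of `L` onto `K` sends an expression over `L` to one over `K` without
  -- changing `f`.
  obtain ⟨φ, hφ⟩ := (Algebra.linearMap K L).exists_leftInverse_of_injective
    (LinearMap.ker_eq_bot.2 (algebraMap K L).injective)
  have h1 : φ 1 = 1 := by
    have := DFunLike.congr_fun hφ 1
    simpa using this
  rw [Algebra.adjoin_range_eq_range_aeval] at hf ⊢
  obtain ⟨P, hP⟩ := hf
  refine ⟨mapCoeff φ P, ?_⟩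
  change aeval a _ = f
  change aeval _ P = _ at hP
  rw [← mapCoeff_aeval_map, hP]
  have := mapCoeff_C_mul_map φ 1 f
  rwa [C_1, one_mul, h1, C_1, one_mul] at this

/-- Functionals separate the points of `L`, so one of them preserves a given nonconstant
coefficient. -/
theorem exists_mapCoeff_totalDegree_ne_zero {p : MvPolynomial σ L} (hp : p.totalDegree ≠ 0) :
    ∃ φ : L →ₗ[K] K, (mapCoeff φ p).totalDegree ≠ 0 := by
  classical
  by_contra! h
  apply hp
  rw [totalDegree_eq_zero_iff_eq_C]
  ext m
  by_cases hm : m = 0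
  · subst hm; simp
  have h1 : coeff m p = 0 := by
    rw [← Module.forall_dual_apply_eq_zero_iff K]
    intro φ
    have h2 := totalDegree_eq_zero_iff_eq_C.1 (h φ)
    have h3 := congrArg (coeff m) h2
    rwa [coeff_mapCoeff, coeff_C, if_neg (Ne.symm hm)] at h3
  rw [h1, coeff_C, if_neg (Ne.symm hm)]

theorem exists_mapCoeff_ne_zero {p : MvPolynomial σ L} (hp : p ≠ 0) :
    ∃ φ : L →ₗ[K] K, mapCoeff φ p ≠ 0 := by
  by_contra! h
  apply hp
  ext m
  rw [coeff_zero, ← Module.forall_dual_apply_eq_zero_iff K]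
  intro φ
  have := congrArg (coeff m) (h φ)
  simpa using this

theorem totalDegree_map_algebraMap (p : MvPolynomial σ K) :
    (map (algebraMap K L) p).totalDegree = p.totalDegree := by
  simp only [totalDegree, support_map_of_injective p (algebraMap K L).injective]

theorem derivation_apply_eq {R : Type*} [CommRing R]
    (D : Derivation R (MvPolynomial (Fin 2) R) (MvPolynomial (Fin 2) R))
    (p : MvPolynomial (Fin 2) R) :
    D p = pderiv 0 p * D (X 0) + pderiv 1 p * D (X 1) := by
  have : D = D (X 0) • pderiv 0 + D (X 1) • pderiv 1 := by
    apply derivation_ext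
    intro i
    fin_cases i <;> simp [pderiv_X]
  conv_lhs => rw [this]
  simp [mul_comm]

end MvPolynomial

namespace Derivation

open MvPolynomial

variable {K L : Type*} [Field K] [Field L] [Algebra K L]

/-- The extension of scalars of a derivation of `K[s, t]`. -/
noncomputable def extendScalars (L : Type*) [Field L] [Algebra K L]
    (D : Derivation K (MvPolynomial (Fin 2) K) (MvPolynomial (Fin 2) K)) :
    Derivation L (MvPolynomial (Fin 2) L) (MvPolynomial (Fin 2) L) :=
  mkDerivation L fun i => map (algebraMap K L) (D (X i))

variable (D : Derivation K (MvPolynomial (Fin 2) K) (MvPolynomial (Fin 2) K))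

theorem extendScalars_map (p : MvPolynomial (Fin 2) K) :
    D.extendScalars L (map (algebraMap K L) p) = map (algebraMap K L) (D p) := by
  rw [derivation_apply_eq, derivation_apply_eq D p, map_add, map_mul, map_mul, extendScalars,
    mkDerivation_X, mkDerivation_X, pderiv_map, pderiv_map]

/-- Since `D` is defined over `K`, functionals carry kernel elements and equations `D'(G) = c` from
`L` down to `K`. -/
theorem mapCoeff_extendScalars (φ : L →ₗ[K] K) (p : MvPolynomial (Fin 2) L) :
    mapCoeff φ (D.extendScalars L p) = D (mapCoeff φ p) := by
  rw [derivation_apply_eq, derivation_apply_eq D, extendScalars, mkDerivation_X, mkDerivation_X,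
    mapCoeff_add, mapCoeff_mul_map, mapCoeff_mul_map, mapCoeff_pderiv, mapCoeff_pderiv]

variable [CharZero K] [CharZero L] {D}

theorem IsLocallyNilpotent.extendScalars (hD : D.IsLocallyNilpotent) :
    (D.extendScalars L).IsLocallyNilpotent := by
  rw [isLocallyNilpotent_iff, eq_top_iff, ← adjoin_range_X, Algebra.adjoin_le_iff]
  rintro _ ⟨i, rfl⟩
  obtain ⟨N, hN⟩ := hD (X i)
  refine (mem_nilSubalgebra _).2 ⟨N, ?_⟩
  have h : ∀ n p, (⇑(D.extendScalars L))^[n] (map (algebraMap K L) p) =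
      map (algebraMap K L) ((⇑D)^[n] p) := by
    intro n p
    induction n with
    | zero => rfl
    | succ n ih =>
      rw [Function.iterate_succ_apply', Function.iterate_succ_apply', ih, extendScalars_map]
  have := h N (X i)
  rwa [hN, map_X, map_zero] at this

/-- Rentschler's theorem: the kernel of a nonzero locally nilpotent derivation of `K[s, t]` is
generated by a variable. -/
theorem IsLocallyNilpotent.exists_kerSubalgebra_eq_adjoin_variable (hD : D.IsLocallyNilpotent)
    (h0 : D ≠ 0) :
    ∃ g, g.totalDegree ≠ 0 ∧ D.kerSubalgebra = Algebra.adjoin K {g} ∧ IsPolyVariable K g := by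
  let L := AlgebraicClosure K
  have : CharZero L := charZero_of_injective_algebraMap (algebraMap K L).injective
  let ι : MvPolynomial (Fin 2) K →+* MvPolynomial (Fin 2) L := map (algebraMap K L)
  have hι : Function.Injective ι := map_injective _ (algebraMap K L).injective
  obtain ⟨g, ⟨hg, hg0⟩, hmin⟩ : ∃ g, (D g = 0 ∧ g.totalDegree ≠ 0) ∧
      ∀ h, D h = 0 → h.totalDegree ≠ 0 → g.totalDegree ≤ h.totalDegree := by
    obtain ⟨g, hg, hm⟩ := WellFounded.has_min (measure totalDegree).wf
      {g : MvPolynomial (Fin 2) K | D g = 0 ∧ g.totalDegree ≠ 0} (hD.exists_totalDegree_ne_zero h0)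
    exact ⟨g, hg, fun h h1 h2 => not_lt.1 (hm h ⟨h1, h2⟩)⟩
  let D' := D.extendScalars L
  have hD' : D'.IsLocallyNilpotent := hD.extendScalars
  have h0' : D' ≠ 0 := by
    intro h
    apply h0
    ext1 p
    apply hι
    rw [← extendScalars_map]
    change D' _ = _
    rw [h, Derivation.zero_apply, Derivation.zero_apply, map_zero]
  have hg' : D' (ι g) = 0 := by
    change D.extendScalars L _ = 0
    rw [extendScalars_map, hg, map_zero]
  have hdeg : (ι g).totalDegree = g.totalDegree := totalDegree_map_algebraMap g
  have hg0' : (ι g).totalDegree ≠ 0 := hdeg ▸ hg0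
  -- A nonconstant kernel element over `L` yields one over `K` of no larger degree, so minimality of
  -- `g` persists over `L`.
  have hmin' : ∀ h, D' h = 0 → h.totalDegree ≠ 0 → (ι g).totalDegree ≤ h.totalDegree := by
    intro h hh hh0
    obtain ⟨φ, hφ⟩ := exists_mapCoeff_totalDegree_ne_zero (K := K) hh0
    rw [hdeg]
    refine (hmin _ ?_ hφ).trans (totalDegree_mapCoeff_le φ h)
    rw [← mapCoeff_extendScalars]
    change mapCoeff φ (D' h) = 0
    rw [hh]
    ext m
    simp
  have hker := hD'.kerSubalgebra_eq_of_minimal h0' hg' hg0' hmin'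
  have hr1 : ∀ (R : Type _) [CommRing R] (a : R), Set.range (fun _ : Fin 1 => a) = {a} :=
    fun R _ a => Set.range_const
  refine ⟨g, hg0, ?_, ?_⟩
  · apply le_antisymm
    · intro f hf
      have h1 : ι f ∈ D'.kerSubalgebra := by
        change D.extendScalars L _ = 0
        rw [extendScalars_map, show D f = 0 from hf, map_zero]
      rw [hker] at h1
      have h2 := mem_adjoin_of_map_mem_adjoin (L := L) (fun _ : Fin 1 => g) (f := f)
        (by rw [hr1]; exact h1)
      rwa [hr1] at h2
    · rw [Algebra.adjoin_le_iff]
      rintro _ rfl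
      exact hg
  · obtain ⟨c, D₁, G, hc, hG⟩ := hD'.exists_eq_smul_slice h0' hg' hg0' hmin'
    have hc0 : c ≠ 0 := by
      rintro rfl
      rw [zero_smul] at hc
      exact h0' hc
    obtain ⟨φ, hφ⟩ := exists_mapCoeff_ne_zero (K := K) hc0
    have h1 : ι (mapCoeff φ c) = c * D₁ (ι (mapCoeff φ G)) := by
      have h2 : D' G = c := by rw [hc, Derivation.smul_apply, hG, smul_eq_mul, mul_one]
      have h3 : D' (ι (mapCoeff φ G)) = ι (mapCoeff φ c) := by
        change D.extendScalars L _ = _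
        rw [extendScalars_map, ← mapCoeff_extendScalars]
        change ι (mapCoeff φ (D' G)) = _
        rw [h2]
      rw [← h3, hc, Derivation.smul_apply, smul_eq_mul]
    have hne : c * D₁ (ι (mapCoeff φ G)) ≠ 0 := by
      rw [← h1]
      exact (map_ne_zero_iff ι hι).2 hφ
    have hdegc := totalDegree_mul_of_isDomain hc0 (right_ne_zero_of_mul hne)
    rw [← h1, show (ι (mapCoeff φ c)).totalDegree = _ from totalDegree_map_algebraMap _] at hdegc
    have h2 := totalDegree_mapCoeff_le φ c
    -- The image of `c` under `φ` is nonzero, has degree at most that of `c`, and equals `c` times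
    -- this factor. The factor is thus a nonzero constant, and `G` can be replaced by a polynomial
    -- over `K`.
    have h3 : (D₁ (ι (mapCoeff φ G))).totalDegree = 0 := by omega
    rw [totalDegree_eq_zero_iff_eq_C] at h3
    set w := (D₁ (ι (mapCoeff φ G))).coeff 0 with hw
    have hw0 : w ≠ 0 := by
      intro h
      rw [h3, h, C_0, mul_zero] at hne
      exact hne rfl
    have hs : D₁ (w⁻¹ • ι (mapCoeff φ G)) = 1 := by
      rw [map_smul, h3, smul_eq_C_mul, ← C_mul, inv_mul_cancel₀ hw0, C_1]
    have htop := hD'.adjoin_pair_eq_top h0' hc hs hker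
    refine ⟨mapCoeff φ G, ?_⟩
    rw [eq_top_iff]
    intro f _
    have hr2 : ∀ {R : Type _} (a b : R), Set.range ![a, b] = {a, b} := by
      intro R a b
      simp [Matrix.range_cons, Matrix.range_empty, Set.pair_comm]
    have h4 : ι f ∈ Algebra.adjoin L {ι g, ι (mapCoeff φ G)} := by
      have h5 : Algebra.adjoin L {ι g, w⁻¹ • ι (mapCoeff φ G)} ≤
          Algebra.adjoin L {ι g, ι (mapCoeff φ G)} := by
        rw [Algebra.adjoin_le_iff]
        rintro _ (rfl | rfl)
        · exact Algebra.subset_adjoin (by simp)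
        · exact Subalgebra.smul_mem _ (Algebra.subset_adjoin (by simp)) _
      rw [htop] at h5
      exact h5 trivial
    have h6 := mem_adjoin_of_map_mem_adjoin (L := L) ![g, mapCoeff φ G] (f := f) (by
      have : (fun i => map (algebraMap K L) (![g, mapCoeff φ G] i)) =
          ![ι g, ι (mapCoeff φ G)] := by
        funext i; fin_cases i <;> rfl
      rw [this, hr2]
      exact h4)
    rwa [hr2] at h6

end Derivation

/-! ### Primitive polynomials over a principal ideal domain. -/

namespace MvPolynomial

section Content

variable {R K σ : Type*} [CommRing R] [IsDomain R] [Field K] [Algebra R K] [IsFractionRing R K]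

theorem exists_map_eq_C_mul (g : MvPolynomial σ K) :
    ∃ (c : R) (f : MvPolynomial σ R), c ≠ 0 ∧
      map (algebraMap R K) f = C (algebraMap R K c) * g := by
  induction g using MvPolynomial.induction_on' with
  | monomial u a =>
    obtain ⟨n, c, hc, rfl⟩ := IsFractionRing.div_surjective (A := R) a
    have hc0 : algebraMap R K c ≠ 0 :=
      (map_ne_zero_iff _ (IsFractionRing.injective R K)).2 (nonZeroDivisors.ne_zero hc)
    refine ⟨c, monomial u n, nonZeroDivisors.ne_zero hc, ?_⟩
    rw [map_monomial, C_mul_monomial, mul_div_cancel₀ _ hc0]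
  | add p q hp hq =>
    obtain ⟨c, f, hc, hf⟩ := hp
    obtain ⟨c', f', hc', hf'⟩ := hq
    refine ⟨c * c', C c' * f + C c * f', mul_ne_zero hc hc', ?_⟩
    rw [map_add, map_mul, map_mul, hf, hf', map_C, map_C, map_mul, C_mul]
    ring

theorem _root_.Polynomial.exists_map_eq_C_mul (q : Polynomial K) :
    ∃ (c : R) (p : Polynomial R), c ≠ 0 ∧
      p.map (algebraMap R K) = Polynomial.C (algebraMap R K c) * q := by
  induction q using Polynomial.induction_on' with
  | monomial u a =>
    obtain ⟨n, c, hc, rfl⟩ := IsFractionRing.div_surjective (A := R) a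
    have hc0 : algebraMap R K c ≠ 0 :=
      (map_ne_zero_iff _ (IsFractionRing.injective R K)).2 (nonZeroDivisors.ne_zero hc)
    refine ⟨c, Polynomial.monomial u n, nonZeroDivisors.ne_zero hc, ?_⟩
    rw [Polynomial.map_monomial, Polynomial.C_mul_monomial, mul_div_cancel₀ _ hc0]
  | add p q hp hq =>
    obtain ⟨c, f, hc, hf⟩ := hp
    obtain ⟨c', f', hc', hf'⟩ := hq
    refine ⟨c * c', Polynomial.C c' * f + Polynomial.C c * f', mul_ne_zero hc hc', ?_⟩
    rw [Polynomial.map_add, Polynomial.map_mul, Polynomial.map_mul, hf, hf', Polynomial.map_C,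
      Polynomial.map_C, map_mul, Polynomial.C_mul]
    ring

/-- A nonzero polynomial over a principal ideal domain is a multiple of a primitive one. -/
theorem exists_eq_C_mul_primitive [IsPrincipalIdealRing R] {f : MvPolynomial σ R} (hf : f ≠ 0) :
    ∃ (c : R) (f' : MvPolynomial σ R), c ≠ 0 ∧ f = C c * f' ∧ ∀ p, Prime p → ¬ C p ∣ f' := by
  let I : Ideal R := Ideal.span (Set.range fun m => coeff m f)
  -- The content is a generator of the ideal of coefficients. A further prime factor `p` would put
  -- this ideal inside `(cp)`.
  obtain ⟨c, hc⟩ := (IsPrincipalIdealRing.principal I).principal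
  have hdvd : C c ∣ f := by
    rw [C_dvd_iff_dvd_coeff]
    intro m
    have : coeff m f ∈ I := Ideal.subset_span ⟨m, rfl⟩
    rwa [hc, Ideal.submodule_span_eq, Ideal.mem_span_singleton] at this
  obtain ⟨f', rfl⟩ := hdvd
  have hc0 : c ≠ 0 := by rintro rfl; simp at hf
  refine ⟨c, f', hc0, rfl, ?_⟩
  rintro p hp ⟨f'', rfl⟩
  have hle : I ≤ Ideal.span {c * p} := by
    rw [Ideal.span_le]
    rintro _ ⟨m, rfl⟩
    rw [SetLike.mem_coe, Ideal.mem_span_singleton]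
    simp only [← mul_assoc, ← C_mul, coeff_C_mul]
    exact dvd_mul_right _ _
  rw [hc, Ideal.submodule_span_eq, Ideal.span_singleton_le_span_singleton] at hle
  exact hp.not_isUnit (isUnit_of_dvd_one ((mul_dvd_mul_iff_left hc0).1 (by rwa [mul_one])))

/-- A nonzero polynomial without constant term is transcendental. -/
theorem eq_zero_of_aeval_eq_zero {f : MvPolynomial σ R} (hf : f ≠ 0) (hf0 : constantCoeff f = 0)
    {q : Polynomial R} (h : Polynomial.aeval f q = 0) : q = 0 := by
  by_contra hq
  obtain ⟨q', hq', hX⟩ := (Polynomial.finiteMultiplicity_of_degree_pos_of_monic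
    (by simp) Polynomial.monic_X hq).exists_eq_pow_mul_and_not_dvd
  rw [hq', map_mul, map_pow, Polynomial.aeval_X] at h
  -- After cancelling powers of `f`, the constant term of `q'(f) = 0` is `q'(0)`, which is nonzero
  -- because `X` does not divide `q'`.
  have h1 := congrArg constantCoeff ((mul_eq_zero.1 h).resolve_left (pow_ne_zero _ hf))
  apply hX
  rw [Polynomial.X_dvd_iff]
  rw [Polynomial.aeval_def, Polynomial.hom_eval₂, hf0, map_zero] at h1
  have h2 : (constantCoeff : MvPolynomial σ R →+* R).comp (algebraMap R (MvPolynomial σ R)) =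
      RingHom.id R := by
    ext a; simp [algebraMap_eq]
  rw [h2] at h1
  rw [Polynomial.coeff_zero_eq_eval_zero]
  exact h1

/-- If `f` is primitive without constant term, then `K[f] ∩ R[σ] = R[f]`. -/
theorem exists_aeval_eq_of_map_mem_adjoin [IsPrincipalIdealRing R] {f h : MvPolynomial σ R}
    (hf0 : constantCoeff f = 0) (hf : ∀ p, Prime p → ¬ C p ∣ f)
    (hh : map (algebraMap R K) h ∈ Algebra.adjoin K {map (algebraMap R K) f}) :
    ∃ q : Polynomial R, Polynomial.aeval f q = h := by
  have key : ∀ c : R, c ≠ 0 → ∀ (h : MvPolynomial σ R) (q : Polynomial R),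
      C c * h = Polynomial.aeval f q → ∃ q : Polynomial R, Polynomial.aeval f q = h := by
    intro c
    induction c using UniqueFactorizationMonoid.induction_on_prime with
    | h₁ => intro h0; exact absurd rfl h0
    | h₂ c hc =>
      intro _ h q hq
      obtain ⟨u, rfl⟩ := hc
      refine ⟨Polynomial.C (↑u⁻¹ : R) * q, ?_⟩
      rw [map_mul, ← hq, Polynomial.aeval_C, algebraMap_eq, ← mul_assoc, ← C_mul, Units.inv_mul,
        C_1, one_mul]
    | h₃ a p ha hp ih =>
      intro _ h q hq
      have hI : (Ideal.span {p}).IsPrime := (Ideal.span_singleton_prime hp.ne_zero).2 hp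
      let π := Ideal.Quotient.mk (Ideal.span {p})
      have hπ : ∀ r, π r = 0 ↔ p ∣ r := fun r => by
        rw [← Ideal.mem_span_singleton]; exact Ideal.Quotient.eq_zero_iff_mem
      -- Modulo a prime `p` of the denominator the relation reads `q(f) = 0`. Primitivity keeps `f`
      -- nonzero modulo `p`, hence transcendental, so `p` divides `q` and can be cancelled.
      have h1 : q.map π = 0 := by
        refine eq_zero_of_aeval_eq_zero (f := map π f) ?_ ?_ ?_
        · rw [Ne, ← C_dvd_iff_map_hom_eq_zero π p hπ]
          exact hf p hp
        · rw [constantCoeff_map, hf0, map_zero]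
        · have h2 := congrArg (map π) hq
          rw [map_mul, map_C, map_mul, (hπ p).2 dvd_rfl, zero_mul, C_0, zero_mul] at h2
          rw [h2, Polynomial.aeval_def, Polynomial.aeval_def, Polynomial.hom_eval₂,
            Polynomial.eval₂_map]
          congr 1
          ext a
          simp [algebraMap_eq]
      have h3 : Polynomial.C p ∣ q := by
        rw [Polynomial.C_dvd_iff_dvd_coeff]
        intro i
        rw [← hπ, ← Polynomial.coeff_map, h1, Polynomial.coeff_zero]
      obtain ⟨q', rfl⟩ := h3
      refine ih ha h q' ?_
      have hp0 : (C p : MvPolynomial σ R) ≠ 0 := by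
        rw [Ne, C_eq_zero]; exact hp.ne_zero
      apply mul_left_cancel₀ hp0
      rw [← mul_assoc, ← C_mul, hq, map_mul, Polynomial.aeval_C, algebraMap_eq]
  rw [Algebra.adjoin_singleton_eq_range_aeval] at hh
  obtain ⟨q, hq⟩ := hh
  change Polynomial.aeval _ q = _ at hq
  obtain ⟨c, p, hc, hp⟩ := Polynomial.exists_map_eq_C_mul (R := R) q
  refine key c hc h p ?_
  apply map_injective _ (IsFractionRing.injective R K)
  rw [map_mul, map_C, ← hq, Polynomial.aeval_def f p, Polynomial.hom_eval₂]
  have h2 : ((map (algebraMap R K)).comp (algebraMap R (MvPolynomial σ R))) =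
      (algebraMap K (MvPolynomial σ K)).comp (algebraMap R K) := by
    ext a; simp [algebraMap_eq]
  rw [h2, ← Polynomial.eval₂_map, hp, ← Polynomial.aeval_def, map_mul, Polynomial.aeval_C,
    algebraMap_eq]

/-- A nonconstant polynomial over the fraction field can be normalized by an affine
transformation to a primitive polynomial without constant term. -/
theorem exists_primitive_affine [IsPrincipalIdealRing R] {g : MvPolynomial σ K}
    (hg : g.totalDegree ≠ 0) :
    ∃ (f : MvPolynomial σ R) (a b : K), b ≠ 0 ∧ map (algebraMap R K) f = C b * (g - C a) ∧
      f ≠ 0 ∧ constantCoeff f = 0 ∧ ∀ p, Prime p → ¬ C p ∣ f := by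
  have hinj := IsFractionRing.injective R K
  obtain ⟨c, f, hc, hf⟩ := exists_map_eq_C_mul (R := R) (g - C (constantCoeff g))
  have hc' : algebraMap R K c ≠ 0 := (map_ne_zero_iff _ hinj).2 hc
  have hne : g - C (constantCoeff g) ≠ 0 := by
    intro h
    rw [sub_eq_zero] at h
    rw [h, totalDegree_C] at hg
    exact hg rfl
  have hf0 : f ≠ 0 := by
    rintro rfl
    rw [map_zero] at hf
    exact mul_ne_zero ((map_ne_zero_iff _ (C_injective _ _)).2 hc') hne hf.symm
  obtain ⟨c', f', hc0, rfl, hprim⟩ := exists_eq_C_mul_primitive hf0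
  have hc0' : algebraMap R K c' ≠ 0 := (map_ne_zero_iff _ hinj).2 hc0
  have hmap : map (algebraMap R K) f' =
      C ((algebraMap R K c')⁻¹ * algebraMap R K c) * (g - C (constantCoeff g)) := by
    rw [C_mul, mul_assoc, ← hf, map_mul, map_C, ← mul_assoc, ← C_mul, inv_mul_cancel₀ hc0', C_1,
      one_mul]
  refine ⟨f', _, _, mul_ne_zero (inv_ne_zero hc0') hc', hmap, right_ne_zero_of_mul hf0, ?_, hprim⟩
  apply hinj
  rw [← constantCoeff_map, hmap, map_zero, map_mul, map_sub]
  simp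

theorem mem_adjoin_C_mul_sub_C (g : MvPolynomial σ K) {a b : K} (hb : b ≠ 0) :
    g ∈ Algebra.adjoin K {C b * (g - C a)} := by
  have hC : ∀ c : K, C c ∈ Algebra.adjoin K {C b * (g - C a)} := fun c => by
    rw [← algebraMap_eq]
    exact Subalgebra.algebraMap_mem _ c
  have h1 : C b⁻¹ * (C b * (g - C a)) + C a = g := by
    rw [← mul_assoc, ← C_mul, inv_mul_cancel₀ hb, C_1, one_mul, sub_add_cancel]
  have h2 := Subalgebra.add_mem _ (Subalgebra.mul_mem _ (hC b⁻¹)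
    (Algebra.subset_adjoin (Set.mem_singleton _))) (hC a)
  rwa [h1] at h2

end Content

end MvPolynomial

/-! ### Passage to `k(x)[s, t]` and conclusion. -/

namespace NewClass

open MvPolynomial

variable {k : Type*} [Field k]

/-- The isomorphism `k[x, s, t] → k[x][s, t]`. -/
noncomputable def toPolyPoly (k : Type*) [Field k] :
    MvPolynomial (Fin 3) k →ₐ[k] MvPolynomial (Fin 2) (Polynomial k) :=
  aeval ![C Polynomial.X, X 0, X 1]

/-- The isomorphism `k[x][s, t] → k[x, s, t]`. -/
noncomputable def ofPolyPoly (k : Type*) [Field k] :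
    MvPolynomial (Fin 2) (Polynomial k) →+* MvPolynomial (Fin 3) k :=
  eval₂Hom (Polynomial.aeval (X 0 : MvPolynomial (Fin 3) k)).toRingHom ![X 1, X 2]

theorem ofPolyPoly_toPolyPoly (p : MvPolynomial (Fin 3) k) :
    ofPolyPoly k (toPolyPoly k p) = p := by
  induction p using MvPolynomial.induction_on with
  | C a =>
    rw [← algebraMap_eq, AlgHom.commutes, IsScalarTower.algebraMap_apply k (Polynomial k)]
    simp [ofPolyPoly, algebraMap_eq]
  | add p q hp hq => rw [map_add, map_add, hp, hq]
  | mul_X p i hp =>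
    rw [map_mul, map_mul, hp]
    congr 1
    fin_cases i <;> simp [toPolyPoly, ofPolyPoly]

theorem toPolyPoly_ofPolyPoly (p : MvPolynomial (Fin 2) (Polynomial k)) :
    toPolyPoly k (ofPolyPoly k p) = p := by
  have h : (toPolyPoly k).toRingHom.comp (ofPolyPoly k) = RingHom.id _ := by
    apply MvPolynomial.ringHom_ext
    · intro a
      have : (toPolyPoly k) (Polynomial.aeval (X 0) a) = C a := by
        rw [← Polynomial.aeval_algHom_apply]
        have h1 : toPolyPoly k (X 0) = C Polynomial.X := by simp [toPolyPoly]
        rw [h1, ← algebraMap_eq, Polynomial.aeval_algebraMap_apply, Polynomial.aeval_X_left_apply]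
      simpa [ofPolyPoly] using this
    · intro i
      fin_cases i <;> simp [toPolyPoly, ofPolyPoly]
  exact DFunLike.congr_fun h p

theorem map_toPolyPoly (p : MvPolynomial (Fin 3) k) :
    map (algebraMap (Polynomial k) (RatFunc k)) (toPolyPoly k p) = toRatPoly k p := by
  have h := comp_aeval_apply ![(C Polynomial.X : MvPolynomial (Fin 2) (Polynomial k)), X 0, X 1]
    (mapAlgHom (IsScalarTower.toAlgHom k (Polynomial k) (RatFunc k))) p
  rw [comp_vec_three] at h
  refine h.trans ?_
  have h1 : ∀ q : MvPolynomial (Fin 2) (Polynomial k),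
      mapAlgHom (IsScalarTower.toAlgHom k (Polynomial k) (RatFunc k)) q =
        map (algebraMap (Polynomial k) (RatFunc k)) q := fun q => rfl
  rw [h1, h1, h1, map_C, map_X, map_X, RatFunc.algebraMap_X, toRatPoly]

theorem toRatPoly_injective : Function.Injective (toRatPoly k) := by
  intro p q h
  rw [← map_toPolyPoly, ← map_toPolyPoly] at h
  have := map_injective _ (IsFractionRing.injective (Polynomial k) (RatFunc k)) h
  rw [← ofPolyPoly_toPolyPoly p, this, ofPolyPoly_toPolyPoly]

variable {n e m d r : ℕ} {Q : MvPolynomial (Fin 3) k}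

/-- The embedding of `B` into `k(x)[s, t]`. -/
theorem exists_ratPoly_embedding (hn : 1 ≤ n) (hm : 2 ≤ m) (hd : 2 ≤ d) :
    ∃ ψ : B n e m d r Q →ₐ[k] MvPolynomial (Fin 2) (RatFunc k), Function.Injective ψ ∧
      ψ (x n e m d r Q) = C RatFunc.X ∧ ψ (s n e m d r Q) = X 0 ∧ ψ (t n e m d r Q) = X 1 ∧
      ∀ p, ψ (evalXST n e m d r Q p) = toRatPoly k p := by
  have hpow : ∀ j (a : MvPolynomial (Fin 2) (RatFunc k)),
      C RatFunc.X ^ j * (C (RatFunc.X ^ j)⁻¹ * a) = a := by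
    intro j a
    rw [← mul_assoc, ← C_pow, ← C_mul, mul_inv_cancel₀ (pow_ne_zero _ RatFunc.X_ne_zero), C_1,
      one_mul]
  obtain ⟨ψ, hx, hs, ht, -, -⟩ := exists_lift (n := n) (e := e) (m := m) (d := d) (r := r) (Q := Q)
    (hpow n (X 0 ^ d + X 1 ^ r + C RatFunc.X * aeval ![C RatFunc.X, X 0, X 1] Q))
    (hpow e _)
  have hev : ∀ p, ψ (evalXST n e m d r Q p) = toRatPoly k p := by
    intro p
    rw [map_evalXST, hx, hs, ht, toRatPoly]
  refine ⟨ψ, injective_of_injective_evalXST hn hm hd ψ ?_, hx, hs, ht, hev⟩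
  intro p q h
  simp only [hev] at h
  exact toRatPoly_injective h

/-- If `f ∈ k[x][s, t]` is nonzero without constant term, then `x` and `f` are algebraically
independent. -/
theorem algebraicIndependent_C_X {f : MvPolynomial (Fin 2) (Polynomial k)} (hf : f ≠ 0)
    (hf0 : constantCoeff f = 0) :
    AlgebraicIndependent k ![(C Polynomial.X : MvPolynomial (Fin 2) (Polynomial k)), f] := by
  rw [algebraicIndependent_iff]
  intro P hP
  let τ : MvPolynomial (Fin 2) k →ₐ[k] Polynomial (Polynomial k) :=
    aeval ![Polynomial.C Polynomial.X, Polynomial.X]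
  let g : Polynomial (Polynomial k) →+* MvPolynomial (Fin 2) k :=
    Polynomial.eval₂RingHom (Polynomial.aeval (X 0 : MvPolynomial (Fin 2) k)).toRingHom (X 1)
  have hg : ∀ p, g (τ p) = p := by
    intro p
    induction p using MvPolynomial.induction_on with
    | C a =>
      rw [← algebraMap_eq, AlgHom.commutes, IsScalarTower.algebraMap_apply k (Polynomial k)]
      simp [g, algebraMap_eq, Polynomial.algebraMap_eq]
    | add p q hp hq => rw [map_add, map_add, hp, hq]
    | mul_X p i hp =>
      rw [map_mul, map_mul, hp]
      congr 1
      fin_cases i <;> simp [g, τ]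
  have h1 : Polynomial.aeval f (τ P) = 0 := by
    have h2 := comp_aeval_apply ![Polynomial.C (Polynomial.X : Polynomial k), Polynomial.X]
      ((Polynomial.aeval (R := Polynomial k) f).restrictScalars k) P
    rw [comp_vec_two] at h2
    refine h2.trans ?_
    simpa [algebraMap_eq] using hP
  rw [← hg P, eq_zero_of_aeval_eq_zero hf hf0 h1, map_zero]

/-- The subalgebra `k[x, F]` contains the images of all polynomials in `F` over `k[x]`. -/
theorem evalXST_ofPolyPoly_aeval_mem (f : MvPolynomial (Fin 3) k)
    (q : Polynomial (Polynomial k)) :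
    evalXST n e m d r Q (ofPolyPoly k (Polynomial.aeval (toPolyPoly k f) q)) ∈
      Algebra.adjoin k {x n e m d r Q, evalXST n e m d r Q f} := by
  let ev : MvPolynomial (Fin 3) k →ₐ[k] B n e m d r Q :=
    aeval ![x n e m d r Q, s n e m d r Q, t n e m d r Q]
  change ev _ ∈ _
  induction q using Polynomial.induction_on' with
  | monomial i a =>
    rw [Polynomial.aeval_monomial, map_mul, map_mul, map_pow, map_pow, ofPolyPoly_toPolyPoly,
      algebraMap_eq]
    refine mul_mem ?_ (pow_mem (Algebra.subset_adjoin (by simp [ev, evalXST])) i)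
    have h1 : ofPolyPoly k (C a) = Polynomial.aeval (X 0) a := by simp [ofPolyPoly]
    have h2 : ev (X 0) = x n e m d r Q := by simp [ev]
    rw [h1, ← Polynomial.aeval_algHom_apply, h2]
    exact Algebra.adjoin_mono (by simp) (Polynomial.aeval_mem_adjoin_singleton k _)
  | add p q hp hq => rw [map_add, map_add, map_add]; exact add_mem hp hq

/-- The kernel of a nonzero locally nilpotent derivation of `B` is a polynomial ring `k[x, F]`, where
`F` is a variable of `k(x)[s, t]`. -/
theorem exists_kerSubalgebra_eq_adjoin [CharZero k] (hn : 1 ≤ n) (hne : (n, e) ≠ (1, 0))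
    (hm : 2 ≤ m) (hd : 2 ≤ d) (hr : 2 ≤ r) (hdr : Nat.gcd d r = 1)
    {D : Derivation k (B n e m d r Q) (B n e m d r Q)} (hD : D.IsLocallyNilpotent) (h0 : D ≠ 0) :
    ∃ f : MvPolynomial (Fin 3) k, IsPolyVariable (RatFunc k) (toRatPoly k f) ∧
      D.kerSubalgebra = Algebra.adjoin k {x n e m d r Q, evalXST n e m d r Q f} ∧
      AlgebraicIndependent k ![x n e m d r Q, evalXST n e m d r Q f] := by
  have hinj := evalXST_injective (k := k) (e := e) (r := r) (Q := Q) hn hm hd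
  obtain ⟨ψ, hψ, hψx, hψs, hψt, hψev⟩ :=
    exists_ratPoly_embedding (k := k) (e := e) (r := r) (Q := Q) hn hm hd
  have hDx := apply_x_eq_zero hn hne hm hd hr hdr hD h0
  -- The extension of `D` can be taken `k(x)`-linear because `D x = 0`.
  let D' : Derivation (RatFunc k) (MvPolynomial (Fin 2) (RatFunc k))
    (MvPolynomial (Fin 2) (RatFunc k)) := mkDerivation _ ![ψ (D (s n e m d r Q)),
      ψ (D (t n e m d r Q))]
  have hcomp : ∀ b, D' (ψ b) = ψ (D b) := by
    have hX : (C RatFunc.X : MvPolynomial (Fin 2) (RatFunc k)) ≠ 0 := by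
      rw [Ne, C_eq_zero]; exact RatFunc.X_ne_zero
    refine derivation_comp_eq ψ (hψx ▸ hX) D (D'.restrictScalars k) ?_ ?_ ?_
    · rw [hψx, hDx, map_zero, Derivation.restrictScalars_apply, ← algebraMap_eq,
        Derivation.map_algebraMap]
    · rw [hψs, Derivation.restrictScalars_apply, mkDerivation_X]; rfl
    · rw [hψt, Derivation.restrictScalars_apply, mkDerivation_X]; rfl
  have hiter : ∀ N b, (⇑D')^[N] (ψ b) = ψ ((⇑D)^[N] b) := by
    intro N b
    induction N with
    | zero => rfl
    | succ N ih => rw [Function.iterate_succ_apply', Function.iterate_succ_apply', ih, hcomp]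
  have : CharZero (RatFunc k) := charZero_of_injective_algebraMap (algebraMap k (RatFunc k)).injective
  have hD' : D'.IsLocallyNilpotent := by
    rw [Derivation.isLocallyNilpotent_iff, eq_top_iff, ← adjoin_range_X, Algebra.adjoin_le_iff]
    have hnil : ∀ b, ψ b ∈ D'.nilSubalgebra := fun b => by
      obtain ⟨N, hN⟩ := hD b
      exact D'.mem_nilSubalgebra.2 ⟨N, by rw [hiter, hN, map_zero]⟩
    rintro _ ⟨i, rfl⟩
    fin_cases i
    · have := hnil (s n e m d r Q)
      rwa [hψs] at this
    · have := hnil (t n e m d r Q)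
      rwa [hψt] at this
  have h0' : D' ≠ 0 := by
    intro h
    apply h0
    ext1 b
    apply hψ
    rw [← hcomp, h, Derivation.zero_apply, Derivation.zero_apply, map_zero]
  obtain ⟨g, hg0, hker, G, hG⟩ := hD'.exists_kerSubalgebra_eq_adjoin_variable h0'
  -- An affine change over `k(x)` keeps the generated algebra, hence also the property of being a
  -- variable.
  obtain ⟨f', a, b, hb, hf', hfne, hfc, hfp⟩ := exists_primitive_affine (R := Polynomial k) hg0
  let f := ofPolyPoly k f'
  have hff' : toPolyPoly k f = f' := toPolyPoly_ofPolyPoly f'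
  have hrat : toRatPoly k f = C b * (g - C a) := by rw [← map_toPolyPoly, hff', hf']
  have hgmem : g ∈ Algebra.adjoin (RatFunc k) {toRatPoly k f} := by
    rw [hrat]
    exact mem_adjoin_C_mul_sub_C g hb
  refine ⟨f, ⟨G, ?_⟩, le_antisymm ?_ ?_, ?_⟩
  · rw [eq_top_iff, ← hG, Algebra.adjoin_le_iff]
    rintro _ (rfl | rfl)
    · exact Algebra.adjoin_mono (by simp) hgmem
    · exact Algebra.subset_adjoin (by simp)
  · intro c hc
    obtain ⟨P, rfl⟩ := exists_evalXST_eq_of_apply_eq_zero hn hne hm hd hr hdr hD h0 hc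
    have h1 : toRatPoly k P ∈ D'.kerSubalgebra := by
      rw [← hψev]
      change D' _ = 0
      rw [hcomp, show D _ = 0 from hc, map_zero]
    have h2 : D'.kerSubalgebra ≤ Algebra.adjoin (RatFunc k) {toRatPoly k f} := by
      rw [hker, Algebra.adjoin_le_iff]
      rintro _ rfl
      exact hgmem
    have h3 := h2 h1
    rw [← map_toPolyPoly, ← map_toPolyPoly, hff'] at h3
    -- Here `k(x)[f] ∩ k[x][s,t] = k[x][f]` is used. It applies because kernel elements of `D` are
    -- already polynomials in `x, s, t`.
    obtain ⟨q, hq⟩ := exists_aeval_eq_of_map_mem_adjoin hfc hfp h3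
    rw [← ofPolyPoly_toPolyPoly P, ← hq, ← hff']
    exact evalXST_ofPolyPoly_aeval_mem f q
  · rw [Algebra.adjoin_le_iff]
    rintro _ (rfl | rfl)
    · exact hDx
    · change D _ = 0
      apply hψ
      rw [← hcomp, hψev, hrat, map_zero, ← algebraMap_eq, Derivation.leibniz, map_sub,
        Derivation.map_algebraMap, Derivation.map_algebraMap]
      have hg : D' g = 0 := by
        change g ∈ D'.kerSubalgebra
        rw [hker]
        exact Algebra.subset_adjoin rfl
      rw [hg]
      simp
  · let ev : MvPolynomial (Fin 3) k →ₐ[k] B n e m d r Q :=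
      aeval ![x n e m d r Q, s n e m d r Q, t n e m d r Q]
    have h1 : AlgebraicIndependent k ![(X 0 : MvPolynomial (Fin 3) k), f] := by
      apply AlgebraicIndependent.of_comp (toPolyPoly k)
      have h2 : toPolyPoly k ∘ ![(X 0 : MvPolynomial (Fin 3) k), f] = ![C Polynomial.X, f'] := by
        funext i
        fin_cases i
        · simp [toPolyPoly]
        · exact hff'
      rw [h2]
      exact algebraicIndependent_C_X hfne hfc
    have h3 := h1.map' (f := ev) hinj
    have h4 : ev ∘ ![(X 0 : MvPolynomial (Fin 3) k), f] =
        ![x n e m d r Q, evalXST n e m d r Q f] := by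
      funext i
      fin_cases i
      · simp [ev]
      · rfl
    rwa [h4] at h3

end NewClass

theorem mainTheorem11 {k : Type*} [Field k] [CharZero k] (n e m d r : ℕ)
    (hn : 1 ≤ n) (hne : (n, e) ≠ (1, 0)) (hm : 2 ≤ m) (hd : 2 ≤ d) (hr : 2 ≤ r)
    (hdr : Nat.gcd d r = 1) (Q : MvPolynomial (Fin 3) k) :
    AlgebraicIndependent k
        ![NewClass.x n e m d r Q, NewClass.s n e m d r Q, NewClass.t n e m d r Q] ∧
    ∀ D : Derivation k (NewClass.B n e m d r Q) (NewClass.B n e m d r Q),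
      D.IsLocallyNilpotent → D ≠ 0 →
      ∃ f : MvPolynomial (Fin 3) k,
        IsPolyVariable (RatFunc k) (NewClass.toRatPoly k f) ∧
        D.kerSubalgebra =
          Algebra.adjoin k {NewClass.x n e m d r Q, NewClass.evalXST n e m d r Q f} ∧
        AlgebraicIndependent k ![NewClass.x n e m d r Q, NewClass.evalXST n e m d r Q f] :=
  -- Algebraic independence is by definition injectivity of the evaluation map.
  ⟨NewClass.evalXST_injective hn hm hd, fun _ hD h0 =>
    NewClass.exists_kerSubalgebra_eq_adjoin hn hne hm hd hr hdr hD h0⟩
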